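/- Monoidal categories, monoidal functors and monoidal transformations are symmetric, unital and strong. Let $\Lambda$ be a commutative noetherian ring of global dimension at most $2$, and let $\mathrm{Mod}^f(\Lambda)$ be the symmetric monoidal category of finitely generated $\Lambda$-modules. A $\Lambda$-linear abelian monoidal category is called right exact if $\otimes$ is $\Lambda$-linear and right exact in each variable. **Diagrams.** A graded diagram $\mathscr D$ is a directed graph with a parity $|v|\in\mathbb Z/2$ for each vertex; an edge $\gamma:v\to v'$ has parity $|\gamma|=|v|-|v'|$. A commutative product structure with unit on it consists of: vertices $v\times w$ with $|v\times w|=|v|+|w|$; for each edge $\gamma:v\to v'$ and vertex $w$, edges $\gamma\times\mathrm{id}:v\times w\to v'\times w$ and $\mathrm{id}\times\gamma:w\times v\to w\times v'$; edges $\alpha_{v,w}:v\times w\to w\times v$, $\beta_{v,w,u}:v\times(w\times u)\to(v\times w)\times u$, $\beta'_{v,w,u}:(v\times w)\times u\to v\times(w\times u)$; and a vertex $\mathbf 1$ of parity $0$ with edges $u_v:v\to\mathbf 1\times v$. **Representations.** A representation of $\mathscr D$ in a category is a morphism of directed graphs. A unital graded multiplicative (ugm) representation in an additive monoidal category is a representation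 $R$ with isomorphisms $\tau_{v,w}:R(v\times w)\to R(v)\otimes R(w)$ and $\mathbb 1\cong R(\mathbf 1)$ such that, under $\tau$: $R(\alpha_{v,w})$ corresponds to $(-1)^{|v||w|}$ times the symmetry; $R(\gamma\times\mathrm{id})$ corresponds to $(-1)^{|\gamma||w|}R(\gamma)\otimes\mathrm{id}$; $R(\mathrm{id}\times\gamma)$ corresponds to $\mathrm{id}\otimes R(\gamma)$; $R(\beta)$ and $R(\beta')$ correspond to the associativity isomorphism and its inverse; and all $R(u_v)$ are isomorphisms. A ugm isomorphism is a family of isomorphisms $R(v)\cong R'(v)$ compatible with all edges, with $\tau$, and with the identifications $\mathbb 1\cong R(\mathbf 1)$, $\mathbb 1\cong R'(\mathbf 1)$. The composite of a ugm representation with an additive monoidal functor is ugm in the evident way. **Nori's category.** Let $T:\mathscr D\to\mathrm{Mod}^f(\Lambda)$ be a ugm representation with all $T(v)$ projective. For a finite set $F$ of vertices let $\mathrm{End}(T|_F)\subset\prod_{v\in F}\mathrm{End}_\Lambda(T(v))$ be the algebra of families compatible with all edges between vertices in $F$, and put $\mathcal C(T)=\varinjlim_F\mathrm{Mod}^f(\mathrm{End}(T|_F))$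 (filtered 2-colimit), with forgetful functor $\mathrm{ff}_T:\mathcal C(T)\to\mathrm{Mod}^f(\Lambda)$ and tautological representation $\tilde T:\mathscr D\to\mathcal C(T)$, so that $\mathrm{ff}_T\tilde T=T$. **Theorem.** The $\Lambda$-linear category $\mathcal C(T)$ is abelian and $\mathrm{ff}_T$ is faithful, exact and $\Lambda$-linear. There is a right exact monoidal structure on $\mathcal C(T)$, together with a monoidal structure on $\mathrm{ff}_T$ and a ugm structure on $\tilde T$, such that $\mathrm{ff}_T\tilde T=T$ as ugm representations. With any such structure $\mathcal C(T)$ has the following universal property. Let $\mathcal C$ be a right exact monoidal abelian $\Lambda$-linear category, $S:\mathscr D\to\mathcal C$ a ugm representation, $\mathrm{ff}_S:\mathcal C\to\mathrm{Mod}^f(\Lambda)$ a faithful exact $\Lambda$-linear monoidal functor, and $\theta:\mathrm{ff}_S S\cong T$ a ugm isomorphism (for example the identity, if $\mathrm{ff}_S S=T$). Consider triples $(F,\alpha,\beta)$ of a monoidal functor $F:\mathcal C(T)\to\mathcal C$, a ugm isomorphism $\alpha:S\cong F\tilde T$ and a monoidal isomorphism $\beta:\mathrm{ff}_T\cong\mathrm{ff}_S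 F$ with $\mathrm{ff}_S(\alpha_v)=\beta_{\tilde T(v)}\circ\theta_v$ for all vertices $v$. Then there is such a triple $(F,\alpha,\beta)$ in which $F$ is faithful, exact and $\Lambda$-linear; and for every such triple $(F',\alpha',\beta')$ there is a unique monoidal isomorphism $\gamma:F'\cong F$ with $\gamma_{\tilde T(v)}\circ\alpha'_v=\alpha_v$ for all $v$ and $\mathrm{ff}_S(\gamma_X)\circ\beta'_X=\beta_X$ for all $X\in\mathcal C(T)$. -/

import Mathlib

open CategoryTheory CategoryTheory.Limits MonoidalCategory

universe w v u v₁ u₁ v₂ u₂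

noncomputable section

/-! ### Graded diagrams with a commutative product structure -/

/-- A graded diagram: a directed graph (vertices `V`, edges `v ⟶ w`) together with a parity for
every vertex. An edge `γ : v ⟶ v'` has parity `deg v - deg v'`. -/
class GradedDiagram (V : Type v) extends Quiver.{w} V where
  /-- the parity of a vertex -/
  deg : V → ZMod 2

/-- A commutative product structure on a graded diagram: a map of graded diagrams
`× : V × V → V`, where the edges of the product diagram `V × V` are the pairs `(γ, id)` and
`(id, γ)`, together with a choice of commutativity and associativity edges. -/
class CommProductDiagram (V : Type v) extends GradedDiagram.{w} V where
  /-- the product `v × w` of vertices -/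
  vprod : V → V → V
  deg_prod : ∀ v w, deg (vprod v w) = deg v + deg w
  /-- the edge `γ × id : v × w ⟶ v' × w` -/
  edgeProd : ∀ {v v' : V}, (v ⟶ v') → ∀ w : V, (vprod v w ⟶ vprod v' w)
  /-- the edge `id × γ : w × v ⟶ w × v'` -/
  prodEdge : ∀ (w : V) {v v' : V}, (v ⟶ v') → (vprod w v ⟶ vprod w v')
  /-- commutativity edges -/
  commEdge : ∀ v w, (vprod v w ⟶ vprod w v)
  /-- associativity edges -/
  assocEdge : ∀ v w x, (vprod v (vprod w x) ⟶ vprod (vprod v w) x)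
  /-- associativity edges in the other direction -/
  assocEdge' : ∀ v w x, (vprod (vprod v w) x ⟶ vprod v (vprod w x))

/-- A graded diagram with commutative product structure and unit: an even vertex `one` with a
choice of edges `v ⟶ one × v`. -/
class UnitalProductDiagram (V : Type v) extends CommProductDiagram.{w} V where
  /-- the unit vertex -/
  one : V
  deg_one : deg one = 0
  /-- the unit edges -/
  unitEdge : ∀ v, (v ⟶ vprod one v)

open GradedDiagram CommProductDiagram UnitalProductDiagram

/-- The sign `(-1)^a` of a parity `a`. -/
def koszulSign (a : ZMod 2) : ℤ := (-1) ^ a.val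

/-! ### Unital graded multiplicative representations

A representation of the diagram `V` in a category `C` is a morphism of directed graphs, that is a
prefunctor `V ⥤q C`. -/

/-- The data of a unital graded multiplicative representation on top of a representation `R`:
isomorphisms `R (v × w) ≅ R v ⊗ R w` and `𝟙 ≅ R one`. -/
structure ProductData {V : Type v} [UnitalProductDiagram.{w} V]
    {C : Type u₁} [Category.{v₁} C] [MonoidalCategory C] (R : V ⥤q C) where
  /-- the multiplicativity isomorphisms -/
  τ : ∀ v w : V, R.obj (vprod v w) ≅ R.obj v ⊗ R.obj w
  /-- the identification of the value at the unit vertex with the unit object -/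
  unitIso : 𝟙_ C ≅ R.obj one

namespace ProductData

section

variable {V : Type v} [UnitalProductDiagram.{w} V]
  {C : Type u₁} [Category.{v₁} C] [MonoidalCategory C]
  {D : Type u₂} [Category.{v₂} D] [MonoidalCategory D]

/-- The axioms of a unital graded multiplicative (ugm) representation in an additive symmetric
monoidal category. -/
structure IsUGM [Preadditive C] [SymmetricCategory C] {R : V ⥤q C} (r : ProductData R) :
    Prop where
  /-- commutativity edges are sent to the symmetry, up to the sign `(-1)^(|v||w|)` -/
  comm : ∀ v w : V, (r.τ v w).inv ≫ R.map (commEdge v w) ≫ (r.τ w v).hom =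
    koszulSign (deg v * deg w) • (β_ (R.obj v) (R.obj w)).hom
  /-- compatibility with `γ × id`, up to the sign `(-1)^(|γ||w|)` -/
  edgeProd : ∀ {v v' : V} (γ : v ⟶ v') (w : V),
    R.map (CommProductDiagram.edgeProd γ w) ≫ (r.τ v' w).hom =
      (r.τ v w).hom ≫ (koszulSign ((deg v - deg v') * deg w) • (R.map γ ▷ R.obj w))
  /-- compatibility with `id × γ` -/
  prodEdge : ∀ (w : V) {v v' : V} (γ : v ⟶ v'),
    R.map (CommProductDiagram.prodEdge w γ) ≫ (r.τ w v').hom =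
      (r.τ w v).hom ≫ (R.obj w ◁ R.map γ)
  /-- associativity edges are sent to the associativity isomorphism -/
  assoc : ∀ v w x : V,
    R.map (assocEdge v w x) ≫ (r.τ (vprod v w) x).hom ≫ ((r.τ v w).hom ▷ R.obj x) =
      (r.τ v (vprod w x)).hom ≫ (R.obj v ◁ (r.τ w x).hom) ≫
        (α_ (R.obj v) (R.obj w) (R.obj x)).inv
  assoc' : ∀ v w x : V,
    R.map (assocEdge' v w x) ≫ (r.τ v (vprod w x)).hom ≫ (R.obj v ◁ (r.τ w x).hom) =
      (r.τ (vprod v w) x).hom ≫ ((r.τ v w).hom ▷ R.obj x) ≫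
        (α_ (R.obj v) (R.obj w) (R.obj x)).hom
  /-- unit edges are sent to isomorphisms (they need not be the ones determined by `τ` and
  `unitIso`, although this is a typical case) -/
  unit : ∀ v : V, IsIso (R.map (unitEdge v))

/-- The composite of a representation with a functor. -/
abbrev _root_.Prefunctor.andThen {V : Type v} [Quiver.{w} V] {C : Type u₁} [Category.{v₁} C]
    {D : Type u₂} [Category.{v₂} D] (R : V ⥤q C) (G : C ⥤ D) : V ⥤q D where
  obj v := G.obj (R.obj v)
  map γ := G.map (R.map γ)

/-- The data induced on the composite of a representation with a monoidal functor. -/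
def map {R : V ⥤q C} (r : ProductData R) (G : C ⥤ D) [G.Monoidal] :
    ProductData (R.andThen G) where
  τ v w :=
    { hom := G.map (r.τ v w).hom ≫ Functor.OplaxMonoidal.δ G (R.obj v) (R.obj w)
      inv := Functor.LaxMonoidal.μ G (R.obj v) (R.obj w) ≫ G.map (r.τ v w).inv
      hom_inv_id := by simp
      inv_hom_id := by simp }
  unitIso :=
    { hom := Functor.LaxMonoidal.ε G ≫ G.map r.unitIso.hom
      inv := G.map r.unitIso.inv ≫ Functor.OplaxMonoidal.η G
      hom_inv_id := by simp
      inv_hom_id := by simp }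

/-- A ugm transformation: a family of morphisms compatible with the edges, the isomorphisms `τ`,
and the identifications at the unit vertex. -/
structure IsTransformation {R R' : V ⥤q C} (r : ProductData R) (r' : ProductData R')
    (η : ∀ v : V, R.obj v ⟶ R'.obj v) : Prop where
  natural : ∀ {v w : V} (γ : v ⟶ w), R.map γ ≫ η w = η v ≫ R'.map γ
  tensor : ∀ v w : V, η (vprod v w) ≫ (r'.τ v w).hom = (r.τ v w).hom ≫ (η v ⊗ₘ η w)
  unit : r.unitIso.hom ≫ η one = r'.unitIso.hom

/-- A ugm isomorphism. -/
structure UGMIso {R R' : V ⥤q C} (r : ProductData R) (r' : ProductData R') where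
  /-- the components -/
  app : ∀ v : V, R.obj v ≅ R'.obj v
  isTransformation : IsTransformation r r' (fun v => (app v).hom)

end

end ProductData

/-! ### Right exact monoidal categories -/

/-- The tensor product of the `Λ`-linear monoidal category `C` is `Λ`-linear and right exact in
each variable. -/
class RightExactMonoidal (Λ : Type u) [CommRing Λ] (C : Type u₁) [Category.{v₁} C]
    [Preadditive C] [Linear Λ C] [MonoidalCategory C] : Prop
    extends MonoidalPreadditive C, MonoidalLinear Λ C where
  tensorLeft : ∀ X : C, PreservesFiniteColimits (tensorLeft X)
  tensorRight : ∀ X : C, PreservesFiniteColimits (tensorRight X)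

/-! ### Nori's category -/

section Nori

variable {Λ : Type u} [CommRing Λ] {V : Type v} [Quiver.{w} V]

/-- The algebra `End(T|_F)` of the restriction of a representation `T` to the full subdiagram with
finite vertex set `F`: families of endomorphisms of the `T v`, `v ∈ F`, compatible with all edges
between vertices of `F`. -/
def endAlg (T : V ⥤q FGModuleCat.{u} Λ) (F : Finset V) :
    Subalgebra Λ (∀ v : F, Module.End Λ (T.obj v.1)) where
  carrier := {e | ∀ (v w : F) (γ : v.1 ⟶ w.1),
    (T.map γ).hom.hom ∘ₗ e v = e w ∘ₗ (T.map γ).hom.hom}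
  mul_mem' {a b} ha hb v w γ := by
    ext x
    have h1 := LinearMap.congr_fun (hb v w γ) x
    have h2 := LinearMap.congr_fun (ha v w γ) (b v x)
    simp only [LinearMap.comp_apply] at h1 h2
    simp [h1, h2]
  add_mem' {a b} ha hb v w γ := by
    simp only [Pi.add_apply, LinearMap.comp_add, LinearMap.add_comp, ha v w γ, hb v w γ]
  algebraMap_mem' r v w γ := by
    ext x
    simp [Algebra.algebraMap_eq_smul_one]

/-- Restriction `End(T|_G) → End(T|_F)` for `F ⊆ G`. -/
def endAlgRes (T : V ⥤q FGModuleCat.{u} Λ) {F G : Finset V} (h : F ⊆ G) :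
    endAlg T G →ₐ[Λ] endAlg T F where
  toFun e := ⟨fun v => e.1 ⟨v.1, h v.2⟩, fun v w γ => e.2 ⟨v.1, h v.2⟩ ⟨w.1, h w.2⟩ γ⟩
  map_one' := rfl
  map_mul' _ _ := rfl
  map_zero' := rfl
  map_add' _ _ := rfl
  commutes' _ := rfl

/-- Nori's category `C(T)`, the 2-colimit over the finite full subdiagrams `F` of the categories
of finitely generated `End(T|_F)`-modules. An object is a finitely generated `Λ`-module with an
action of some `End(T|_F)`. (For noetherian `Λ` the algebra `End(T|_F)` is a finitely generated
`Λ`-module, so that finite generation over `End(T|_F)` and over `Λ` agree.) -/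
structure NoriCat (T : V ⥤q FGModuleCat.{u} Λ) where
  /-- the finite subdiagram -/
  supp : Finset V
  /-- the underlying `Λ`-module -/
  carrier : FGModuleCat.{u} Λ
  /-- the module structure over `End(T|_supp)` -/
  action : endAlg T supp →ₐ[Λ] Module.End Λ carrier

namespace NoriCat

variable {T : V ⥤q FGModuleCat.{u} Λ}

/-- `f` is `End(T|_G)`-linear. -/
def IsLinearOver {X Y : NoriCat T} (G : Finset V) (hX : X.supp ⊆ G) (hY : Y.supp ⊆ G)
    (f : X.carrier ⟶ Y.carrier) : Prop :=
  ∀ e : endAlg T G, f.hom.hom ∘ₗ X.action (endAlgRes T hX e) =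
    Y.action (endAlgRes T hY e) ∘ₗ f.hom.hom

lemma IsLinearOver.mono {X Y : NoriCat T} {G G' : Finset V} {hX : X.supp ⊆ G} {hY : Y.supp ⊆ G}
    {f : X.carrier ⟶ Y.carrier} (hf : IsLinearOver G hX hY f) (h : G ⊆ G') :
    IsLinearOver G' (hX.trans h) (hY.trans h) f :=
  fun e => hf (endAlgRes T h e)

/-- Morphisms in the filtered 2-colimit: the colimit over `G` of the modules of
`End(T|_G)`-linear maps. As the transition maps are inclusions inside the module of all
`Λ`-linear maps, this is the union. -/
def homs (X Y : NoriCat T) : Submodule Λ (X.carrier ⟶ Y.carrier) where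
  carrier := {f | ∃ (G : Finset V) (hX : X.supp ⊆ G) (hY : Y.supp ⊆ G), IsLinearOver G hX hY f}
  add_mem' := by
    classical
    rintro f g ⟨G, hX, hY, hf⟩ ⟨G', hX', hY', hg⟩
    refine ⟨G ∪ G', hX.trans Finset.subset_union_left, hY.trans Finset.subset_union_left,
      fun e => ?_⟩
    have h1 := hf.mono (Finset.subset_union_left (s₂ := G')) e
    have h2 := hg.mono (Finset.subset_union_right (s₁ := G)) e
    change (f.hom.hom + g.hom.hom) ∘ₗ _ = _ ∘ₗ (f.hom.hom + g.hom.hom)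
    rw [LinearMap.add_comp, LinearMap.comp_add, h1, h2]
  zero_mem' := by
    classical
    refine ⟨X.supp ∪ Y.supp, Finset.subset_union_left, Finset.subset_union_right, fun e => ?_⟩
    change (0 : X.carrier →ₗ[Λ] Y.carrier) ∘ₗ _ = _ ∘ₗ (0 : X.carrier →ₗ[Λ] Y.carrier)
    rw [LinearMap.zero_comp, LinearMap.comp_zero]
  smul_mem' := by
    rintro c f ⟨G, hX, hY, hf⟩
    refine ⟨G, hX, hY, fun e => ?_⟩
    change (c • f.hom.hom) ∘ₗ _ = _ ∘ₗ (c • f.hom.hom)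
    rw [LinearMap.smul_comp, LinearMap.comp_smul, hf e]

lemma id_mem_homs (X : NoriCat T) : 𝟙 X.carrier ∈ homs X X :=
  ⟨X.supp, subset_rfl, subset_rfl, fun _ => rfl⟩

lemma comp_mem_homs {X Y Z : NoriCat T} {f : X.carrier ⟶ Y.carrier} {g : Y.carrier ⟶ Z.carrier}
    (hf : f ∈ homs X Y) (hg : g ∈ homs Y Z) : f ≫ g ∈ homs X Z := by
  classical
  obtain ⟨G, hX, hY, hf⟩ := hf
  obtain ⟨G', hY', hZ', hg⟩ := hg
  refine ⟨G ∪ G', hX.trans Finset.subset_union_left, hZ'.trans Finset.subset_union_right,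
    fun e => ?_⟩
  have h1 := hf.mono (Finset.subset_union_left (s₂ := G')) e
  have h2 := hg.mono (Finset.subset_union_right (s₁ := G)) e
  change (g.hom.hom ∘ₗ f.hom.hom) ∘ₗ _ = _ ∘ₗ (g.hom.hom ∘ₗ f.hom.hom)
  rw [LinearMap.comp_assoc, h1, ← LinearMap.comp_assoc, h2, LinearMap.comp_assoc]

instance : Category (NoriCat T) where
  Hom X Y := homs X Y
  id X := ⟨𝟙 X.carrier, id_mem_homs X⟩
  comp f g := ⟨f.1 ≫ g.1, comp_mem_homs f.2 g.2⟩
  id_comp f := Subtype.ext (Category.id_comp f.1)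
  comp_id f := Subtype.ext (Category.comp_id f.1)
  assoc f g h := Subtype.ext (Category.assoc f.1 g.1 h.1)

instance : Preadditive (NoriCat T) where
  homGroup X Y := inferInstanceAs (AddCommGroup (homs X Y))
  add_comp _ _ _ f f' g := Subtype.ext (Preadditive.add_comp _ _ _ f.1 f'.1 g.1)
  comp_add _ _ _ f g g' := Subtype.ext (Preadditive.comp_add _ _ _ f.1 g.1 g'.1)

instance : Linear Λ (NoriCat T) where
  homModule X Y := inferInstanceAs (Module Λ (homs X Y))
  smul_comp _ _ _ c f g := Subtype.ext (Linear.smul_comp _ _ _ c f.1 g.1)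
  comp_smul _ _ _ f c g := Subtype.ext (Linear.comp_smul _ _ _ f.1 c g.1)

variable (T)

/-- The forgetful functor `ff_T : C(T) ⥤ fMod Λ`. -/
def forget : NoriCat T ⥤ FGModuleCat.{u} Λ where
  obj X := X.carrier
  map f := f.1

instance : (forget T).Faithful where
  map_injective h := Subtype.ext h

instance : (forget T).Additive where
  map_add := rfl

instance : (forget T).Linear Λ where
  map_smul _ _ := rfl

/-- The universal representation `T̃ : V ⥤q C(T)`, sending `v` to `T v` with its tautological
action of `End(T|_{v})`. By construction `ff_T ∘ T̃ = T`. -/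
def rep : V ⥤q NoriCat T where
  obj v :=
    { supp := {v}
      carrier := T.obj v
      action := (Pi.evalAlgHom Λ (fun x : ({v} : Finset V) => Module.End Λ (T.obj x.1))
        ⟨v, Finset.mem_singleton_self v⟩).comp (endAlg T {v}).val }
  map {v w} γ := ⟨T.map γ, by
    classical
    refine ⟨{v, w}, by simp, by simp, fun e => ?_⟩
    exact e.2 ⟨v, by simp⟩ ⟨w, by simp⟩ γ⟩

end NoriCat

end Nori

/-! ### The monoidal structure on Nori's category and its universal property -/

section Universal

variable {Λ : Type u} [CommRing Λ] {V : Type v} [UnitalProductDiagram.{w} V]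
  {T : V ⥤q FGModuleCat.{u} Λ}

/-- The requirements on the monoidal structure of `C(T)`: it is `Λ`-linear and right exact, the
representation `T̃` is ugm, and the identification `ff_T ∘ T̃ = T` is a ugm isomorphism, for the
monoidal functor `ff_T`. -/
structure IsNoriMonoidal [MonoidalCategory (NoriCat T)] [SymmetricCategory (NoriCat T)]
    [(NoriCat.forget T).Braided] (t : ProductData T) (t' : ProductData (NoriCat.rep T)) :
    Prop where
  rightExact : RightExactMonoidal Λ (NoriCat T)
  isUGM : t'.IsUGM
  forget_rep : ProductData.IsTransformation (t'.map (NoriCat.forget T)) t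
    (fun v => 𝟙 (T.obj v))

/-- Given a factorization of `T` through a ugm representation `S` in `C` and a monoidal functor
`fS : C ⥤ fMod Λ`, with `θ` the ugm isomorphism `fS ∘ S ≅ T`: a monoidal functor `F : C(T) ⥤ C`
together with a ugm isomorphism `α : S ≅ F ∘ T̃` and a monoidal isomorphism `β : ff_T ≅ fS ∘ F`
such that `fS α = β T̃` modulo `θ`. -/
structure NoriLift [MonoidalCategory (NoriCat T)] [SymmetricCategory (NoriCat T)]
    [(NoriCat.forget T).Braided] {t : ProductData T} (t' : ProductData (NoriCat.rep T))
    {C : Type u₁} [Category.{v₁} C] [MonoidalCategory C] [SymmetricCategory C]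
    {S : V ⥤q C} {s : ProductData S} {fS : C ⥤ FGModuleCat.{u} Λ} [fS.Braided]
    (θ : ProductData.UGMIso (s.map fS) t) where
  /-- the functor -/
  F : NoriCat T ⥤ C
  [braided : F.Braided]
  /-- the isomorphism of the upper triangle -/
  α : ProductData.UGMIso s (t'.map F)
  /-- the isomorphism of the lower triangle -/
  β : NoriCat.forget T ≅ F ⋙ fS
  isMonoidal : NatTrans.IsMonoidal β.hom
  compat : ∀ v : V, fS.map (α.app v).hom =
    (θ.app v).hom ≫ β.hom.app ((NoriCat.rep T).obj v)

attribute [instance] NoriLift.braided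

end Universal

end

/-! An object of `NoriCat T` is a module with an action of some `End(T|_G)`, and a morphism is a
linear map that is equivariant over some larger finite vertex set. Kernels and images of such maps
are stable submodules, so abelianness and the exactness of the forgetful functor are read off from
modules. Every further construction asks whether a given linear map underlies a morphism.

Tensor product. To let `End(T|_H)` act on `X ⊗ Y` when `H` contains the products of vertices of `G`
and `G'`, a comultiplication `End(T|_H) → End(T|_G) ⊗ End(T|_G')` is needed. Now `End(T|_G)` is the
centralizer, in the endomorphisms of the direct sum of the `T v`, of the vertex projections and the
edge operators. By noetherianity finitely many commutators cut it out, so it is the kernel of a map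
of finitely generated projective modules, and global dimension at most 2 makes it projective
(`projective_of_centralizer`). Flatness then shows that the tensor product of two centralizers is
the joint centralizer on the tensor product (`exists_endTensor_map`). An element of `End(T|_H)`,
transported by `τ`, lies in it because it commutes with the edges `γ × id` and `id × γ`; the sign
cancels.

Coherence. Associativity and symmetry are morphisms on the objects `T̃ v` because the diagram has
edges for them. This propagates in two stages, one variable at a time: the regular module embeds in
a finite sum of `T̃ v` by evaluation at generators, and tensoring with flat modules keeps this
injective (`liftsHom_reg`); every object is a quotient of a finite sum of regular modules
(`liftsHom_of_reg`). Unit edges give only unspecified isomorphisms `T̃ v ≅ T̃ 1 ⊗ T̃ v`. At `1` such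
an isomorphism differs from the canonical one by a scalar, and associativity and naturality carry
the conclusion to every `v`. The coherence axioms are then inherited from modules along the faithful
forgetful functor.

Universal property. For `U : C ⥤ FGModuleCat Λ` faithful and exact, a linear map lifts to `C` as
soon as it does so after an injection or a surjection from `C`. Embed `End(T|_G)` in `U A` for a
finite sum `A` of objects `S v`. A double annihilator argument shows that its image is the common
kernel of the endomorphisms of `A` that vanish on it, so it underlies a subobject (`exists_regObj`).
Other objects are presented by regular modules and right multiplications, hence have counterparts as
cokernels (`exists_corresponds`), and morphisms lift between counterparts (`Corresponds.lifts`).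
This gives the functor. Its monoidal structure comes from the ugm structure of `S` by the same
two-stage extension (`liftsHom_tensorComparison`). Conversely the values of any lift are
counterparts (`corresponds_of_lift`), so the linear comparison of two lifts lifts to `C`; since `U`
is faithful, it is unique and automatically compatible with all structure. -/

noncomputable section

/-! ### The abelian category `C(T)` -/

section

namespace FGModuleCat

variable {Λ : Type u} [CommRing Λ]

/-- The linear map underlying a morphism of `FGModuleCat Λ`. -/
abbrev lin {A B : FGModuleCat.{u} Λ} (f : A ⟶ B) : A →ₗ[Λ] B := f.hom.hom

/-- The morphism of `FGModuleCat Λ` given by a linear map. -/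
abbrev mk {A B : FGModuleCat.{u} Λ} (f : A →ₗ[Λ] B) : A ⟶ B :=
  ObjectProperty.homMk (ModuleCat.ofHom f)

lemma lin_injective_iff_mono [IsNoetherianRing Λ] {A B : FGModuleCat.{u} Λ} (f : A ⟶ B) :
    Mono f ↔ Function.Injective (lin f) := by
  constructor
  · intro h
    exact (ModuleCat.mono_iff_injective ((forget₂ (FGModuleCat Λ) (ModuleCat Λ)).map f)).1
      inferInstance
  · intro h
    exact (forget₂ (FGModuleCat Λ) (ModuleCat Λ)).mono_of_mono_map
      ((ModuleCat.mono_iff_injective _).2 h)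

lemma lin_surjective_iff_epi [IsNoetherianRing Λ] {A B : FGModuleCat.{u} Λ} (f : A ⟶ B) :
    Epi f ↔ Function.Surjective (lin f) := by
  constructor
  · intro h
    exact (ModuleCat.epi_iff_surjective ((forget₂ (FGModuleCat Λ) (ModuleCat Λ)).map f)).1
      inferInstance
  · intro h
    exact (forget₂ (FGModuleCat Λ) (ModuleCat Λ)).epi_of_epi_map
      ((ModuleCat.epi_iff_surjective _).2 h)

lemma exact_iff [IsNoetherianRing Λ] (S : ShortComplex (FGModuleCat.{u} Λ)) :
    S.Exact ↔ ∀ x ∈ LinearMap.ker (lin S.g), x ∈ LinearMap.range (lin S.f) := by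
  rw [← S.exact_map_iff_of_faithful (forget₂ (FGModuleCat Λ) (ModuleCat Λ)),
    ShortComplex.moduleCat_exact_iff]
  rfl

end FGModuleCat

namespace NoriCat

open FGModuleCat

variable {Λ : Type u} [CommRing Λ] {V : Type v} [Quiver.{w} V] {T : V ⥤q FGModuleCat.{u} Λ}

/-- The action of `End(T|_G)` on an object supported in `G`. -/
def act (X : NoriCat T) {G : Finset V} (h : X.supp ⊆ G) : endAlg T G →ₐ[Λ] Module.End Λ X.carrier :=
  X.action.comp (endAlgRes T h)

lemma act_res (X : NoriCat T) {G G' : Finset V} (h : X.supp ⊆ G) (h' : G ⊆ G') (e : endAlg T G') :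
    X.act h (endAlgRes T h' e) = X.act (h.trans h') e := rfl

/-- The linear map underlying a morphism of `C(T)`. -/
abbrev lin {X Y : NoriCat T} (f : X ⟶ Y) : X.carrier →ₗ[Λ] Y.carrier := FGModuleCat.lin f.1

lemma hom_ext_lin {X Y : NoriCat T} {f g : X ⟶ Y} (h : lin f = lin g) : f = g :=
  Subtype.ext (FGModuleCat.hom_ext h)

lemma exists_linear {X Y : NoriCat T} (f : X ⟶ Y) : ∃ (G : Finset V) (hX : X.supp ⊆ G)
    (hY : Y.supp ⊆ G), ∀ e x, lin f (X.act hX e x) = Y.act hY e (lin f x) := by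
  obtain ⟨G, hX, hY, h⟩ := f.2
  exact ⟨G, hX, hY, fun e x => LinearMap.congr_fun (h e) x⟩

/-- A linear map that commutes with the action of some `End(T|_G)` is a morphism of `C(T)`. -/
def homMk {X Y : NoriCat T} (f : X.carrier →ₗ[Λ] Y.carrier) {G : Finset V} (hX : X.supp ⊆ G)
    (hY : Y.supp ⊆ G) (h : ∀ e x, f (X.act hX e x) = Y.act hY e (f x)) : X ⟶ Y :=
  ⟨FGModuleCat.mk f, G, hX, hY, fun e => LinearMap.ext (h e)⟩

@[simp] lemma lin_comp {X Y Z : NoriCat T} (f : X ⟶ Y) (g : Y ⟶ Z) :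
    lin (f ≫ g) = lin g ∘ₗ lin f := rfl

@[simp] lemma lin_id (X : NoriCat T) : lin (𝟙 X) = LinearMap.id := rfl

lemma mono_of_injective {X Y : NoriCat T} (f : X ⟶ Y) (h : Function.Injective (lin f)) :
    Mono f where
  right_cancellation _ _ e := hom_ext_lin <| LinearMap.ext fun x => h <|
    LinearMap.congr_fun (congrArg lin e) x

lemma epi_of_surjective {X Y : NoriCat T} (f : X ⟶ Y) (h : Function.Surjective (lin f)) :
    Epi f where
  left_cancellation _ _ e := hom_ext_lin <| LinearMap.ext fun y => by
    obtain ⟨x, rfl⟩ := h y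
    exact LinearMap.congr_fun (congrArg lin e) x

instance : (forget T).ReflectsIsomorphisms where
  reflects {X Y} f hf' := by
    obtain ⟨j, hj1, hj2⟩ : ∃ j : Y.carrier ⟶ X.carrier, f.1 ≫ j = 𝟙 _ ∧ j ≫ f.1 = 𝟙 _ := hf'.1
    obtain ⟨G, hX, hY, h⟩ := exists_linear f
    have h1 : ∀ x, lin f (FGModuleCat.lin j x) = x := fun x =>
      LinearMap.congr_fun (congrArg FGModuleCat.lin hj2) x
    have h2 : ∀ x, FGModuleCat.lin j (lin f x) = x := fun x =>
      LinearMap.congr_fun (congrArg FGModuleCat.lin hj1) x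
    refine ⟨homMk (FGModuleCat.lin j) hY hX fun e x => ?_, ?_, ?_⟩
    · rw [← h1 x, ← h, h2, h1]
    · exact hom_ext_lin (LinearMap.ext h2)
    · exact hom_ext_lin (LinearMap.ext h1)

/-- Equivariance of `g` can be tested after the injection `i`, over a vertex set on which both `i`
and the composite are equivariant. This makes linear factorizations through kernels into morphisms;
the dual below serves cokernels. -/
lemma linear_of_comp_injective {X Y Z : NoriCat T} (g : X.carrier →ₗ[Λ] Y.carrier) (i : Y ⟶ Z)
    (hi : Function.Injective (lin i)) (f : X ⟶ Z) (h : lin i ∘ₗ g = lin f) :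
    ∃ g' : X ⟶ Y, lin g' = g := by
  classical
  obtain ⟨G, hX, hZ, hf⟩ := exists_linear f
  obtain ⟨G', hY, hZ', hi'⟩ := exists_linear i
  have hf' := fun e => hf (endAlgRes T (Finset.subset_union_left (s₂ := G')) e)
  have hi'' := fun e => hi' (endAlgRes T (Finset.subset_union_right (s₁ := G)) e)
  simp only [act_res] at hf' hi''
  have h' := fun x => LinearMap.congr_fun h x
  simp only [LinearMap.comp_apply] at h'
  exact ⟨homMk g (hX.trans Finset.subset_union_left) (hY.trans Finset.subset_union_right)
    fun e x => hi (by rw [h', hf', hi'', h']), rfl⟩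

lemma linear_of_surjective_comp {X Y Z : NoriCat T} (g : Y.carrier →ₗ[Λ] Z.carrier) (p : X ⟶ Y)
    (hp : Function.Surjective (lin p)) (f : X ⟶ Z) (h : g ∘ₗ lin p = lin f) :
    ∃ g' : Y ⟶ Z, lin g' = g := by
  classical
  obtain ⟨G, hX, hZ, hf⟩ := exists_linear f
  obtain ⟨G', hX', hY, hp'⟩ := exists_linear p
  have hf' := fun e => hf (endAlgRes T (Finset.subset_union_left (s₂ := G')) e)
  have hp'' := fun e => hp' (endAlgRes T (Finset.subset_union_right (s₁ := G)) e)
  simp only [act_res] at hf' hp''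
  have h' := fun x => LinearMap.congr_fun h x
  simp only [LinearMap.comp_apply] at h'
  refine ⟨homMk g (hY.trans Finset.subset_union_right) (hZ.trans Finset.subset_union_left)
    fun e y => ?_, rfl⟩
  obtain ⟨x, rfl⟩ := hp y
  rw [h', ← hp'', h', hf']

variable [IsNoetherianRing Λ]

/-- The subobject given by a submodule that is stable under `End(T|_G)`. -/
def sub (X : NoriCat T) {G : Finset V} (hX : X.supp ⊆ G) (W : Submodule Λ X.carrier)
    (hW : ∀ e, ∀ x ∈ W, X.act hX e x ∈ W) : NoriCat T where
  supp := G
  carrier := FGModuleCat.of Λ W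
  action :=
    { toFun := fun e => (X.act hX e).restrict (hW e)
      map_one' := by ext; simp
      map_mul' := fun a b => by ext; simp
      map_zero' := by ext; simp
      map_add' := fun a b => by ext; simp
      commutes' := fun r => by ext; simp }

/-- The inclusion of a stable submodule. -/
def subι (X : NoriCat T) {G : Finset V} (hX : X.supp ⊆ G) (W : Submodule Λ X.carrier)
    (hW : ∀ e, ∀ x ∈ W, X.act hX e x ∈ W) : X.sub hX W hW ⟶ X :=
  homMk (X := X.sub hX W hW) W.subtype subset_rfl hX fun _ _ => rfl

/-- The quotient by a submodule that is stable under `End(T|_G)`. -/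
def quot (X : NoriCat T) {G : Finset V} (hX : X.supp ⊆ G) (W : Submodule Λ X.carrier)
    (hW : ∀ e, ∀ x ∈ W, X.act hX e x ∈ W) : NoriCat T where
  supp := G
  carrier := FGModuleCat.of Λ (X.carrier ⧸ W)
  action :=
    { toFun := fun e => W.mapQ W (X.act hX e) (hW e)
      map_one' := by ext; simp
      map_mul' := fun a b => by ext; simp
      map_zero' := by ext; simp
      map_add' := fun a b => by ext; simp
      commutes' := fun r => by ext; simp }

/-- The projection to the quotient by a stable submodule. -/
def quotπ (X : NoriCat T) {G : Finset V} (hX : X.supp ⊆ G) (W : Submodule Λ X.carrier)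
    (hW : ∀ e, ∀ x ∈ W, X.act hX e x ∈ W) : X ⟶ X.quot hX W hW :=
  homMk (Y := X.quot hX W hW) W.mkQ hX subset_rfl fun _ _ => rfl

/-- An injection onto the kernel is a kernel. -/
def isLimitOfInjective {K X Y : NoriCat T} {f : X ⟶ Y} (i : K ⟶ X) (w : i ≫ f = 0)
    (hi : Function.Injective (lin i)) (h : LinearMap.ker (lin f) ≤ LinearMap.range (lin i)) :
    IsLimit (KernelFork.ofι i w) :=
  have : Mono i := mono_of_injective i hi
  KernelFork.IsLimit.ofι' i w fun {A} k hk => by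
    have hk' : ∀ x, lin k x ∈ LinearMap.range (lin i) := fun x =>
      h (LinearMap.congr_fun (congrArg lin hk) x)
    let g : A.carrier →ₗ[Λ] K.carrier :=
      (LinearEquiv.ofInjective (lin i) hi).symm.toLinearMap ∘ₗ (lin k).codRestrict _ hk'
    have hg : lin i ∘ₗ g = lin k := LinearMap.ext fun x => by
      change ((LinearEquiv.ofInjective (lin i) hi)
        ((LinearEquiv.ofInjective (lin i) hi).symm _) : X.carrier) = _
      rw [LinearEquiv.apply_symm_apply]
      rfl
    have hg' := linear_of_comp_injective g i hi k hg
    exact ⟨hg'.choose, hom_ext_lin (by rw [lin_comp, hg'.choose_spec, hg])⟩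

/-- A surjection whose kernel is the image is a cokernel. -/
def isColimitOfSurjective {X Y Q : NoriCat T} {f : X ⟶ Y} (p : Y ⟶ Q) (w : f ≫ p = 0)
    (hp : Function.Surjective (lin p)) (h : LinearMap.ker (lin p) ≤ LinearMap.range (lin f)) :
    IsColimit (CokernelCofork.ofπ p w) :=
  have : Epi p := epi_of_surjective p hp
  CokernelCofork.IsColimit.ofπ' p w fun {A} k hk => by
    have hk' : LinearMap.ker (lin p) ≤ LinearMap.ker (lin k) := fun x hx => by
      obtain ⟨y, rfl⟩ := h hx
      exact LinearMap.congr_fun (congrArg lin hk) y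
    let g : Q.carrier →ₗ[Λ] A.carrier :=
      (LinearMap.ker (lin p)).liftQ (lin k) hk' ∘ₗ
        ((lin p).quotKerEquivOfSurjective hp).symm.toLinearMap
    have hg : g ∘ₗ lin p = lin k := LinearMap.ext fun x => by
      have : ((lin p).quotKerEquivOfSurjective hp).symm (lin p x) = Submodule.Quotient.mk x := by
        rw [LinearEquiv.symm_apply_eq]
        rfl
      simp only [g, LinearMap.comp_apply, LinearEquiv.coe_coe, this]
      rfl
    have hg' := linear_of_surjective_comp g p hp k hg
    exact ⟨hg'.choose, hom_ext_lin (by rw [lin_comp, hg'.choose_spec, hg])⟩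

/-- Equivariance over `G` makes the linear kernel stable under `End(T|_G)`; the kernel object
therefore takes `G` as support, which may be larger than that of `X`. -/
lemma exists_kernel {X Y : NoriCat T} (f : X ⟶ Y) : ∃ (K : NoriCat T) (i : K ⟶ X)
    (_ : i ≫ f = 0), Function.Injective (lin i) ∧
      LinearMap.ker (lin f) ≤ LinearMap.range (lin i) := by
  obtain ⟨G, hX, hY, h⟩ := exists_linear f
  have hW : ∀ e, ∀ x ∈ LinearMap.ker (lin f), X.act hX e x ∈ LinearMap.ker (lin f) := by
    intro e x hx
    rw [LinearMap.mem_ker] at hx ⊢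
    rw [h, hx, map_zero]
  refine ⟨X.sub hX _ hW, X.subι hX _ hW, hom_ext_lin (LinearMap.ext fun x => x.2),
    Subtype.val_injective, fun x hx => ⟨⟨x, hx⟩, rfl⟩⟩

omit [IsNoetherianRing Λ] in
lemma exists_cokernel {X Y : NoriCat T} (f : X ⟶ Y) : ∃ (Q : NoriCat T) (p : Y ⟶ Q)
    (_ : f ≫ p = 0), Function.Surjective (lin p) ∧
      LinearMap.ker (lin p) ≤ LinearMap.range (lin f) := by
  obtain ⟨G, hX, hY, h⟩ := exists_linear f
  have hW : ∀ e, ∀ x ∈ LinearMap.range (lin f), Y.act hY e x ∈ LinearMap.range (lin f) := by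
    rintro e _ ⟨x, rfl⟩
    exact ⟨_, h e x⟩
  refine ⟨Y.quot hY _ hW, Y.quotπ hY _ hW, hom_ext_lin (LinearMap.ext fun x => ?_),
    Submodule.mkQ_surjective _, fun x hx => ?_⟩
  · exact (Submodule.Quotient.mk_eq_zero _).2 ⟨x, rfl⟩
  · exact (Submodule.Quotient.mk_eq_zero _).1 hx

instance : HasKernels (NoriCat T) where
  has_limit f := by
    obtain ⟨K, i, w, h1, h2⟩ := exists_kernel f
    exact ⟨⟨_, isLimitOfInjective i w h1 h2⟩⟩

instance : HasCokernels (NoriCat T) where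
  has_colimit f := by
    obtain ⟨Q, p, w, h1, h2⟩ := exists_cokernel f
    exact ⟨⟨_, isColimitOfSurjective p w h1 h2⟩⟩

/-- The direct sum of two objects of `C(T)`. -/
def prod (X Y : NoriCat T) : NoriCat T := by
  classical exact
  { supp := X.supp ∪ Y.supp
    carrier := FGModuleCat.of Λ (X.carrier × Y.carrier)
    action :=
      { toFun := fun e => (X.act Finset.subset_union_left e).prodMap
          (Y.act Finset.subset_union_right e)
        map_one' := by ext <;> simp
        map_mul' := fun a b => by ext <;> simp
        map_zero' := by ext <;> simp
        map_add' := fun a b => by ext <;> simp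
        commutes' := fun r => by ext <;> simp } }

omit [IsNoetherianRing Λ] in
lemma hasBinaryBiproduct (X Y : NoriCat T) : HasBinaryBiproduct X Y := by
  classical
  let b : BinaryBicone X Y :=
    { pt := X.prod Y
      fst := homMk (X := X.prod Y) (LinearMap.fst Λ X.carrier Y.carrier) subset_rfl
        Finset.subset_union_left fun _ _ => rfl
      snd := homMk (X := X.prod Y) (LinearMap.snd Λ X.carrier Y.carrier) subset_rfl
        Finset.subset_union_right fun _ _ => rfl
      inl := homMk (Y := X.prod Y) (LinearMap.inl Λ X.carrier Y.carrier)
        Finset.subset_union_left subset_rfl fun e x =>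
          Prod.ext rfl (map_zero (Y.act Finset.subset_union_right e)).symm
      inr := homMk (Y := X.prod Y) (LinearMap.inr Λ X.carrier Y.carrier)
        Finset.subset_union_right subset_rfl fun e x =>
          Prod.ext (map_zero (X.act Finset.subset_union_left e)).symm rfl
      inl_fst := rfl
      inl_snd := rfl
      inr_fst := rfl
      inr_snd := rfl }
  exact HasBinaryBiproduct.mk ⟨b, isBinaryBilimitOfTotal b (hom_ext_lin (LinearMap.ext fun x =>
    Prod.ext (add_zero _) (zero_add _)))⟩

/-- The zero object of `C(T)`. -/
def zero (T : V ⥤q FGModuleCat.{u} Λ) : NoriCat T where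
  supp := ∅
  carrier := FGModuleCat.of Λ PUnit
  action :=
    { toFun := fun _ => 0
      map_one' := rfl
      map_mul' := fun _ _ => rfl
      map_zero' := rfl
      map_add' := fun _ _ => rfl
      commutes' := fun _ => rfl }

instance : HasZeroObject (NoriCat T) :=
  ⟨zero T, (IsZero.iff_id_eq_zero _).2 rfl⟩

instance : HasFiniteProducts (NoriCat T) :=
  have : HasBinaryBiproducts (NoriCat T) := ⟨hasBinaryBiproduct⟩
  have : HasTerminal (NoriCat T) := HasZeroObject.hasTerminal
  hasFiniteProducts_of_has_binary_and_terminal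

instance {X Y : NoriCat T} (f : X ⟶ Y) : PreservesLimit (parallelPair f 0) (forget T) := by
  obtain ⟨K, i, w, h1, h2⟩ := exists_kernel f
  refine preservesLimit_of_preserves_limit_cone (isLimitOfInjective i w h1 h2)
    ((KernelFork.isLimitMapConeEquiv _ _).2 ?_)
  let S := (ShortComplex.mk i f w).map (forget T)
  have : Mono S.f := (lin_injective_iff_mono _).2 h1
  exact ((exact_iff S).2 fun x hx => h2 hx).fIsKernel

instance {X Y : NoriCat T} (f : X ⟶ Y) : PreservesColimit (parallelPair f 0) (forget T) := by
  obtain ⟨Q, p, w, h1, h2⟩ := exists_cokernel f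
  refine preservesColimit_of_preserves_colimit_cocone (isColimitOfSurjective p w h1 h2)
    ((CokernelCofork.isColimitMapCoconeEquiv _ _).2 ?_)
  let S := (ShortComplex.mk f p w).map (forget T)
  have : Epi S.g := (lin_surjective_iff_epi _).2 h1
  exact ((exact_iff S).2 fun x hx => h2 hx).gIsCokernel

/-- The forgetful functor reflects isomorphisms and preserves kernels and cokernels, so it carries
this comparison, up to isomorphism, to the invertible one for modules. -/
instance {X Y : NoriCat T} (f : X ⟶ Y) : IsIso (Abelian.coimageImageComparison f) := by
  have := IsIso.of_isIso_fac_right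
    (Abelian.PreservesCoimage.hom_coimageImageComparison (forget T) f).symm
  exact isIso_of_reflects_iso _ (forget T)

instance : Abelian (NoriCat T) := Abelian.ofCoimageImageComparisonIsIso

lemma abelian_toPreadditive :
    (inferInstance : Abelian (NoriCat T)).toPreadditive = (inferInstance : Preadditive (NoriCat T)) :=
  rfl

instance : PreservesFiniteLimits (forget T) :=
  Functor.preservesFiniteLimits_of_preservesKernels _

instance : PreservesFiniteColimits (forget T) :=
  Functor.preservesFiniteColimits_of_preservesCokernels _

end NoriCat

end

/-! ### Linear maps that lift along a faithful exact functor -/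

section

namespace FGModuleCat

variable {Λ : Type u} [CommRing Λ]

@[simp] lemma lin_comp {A B C : FGModuleCat.{u} Λ} (f : A ⟶ B) (g : B ⟶ C) :
    lin (f ≫ g) = lin g ∘ₗ lin f := rfl

end FGModuleCat

open FGModuleCat

namespace CategoryTheory.Functor

variable {Λ : Type u} [CommRing Λ] {C : Type u₁} [Category.{v₁} C]
  (U : C ⥤ FGModuleCat.{u} Λ)

/-- The linear map underlying the image of a morphism under a functor to modules. -/
abbrev linMap {A B : C} (f : A ⟶ B) : U.obj A →ₗ[Λ] U.obj B := lin (U.map f)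

/-- A linear map lifts to a morphism along `U`. -/
def Lifts {A B : C} (f : U.obj A →ₗ[Λ] U.obj B) : Prop := ∃ g : A ⟶ B, U.linMap g = f

variable {U}

lemma linMap_comp {A B D : C} (f : A ⟶ B) (g : B ⟶ D) :
    U.linMap (f ≫ g) = U.linMap g ∘ₗ U.linMap f := by
  rw [linMap, U.map_comp]
  rfl

lemma linMap_comp_apply {A B D : C} (f : A ⟶ B) (g : B ⟶ D) (x : U.obj A) :
    U.linMap (f ≫ g) x = U.linMap g (U.linMap f x) := by
  rw [linMap_comp]
  rfl

lemma linMap_id (A : C) : U.linMap (𝟙 A) = LinearMap.id := by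
  rw [linMap, U.map_id]
  rfl

lemma linMap_injective [U.Faithful] {A B : C} {f g : A ⟶ B} (h : U.linMap f = U.linMap g) :
    f = g :=
  U.map_injective (FGModuleCat.hom_ext h)

lemma lifts_linMap {A B : C} (g : A ⟶ B) : U.Lifts (U.linMap g) := ⟨g, rfl⟩

lemma Lifts.comp {A B D : C} {g : U.obj B →ₗ[Λ] U.obj D} {f : U.obj A →ₗ[Λ] U.obj B}
    (hg : U.Lifts g) (hf : U.Lifts f) : U.Lifts (g ∘ₗ f) := by
  obtain ⟨g, rfl⟩ := hg
  obtain ⟨f, rfl⟩ := hf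
  exact ⟨f ≫ g, linMap_comp f g⟩

lemma linMap_hom_inv (A B : C) (e : A ≅ B) (x : U.obj A) :
    U.linMap e.inv (U.linMap e.hom x) = x := by
  rw [← linMap_comp_apply, e.hom_inv_id, linMap_id]
  rfl

section Linear

variable [Preadditive C] [CategoryTheory.Linear Λ C] [U.Linear Λ]

lemma linMap_smul {A B : C} (r : Λ) (f : A ⟶ B) : U.linMap (r • f) = r • U.linMap f := by
  rw [linMap, U.map_smul]
  rfl

end Linear

section Additive

variable [Preadditive C] [U.Additive]

lemma linMap_add {A B : C} (f g : A ⟶ B) : U.linMap (f + g) = U.linMap f + U.linMap g := by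
  rw [linMap, U.map_add]
  rfl

lemma linMap_zero (A B : C) : U.linMap (0 : A ⟶ B) = 0 := by
  rw [linMap, U.map_zero]
  rfl

lemma linMap_sub {A B : C} (f g : A ⟶ B) : U.linMap (f - g) = U.linMap f - U.linMap g := by
  rw [linMap, U.map_sub]
  rfl

lemma linMap_sum {A B : C} {ι : Type*} (s : Finset ι) (f : ι → (A ⟶ B)) :
    U.linMap (∑ i ∈ s, f i) = ∑ i ∈ s, U.linMap (f i) := by
  classical
  induction s using Finset.induction_on with
  | empty => simp only [Finset.sum_empty, linMap_zero]
  | insert a s ha ih => rw [Finset.sum_insert ha, Finset.sum_insert ha, linMap_add, ih]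

end Additive

section Abelian

variable [Abelian C] [U.Additive] [PreservesFiniteLimits U] [PreservesFiniteColimits U]
  [IsNoetherianRing Λ]

lemma exact_linMap {S : ShortComplex C} (hS : S.Exact) (x : U.obj S.X₂)
    (hx : U.linMap S.g x = 0) : ∃ y, U.linMap S.f y = x :=
  (exact_iff (S.map U)).1 (hS.map U) x hx

variable [U.Faithful]

lemma mono_iff_injective {A B : C} (f : A ⟶ B) : Mono f ↔ Function.Injective (U.linMap f) := by
  rw [← lin_injective_iff_mono]
  exact ⟨fun _ => inferInstance, fun h => U.mono_of_mono_map h⟩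

lemma epi_iff_surjective {A B : C} (f : A ⟶ B) : Epi f ↔ Function.Surjective (U.linMap f) := by
  rw [← lin_surjective_iff_epi]
  exact ⟨fun _ => inferInstance, fun h => U.epi_of_epi_map h⟩

lemma isIso_of_bijective {A B : C} (f : A ⟶ B) (h : Function.Bijective (U.linMap f)) : IsIso f := by
  have := (mono_iff_injective f).2 h.1
  have := (epi_iff_surjective f).2 h.2
  exact isIso_of_mono_of_epi f

lemma Lifts.symm {A B : C} (e : U.obj A ≃ₗ[Λ] U.obj B) (h : U.Lifts e.toLinearMap) :
    U.Lifts e.symm.toLinearMap := by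
  obtain ⟨g, hg⟩ := h
  have hg' : ∀ x, U.linMap g x = e x := LinearMap.congr_fun hg
  have := isIso_of_bijective (U := U) g (by
    rw [hg]
    exact e.bijective)
  refine ⟨CategoryTheory.inv g, LinearMap.ext fun x => e.injective ?_⟩
  rw [← hg', ← linMap_comp_apply, IsIso.inv_hom_id, linMap_id]
  exact (e.apply_symm_apply x).symm

/-- A lift of the composite is killed by the cokernel of `g`, as this can be checked after the
faithful `U`. In an abelian category it therefore factors through the mono `g`, and injectivity
identifies the factor with `f`. -/
lemma lifts_of_comp_mono {A B D : C} (f : U.obj A →ₗ[Λ] U.obj B) (g : B ⟶ D)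
    (hg : Function.Injective (U.linMap g)) (h : U.Lifts (U.linMap g ∘ₗ f)) : U.Lifts f := by
  obtain ⟨k, hk⟩ := h
  have := (mono_iff_injective g).2 hg
  have hk' : ∀ x, U.linMap k x = U.linMap g (f x) := LinearMap.congr_fun hk
  have w : k ≫ cokernel.π g = 0 := linMap_injective (U := U) <| LinearMap.ext fun x => by
    rw [linMap_comp_apply, hk', ← linMap_comp_apply, cokernel.condition, linMap_zero, linMap_zero]
    rfl
  refine ⟨Abelian.monoLift g k w, LinearMap.ext fun x => hg ?_⟩
  rw [← linMap_comp_apply, Abelian.monoLift_comp, hk']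

lemma lifts_of_epi_comp {A B D : C} (f : U.obj A →ₗ[Λ] U.obj B) (g : D ⟶ A)
    (hg : Function.Surjective (U.linMap g)) (h : U.Lifts (f ∘ₗ U.linMap g)) : U.Lifts f := by
  obtain ⟨k, hk⟩ := h
  have := (epi_iff_surjective g).2 hg
  have hk' : ∀ x, U.linMap k x = f (U.linMap g x) := LinearMap.congr_fun hk
  have w : kernel.ι g ≫ k = 0 := linMap_injective (U := U) <| LinearMap.ext fun x => by
    rw [linMap_comp_apply, hk', ← linMap_comp_apply, kernel.condition, linMap_zero, linMap_zero]
    exact map_zero f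
  refine ⟨Abelian.epiDesc g k w, LinearMap.ext fun x => ?_⟩
  obtain ⟨y, rfl⟩ := hg x
  rw [← linMap_comp_apply, Abelian.comp_epiDesc, hk']

attribute [local instance] Abelian.hasFiniteBiproducts

omit [PreservesFiniteLimits U] [PreservesFiniteColimits U] [IsNoetherianRing Λ] [U.Faithful] in
lemma sum_biproduct {ι : Type} [Fintype ι] (B : ι → C) (x : U.obj (⨁ B)) :
    ∑ i, U.linMap (biproduct.ι B i) (U.linMap (biproduct.π B i) x) = x := by
  have h := LinearMap.congr_fun (congrArg U.linMap (biproduct.total (f := B))) x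
  rw [linMap_sum, linMap_id] at h
  rw [LinearMap.sum_apply] at h
  simp only [linMap_comp_apply] at h
  exact h

omit [PreservesFiniteLimits U] [PreservesFiniteColimits U] [IsNoetherianRing Λ] [U.Faithful] in
lemma biproduct_ext {ι : Type} [Fintype ι] (B : ι → C) {x y : U.obj (⨁ B)}
    (h : ∀ i, U.linMap (biproduct.π B i) x = U.linMap (biproduct.π B i) y) : x = y := by
  rw [← sum_biproduct B x, ← sum_biproduct B y]
  simp only [h]

/-- A linear map lifts if its composites with a jointly injective finite family of morphisms
lift. -/
lemma lifts_of_jointly_injective {A B : C} (f : U.obj A →ₗ[Λ] U.obj B) {ι : Type} [Finite ι]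
    {D : ι → C} (g : ∀ i, B ⟶ D i) (hg : ∀ x, (∀ i, U.linMap (g i) x = 0) → x = 0)
    (h : ∀ i, U.Lifts (U.linMap (g i) ∘ₗ f)) : U.Lifts f := by
  have := Fintype.ofFinite ι
  choose k hk using h
  refine lifts_of_comp_mono f (biproduct.lift g) ?_ ⟨biproduct.lift k, LinearMap.ext fun x =>
    biproduct_ext _ fun i => ?_⟩
  · rw [injective_iff_map_eq_zero]
    refine fun x hx => hg x fun i => ?_
    rw [← biproduct.lift_π g i, linMap_comp_apply, hx, map_zero]
  · rw [LinearMap.comp_apply, ← linMap_comp_apply, ← linMap_comp_apply, biproduct.lift_π,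
      biproduct.lift_π, hk]
    rfl

/-- A linear map lifts if its composites with a jointly surjective finite family of morphisms
lift. -/
lemma lifts_of_jointly_surjective {A B : C} (f : U.obj A →ₗ[Λ] U.obj B) {ι : Type} [Fintype ι]
    {D : ι → C} (g : ∀ i, D i ⟶ A) (hg : ∀ x, ∃ y : ∀ i, U.obj (D i), ∑ i, U.linMap (g i) (y i) = x)
    (h : ∀ i, U.Lifts (f ∘ₗ U.linMap (g i))) : U.Lifts f := by
  choose k hk using h
  refine lifts_of_epi_comp f (biproduct.desc g) ?_ ⟨biproduct.desc k, LinearMap.ext fun x => ?_⟩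
  · intro x
    obtain ⟨y, rfl⟩ := hg x
    refine ⟨∑ i, U.linMap (biproduct.ι D i) (y i), ?_⟩
    rw [_root_.map_sum]
    simp only [← linMap_comp_apply, biproduct.ι_desc]
  · rw [← sum_biproduct D x, _root_.map_sum, _root_.map_sum]
    refine Finset.sum_congr rfl fun i _ => ?_
    rw [← linMap_comp_apply, biproduct.ι_desc, hk, LinearMap.comp_apply, LinearMap.comp_apply,
      ← linMap_comp_apply (biproduct.ι D i), biproduct.ι_desc]

end Abelian

end CategoryTheory.Functor

end

/-! ### Projectivity of centralizers and endomorphisms of tensor products -/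

section

namespace FiniteProjective

open scoped TensorProduct

variable {Λ : Type u} [CommRing Λ]

section

variable (M N : Type*) [AddCommGroup M] [Module Λ M] [AddCommGroup N] [Module Λ N]
  [Module.Finite Λ M] [Module.Projective Λ M] [Module.Finite Λ N] [Module.Projective Λ N]

omit [Module.Finite Λ N] [Module.Projective Λ N] in
lemma exists_retract : ∃ (n : ℕ) (p : (Fin n → Λ) →ₗ[Λ] M) (i : M →ₗ[Λ] Fin n → Λ),
    p ∘ₗ i = LinearMap.id := by
  obtain ⟨n, p, i, -, -, h⟩ := Module.Finite.exists_comp_eq_id_of_projective Λ M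
  exact ⟨n, p, i, h⟩

/-- Composing with the retractions on both sides exhibits `Hom(M, N)` as a retract of the free
module `Hom(Λⁿ, Λᵐ)`. -/
lemma projective_linearMap : Module.Projective Λ (M →ₗ[Λ] N) := by
  obtain ⟨n, p, i, h⟩ := exists_retract (Λ := Λ) M
  obtain ⟨m, q, j, h'⟩ := exists_retract (Λ := Λ) N
  refine Module.Projective.of_split (M := (Fin n → Λ) →ₗ[Λ] Fin m → Λ)
    (LinearMap.lcomp Λ _ p ∘ₗ LinearMap.llcomp Λ M N (Fin m → Λ) j)
    (LinearMap.lcomp Λ _ i ∘ₗ LinearMap.llcomp Λ (Fin n → Λ) (Fin m → Λ) N q) ?_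
  ext f x
  have h1 : p (i x) = x := LinearMap.congr_fun h x
  have h2 : q (j (f x)) = f x := LinearMap.congr_fun h' (f x)
  simp [h1, h2]

/-- The canonical map `End M ⊗ End N → End (M ⊗ N)`. -/
abbrev endTensor : Module.End Λ M ⊗[Λ] Module.End Λ N →ₗ[Λ] Module.End Λ (M ⊗[Λ] N) :=
  TensorProduct.homTensorHomMap (RingHom.id Λ) M N M N

/-- For finite free modules this is a standard equivalence. Conjugation by the retractions embeds
`End M ⊗ End N` and `End (M ⊗ N)` compatibly as retracts of the free versions (`e1`, `e2`), and
bijectivity passes to retracts. -/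
lemma endTensor_bijective : Function.Bijective (endTensor (Λ := Λ) M N) := by
  obtain ⟨n, p, i, h⟩ := exists_retract (Λ := Λ) M
  obtain ⟨m, q, j, h'⟩ := exists_retract (Λ := Λ) N
  have h1 : ∀ x, p (i x) = x := LinearMap.congr_fun h
  have h2 : ∀ x, q (j x) = x := LinearMap.congr_fun h'
  have hfree : Function.Bijective (endTensor (Λ := Λ) (Fin n → Λ) (Fin m → Λ)) := by
    rw [endTensor, ← homTensorHomEquiv_toLinearMap]
    exact (homTensorHomEquiv Λ (Fin n → Λ) (Fin m → Λ) (Fin n → Λ) (Fin m → Λ)).bijective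
  -- conjugation with the retractions
  let s : Module.End Λ M →ₗ[Λ] Module.End Λ (Fin n → Λ) :=
    LinearMap.lcomp Λ _ p ∘ₗ LinearMap.llcomp Λ M M (Fin n → Λ) i
  let s' : Module.End Λ (Fin n → Λ) →ₗ[Λ] Module.End Λ M :=
    LinearMap.lcomp Λ _ i ∘ₗ LinearMap.llcomp Λ (Fin n → Λ) (Fin n → Λ) M p
  let r : Module.End Λ N →ₗ[Λ] Module.End Λ (Fin m → Λ) :=
    LinearMap.lcomp Λ _ q ∘ₗ LinearMap.llcomp Λ N N (Fin m → Λ) j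
  let r' : Module.End Λ (Fin m → Λ) →ₗ[Λ] Module.End Λ N :=
    LinearMap.lcomp Λ _ j ∘ₗ LinearMap.llcomp Λ (Fin m → Λ) (Fin m → Λ) N q
  have hs : s' ∘ₗ s = LinearMap.id := by ext f x; simp [s, s', h1]
  have hr : r' ∘ₗ r = LinearMap.id := by ext f x; simp [r, r', h2]
  have e1 : ∀ z, endTensor (Fin n → Λ) (Fin m → Λ) (TensorProduct.map s r z) =
      TensorProduct.map i j ∘ₗ endTensor M N z ∘ₗ TensorProduct.map p q := by
    intro z
    induction z with
    | zero => simp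
    | add x y hx hy => simp only [map_add, hx, hy, LinearMap.add_comp, LinearMap.comp_add]
    | tmul f g => ext x y; simp [s, r]
  have e2 : ∀ z, endTensor M N (TensorProduct.map s' r' z) =
      TensorProduct.map p q ∘ₗ endTensor (Fin n → Λ) (Fin m → Λ) z ∘ₗ TensorProduct.map i j := by
    intro z
    induction z with
    | zero => simp
    | add x y hx hy => simp only [map_add, hx, hy, LinearMap.add_comp, LinearMap.comp_add]
    | tmul f g => ext x y; simp [s', r']
  constructor
  · rw [injective_iff_map_eq_zero]
    intro z hz
    have h3 := e1 z
    rw [hz, LinearMap.zero_comp, LinearMap.comp_zero] at h3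
    have h4 := (injective_iff_map_eq_zero _).1 hfree.1 _ h3
    have h5 := congrArg (TensorProduct.map s' r') h4
    rwa [map_zero, ← LinearMap.comp_apply, ← TensorProduct.map_comp, hs, hr,
      TensorProduct.map_id] at h5
  · intro f
    obtain ⟨z, hz⟩ := hfree.2 (TensorProduct.map i j ∘ₗ f ∘ₗ TensorProduct.map p q)
    refine ⟨TensorProduct.map s' r' z, ?_⟩
    rw [e2, hz]
    have h6 : TensorProduct.map p q ∘ₗ TensorProduct.map i j = LinearMap.id := by
      rw [← TensorProduct.map_comp, h, h', TensorProduct.map_id]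
    have h7 : ∀ x, TensorProduct.map p q (TensorProduct.map i j x) = x := LinearMap.congr_fun h6
    ext x y
    simp only [TensorProduct.AlgebraTensorModule.curry_apply, LinearMap.restrictScalars_self,
      TensorProduct.curry_apply, LinearMap.comp_apply, h7]

end

/-! ### Tensoring jointly injective and jointly surjective families -/

section

variable {P E : Type*} [AddCommGroup P] [Module Λ P] [AddCommGroup E] [Module Λ E] {n : ℕ}
  {Q : Fin n → Type*} [∀ k, AddCommGroup (Q k)] [∀ k, Module Λ (Q k)]

/-- Writing `Φ` as the sum of its components followed by the coordinate inclusions avoids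
identifying the tensor product of a finite product with a product of tensor products. -/
lemma rTensor_pi_eq_zero (Φ : P →ₗ[Λ] ∀ k, Q k) (x : P ⊗[Λ] E)
    (h : ∀ k, ((LinearMap.proj k : (∀ k, Q k) →ₗ[Λ] Q k) ∘ₗ Φ).rTensor E x = 0) :
    Φ.rTensor E x = 0 := by
  have hsum : Φ = ∑ k, (LinearMap.single Λ Q k) ∘ₗ
      ((LinearMap.proj k : (∀ k, Q k) →ₗ[Λ] Q k) ∘ₗ Φ) := by
    refine LinearMap.ext fun f => ?_
    rw [LinearMap.sum_apply]
    exact (Finset.univ_sum_single _).symm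
  have h' := congrArg (LinearMap.rTensorHom (R := Λ) E) hsum
  rw [map_sum] at h'
  simp only [LinearMap.coe_rTensorHom, LinearMap.rTensor_comp] at h' h
  rw [h', LinearMap.sum_apply]
  refine Finset.sum_eq_zero fun k _ => ?_
  rw [LinearMap.comp_apply, h, map_zero]

lemma lTensor_pi_eq_zero (Φ : P →ₗ[Λ] ∀ k, Q k) (x : E ⊗[Λ] P)
    (h : ∀ k, ((LinearMap.proj k : (∀ k, Q k) →ₗ[Λ] Q k) ∘ₗ Φ).lTensor E x = 0) :
    Φ.lTensor E x = 0 := by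
  have hsum : Φ = ∑ k, (LinearMap.single Λ Q k) ∘ₗ
      ((LinearMap.proj k : (∀ k, Q k) →ₗ[Λ] Q k) ∘ₗ Φ) := by
    refine LinearMap.ext fun f => ?_
    rw [LinearMap.sum_apply]
    exact (Finset.univ_sum_single _).symm
  have h' := congrArg (LinearMap.lTensorHom (R := Λ) E) hsum
  rw [map_sum] at h'
  simp only [LinearMap.coe_lTensorHom, LinearMap.lTensor_comp] at h' h
  rw [h', LinearMap.sum_apply]
  refine Finset.sum_eq_zero fun k _ => ?_
  rw [LinearMap.comp_apply, h, map_zero]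

/-- Joint injectivity is injectivity of the single map into the product, and this is what flatness
of `E` preserves. -/
lemma rTensor_jointly_injective [Module.Flat Λ E] (g : ∀ k, P →ₗ[Λ] Q k)
    (hg : ∀ x, (∀ k, g k x = 0) → x = 0) (z : P ⊗[Λ] E) (h : ∀ k, (g k).rTensor E z = 0) :
    z = 0 := by
  have hi : Function.Injective (LinearMap.pi g) :=
    (injective_iff_map_eq_zero _).2 fun x hx => hg x fun k => congrFun hx k
  apply Module.Flat.rTensor_preserves_injective_linearMap (M := E) _ hi
  rw [map_zero]
  exact rTensor_pi_eq_zero _ _ h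

lemma rTensor_jointly_surjective (g : ∀ k, Q k →ₗ[Λ] P) (hg : ∀ x, ∃ y : ∀ k, Q k, ∑ k, g k (y k) = x)
    (z : P ⊗[Λ] E) : ∃ y : ∀ k, Q k ⊗[Λ] E, ∑ k, (g k).rTensor E (y k) = z := by
  induction z with
  | zero => exact ⟨0, by simp⟩
  | add z z' hz hz' =>
    obtain ⟨y, rfl⟩ := hz
    obtain ⟨y', rfl⟩ := hz'
    exact ⟨y + y', by simp [Finset.sum_add_distrib]⟩
  | tmul m e =>
    obtain ⟨y, rfl⟩ := hg m
    exact ⟨fun k => y k ⊗ₜ e, by simp [TensorProduct.sum_tmul]⟩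

end

/-! ### Centralizers as kernels, and their tensor products -/

section

variable {M : Type*} [AddCommGroup M] [Module Λ M] [Module.Finite Λ M] [IsNoetherianRing Λ]

/-- The commutator with finitely many elements of `R` has the centralizer of `R` as kernel. -/
lemma exists_commutator (R : Set (Module.End Λ M)) : ∃ (n : ℕ) (r : Fin n → Module.End Λ M)
    (Φ : Module.End Λ M →ₗ[Λ] Fin n → Module.End Λ M),
    (∀ k, r k ∈ R) ∧ (∀ f k, Φ f k = r k ∘ₗ f - f ∘ₗ r k) ∧
    ∀ f, Φ f = 0 ↔ ∀ r ∈ R, r ∘ₗ f = f ∘ₗ r := by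
  -- `End M` is a noetherian module, so the span of `R` is generated by finitely many elements that
  -- can be chosen in `R` itself.
  obtain ⟨t, htR, ht⟩ := (Submodule.fg_span_iff_fg_span_finset_subset R).1
    (IsNoetherian.noetherian (Submodule.span Λ R))
  let r : Fin t.card → Module.End Λ M := fun k => (t.equivFin.symm k : Module.End Λ M)
  refine ⟨t.card, r, LinearMap.pi fun k => LinearMap.llcomp Λ M M M (r k) - LinearMap.lcomp Λ M (r k),
    fun k => htR (t.equivFin.symm k).2, fun f k => rfl, fun f => ⟨fun h r' hr' => ?_, fun h => ?_⟩⟩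
  -- The operators commuting with `f` form a submodule, so commuting with the generators `t` gives
  -- commuting with all of `R`.
  · have hle : Submodule.span Λ (t : Set (Module.End Λ M)) ≤
        Subalgebra.toSubmodule (Subalgebra.centralizer Λ {f}) := by
      refine Submodule.span_le.2 fun x hx => ?_
      rintro _ rfl
      have hk := sub_eq_zero.1 (congrFun h (t.equivFin ⟨x, hx⟩))
      simp only [r, Equiv.symm_apply_apply] at hk
      exact hk.symm
    exact (hle (ht ▸ Submodule.subset_span hr') f rfl).symm
  · funext k
    exact sub_eq_zero.2 (h _ (htR (t.equivFin.symm k).2))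

variable {N : Type*} [AddCommGroup N] [Module Λ N] [Module.Finite Λ N]
  [Module.Projective Λ M] [Module.Projective Λ N]
  {A B : Type*} [AddCommGroup A] [Module Λ A] [AddCommGroup B] [Module Λ B] [Module.Flat Λ A]

omit [IsNoetherianRing Λ] in
/-- Operators on `M ⊗ N` coming from `A ⊗ B` are determined by their action. -/
lemma endTensor_map_injective (a : A →ₗ[Λ] Module.End Λ M) (b : B →ₗ[Λ] Module.End Λ N)
    (ha : Function.Injective a) (hb : Function.Injective b) :
    Function.Injective (endTensor M N ∘ₗ TensorProduct.map a b) := by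
  have := projective_linearMap (Λ := Λ) N N
  rw [← LinearMap.rTensor_comp_lTensor, LinearMap.coe_comp, LinearMap.coe_comp]
  exact (endTensor_bijective M N).1.comp
    ((Module.Flat.rTensor_preserves_injective_linearMap a ha).comp
      (Module.Flat.lTensor_preserves_injective_linearMap b hb))

/-- If `A` and `B` are the centralizers of `R` and `R'`, every operator on `M ⊗ N` that commutes
with `R ⊗ 1` and `1 ⊗ R'` comes from `A ⊗ B`. -/
lemma exists_endTensor_map (a : A →ₗ[Λ] Module.End Λ M) (b : B →ₗ[Λ] Module.End Λ N)
    {R : Set (Module.End Λ M)} {R' : Set (Module.End Λ N)}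
    (ha : ∀ f, (∀ r ∈ R, r ∘ₗ f = f ∘ₗ r) ↔ f ∈ LinearMap.range a) (ha' : Function.Injective a)
    (hb : ∀ f, (∀ r ∈ R', r ∘ₗ f = f ∘ₗ r) ↔ f ∈ LinearMap.range b)
    (f : Module.End Λ (M ⊗[Λ] N))
    (h : ∀ r ∈ R, LinearMap.rTensor N r ∘ₗ f = f ∘ₗ LinearMap.rTensor N r)
    (h' : ∀ r ∈ R', LinearMap.lTensor M r ∘ₗ f = f ∘ₗ LinearMap.lTensor M r) :
    ∃ z, endTensor M N (TensorProduct.map a b z) = f := by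
  have := projective_linearMap (Λ := Λ) N N
  have := projective_linearMap (Λ := Λ) M M
  obtain ⟨x, rfl⟩ := (endTensor_bijective M N).2 f
  obtain ⟨n, r, Φ, hr, hΦ, hΦ0⟩ := exists_commutator R
  obtain ⟨m, r', Φ', hr', hΦ', hΦ0'⟩ := exists_commutator R'
  have ex : Function.Exact a Φ := fun y => by rw [hΦ0, ha]; rfl
  have ex' : Function.Exact b Φ' := fun y => by rw [hΦ0', hb]; rfl
  -- Under the identification of `End M ⊗ End N` with `End (M ⊗ N)`, the components of `Φ ⊗ 1` are
  -- the commutators with `r k ⊗ 1`.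
  have hx : Φ.rTensor (Module.End Λ N) x = 0 := by
    have key : ∀ k, ((LinearMap.proj k : (Fin n → Module.End Λ M) →ₗ[Λ] _) ∘ₗ Φ).rTensor
        (Module.End Λ N) x = 0 := fun k => by
      apply (endTensor_bijective M N).1
      rw [map_zero, ← sub_eq_zero.2 (h _ (hr k))]
      clear h h'
      induction x with
      | zero => simp
      | add x y hx hy =>
        simp only [map_add, hx, hy, LinearMap.add_comp, LinearMap.comp_add]
        abel
      | tmul f g => ext x y; simp [hΦ, TensorProduct.sub_tmul]
    exact rTensor_pi_eq_zero Φ x key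
  -- Flatness of `End N` keeps `A → End M → (End M)ⁿ` exact, so the operator comes from `A ⊗ End N`.
  obtain ⟨y, rfl⟩ := (Module.Flat.rTensor_exact _ ex x).1 hx
  have hy : Φ'.lTensor A y = 0 := by
    have : Module.Projective Λ (Fin m → Module.End Λ N) :=
      .of_equiv' (DFinsupp.linearEquivFunOnFintype (R := Λ))
    -- The condition from `R'` is known only in `End M ⊗ (End N)ᵐ`; as `(End N)ᵐ` is flat, vanishing
    -- may be tested there instead of in `A ⊗ (End N)ᵐ`.
    apply Module.Flat.rTensor_preserves_injective_linearMap (M := Fin m → Module.End Λ N) a ha'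
    rw [map_zero, ← LinearMap.comp_apply, LinearMap.rTensor_comp_lTensor,
      ← LinearMap.lTensor_comp_rTensor, LinearMap.comp_apply]
    refine lTensor_pi_eq_zero Φ' _ fun k => ?_
    apply (endTensor_bijective M N).1
    rw [map_zero, ← sub_eq_zero.2 (h' _ (hr' k))]
    clear h h' hx
    generalize a.rTensor (Module.End Λ N) y = x
    induction x with
    | zero => simp
    | add x y hx hy =>
      simp only [map_add, hx, hy, LinearMap.add_comp, LinearMap.comp_add]
      abel
    | tmul f g => ext x y; simp [hΦ', TensorProduct.tmul_sub]
  -- Here flatness of `A` enters: it keeps `B → End N → (End N)ᵐ` exact after tensoring.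
  obtain ⟨z, rfl⟩ := (Module.Flat.lTensor_exact _ ex' y).1 hy
  refine ⟨z, ?_⟩
  rw [← LinearMap.rTensor_comp_lTensor]
  rfl

omit [IsNoetherianRing Λ] in
/-- The kernel of a map of finitely generated projective modules is projective over a ring of
global dimension at most `2`. -/
lemma projective_ker {P Q : Type u} [AddCommGroup P] [Module Λ P] [AddCommGroup Q] [Module Λ Q]
    [Module.Projective Λ P] [Module.Projective Λ Q]
    (hΛ : ∀ M : ModuleCat.{u} Λ, HasProjectiveDimensionLE M 2) (f : P →ₗ[Λ] Q) :
    Module.Projective Λ (LinearMap.ker f) := by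
  let S : ShortComplex (ModuleCat.{u} Λ) := ShortComplex.mk
    (ModuleCat.ofHom (LinearMap.ker f).subtype) (ModuleCat.ofHom f.rangeRestrict) (by
      ext x
      exact x.2)
  let S' : ShortComplex (ModuleCat.{u} Λ) := ShortComplex.mk
    (ModuleCat.ofHom (LinearMap.range f).subtype) (ModuleCat.ofHom (LinearMap.range f).mkQ) (by
      ext x
      exact (Submodule.Quotient.mk_eq_zero _).2 x.2)
  have hS : S.ShortExact :=
    { exact := (ShortComplex.moduleCat_exact_iff S).2 fun x hx => ⟨⟨x, congrArg Subtype.val hx⟩, rfl⟩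
      mono_f := (ModuleCat.mono_iff_injective _).2 Subtype.val_injective
      epi_g := (ModuleCat.epi_iff_surjective _).2 f.surjective_rangeRestrict }
  have hS' : S'.ShortExact :=
    { exact := (ShortComplex.moduleCat_exact_iff S').2 fun x hx =>
        ⟨⟨x, (Submodule.Quotient.mk_eq_zero _).1 hx⟩, rfl⟩
      mono_f := (ModuleCat.mono_iff_injective _).2 Subtype.val_injective
      epi_g := (ModuleCat.epi_iff_surjective _).2 (Submodule.mkQ_surjective _) }
  have hP : Projective (ModuleCat.of Λ P) := (IsProjective.iff_projective P).1 inferInstance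
  have hQ : Projective (ModuleCat.of Λ Q) := (IsProjective.iff_projective Q).1 inferInstance
  -- Two dimension shifts: the cokernel of `f` has projective dimension at most 2, hence the image
  -- at most 1 and the kernel at most 0. The strict bounds `LT 2` and `LT 1` express the last two.
  have h1 : HasProjectiveDimensionLT S'.X₁ 2 :=
    (hS'.hasProjectiveDimensionLT_X₃_iff 1 hQ).1 (hΛ _)
  have h2 : HasProjectiveDimensionLT S.X₁ 1 :=
    (hS.hasProjectiveDimensionLT_X₃_iff 0 hP).1 h1
  exact (IsProjective.iff_projective _).2 (projective_iff_hasProjectiveDimensionLT_one.2 h2)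

-- The dimension hypothesis concerns modules in the universe of `Λ`, while direct sums over vertices
-- live in a larger one. Finite modules are small, so the sequence can be shrunk before
-- `projective_ker` is applied.
omit [IsNoetherianRing Λ] in
lemma projective_of_exact {A P Q : Type*} [AddCommGroup A] [Module Λ A] [AddCommGroup P] [Module Λ P]
    [AddCommGroup Q] [Module Λ Q] [Module.Finite Λ P] [Module.Finite Λ Q]
    [Module.Projective Λ P] [Module.Projective Λ Q]
    (hΛ : ∀ M : ModuleCat.{u} Λ, HasProjectiveDimensionLE M 2) (a : A →ₗ[Λ] P) (f : P →ₗ[Λ] Q)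
    (ha : Function.Injective a) (h : Function.Exact a f) : Module.Projective Λ A := by
  have : Small.{u} P := Module.Finite.small Λ P
  have : Small.{u} Q := Module.Finite.small Λ Q
  let f' := (Shrink.linearEquiv Λ Q).symm.toLinearMap ∘ₗ f ∘ₗ
    (Shrink.linearEquiv.{u} Λ P).toLinearMap
  have := projective_ker hΛ f'
  let a' := (Shrink.linearEquiv.{u} Λ P).symm.toLinearMap ∘ₗ a
  have ha' : Function.Injective a' := (Shrink.linearEquiv.{u} Λ P).symm.injective.comp ha
  have hr : LinearMap.ker f' = LinearMap.range a' := by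
    ext x
    obtain ⟨x, rfl⟩ := (Shrink.linearEquiv.{u} Λ P).symm.surjective x
    simp only [f', a', LinearMap.mem_ker, LinearMap.mem_range, LinearMap.comp_apply,
      LinearEquiv.coe_coe, LinearEquiv.apply_symm_apply, EmbeddingLike.map_eq_zero_iff,
      EmbeddingLike.apply_eq_iff_eq]
    exact h x
  rw [hr] at this
  exact Module.Projective.of_equiv (LinearEquiv.ofInjective a' ha').symm

/-- The finite commutator map presents the centralizer as the kernel of a map from `End M` to a
power of `End M`, both finitely generated projective. -/
lemma projective_of_centralizer {A : Type*} [AddCommGroup A] [Module Λ A]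
    (hΛ : ∀ M : ModuleCat.{u} Λ, HasProjectiveDimensionLE M 2) (a : A →ₗ[Λ] Module.End Λ M)
    {R : Set (Module.End Λ M)} (ha : ∀ f, (∀ r ∈ R, r ∘ₗ f = f ∘ₗ r) ↔ f ∈ LinearMap.range a)
    (ha' : Function.Injective a) : Module.Projective Λ A := by
  obtain ⟨n, r, Φ, -, -, hΦ⟩ := exists_commutator R
  have := projective_linearMap (Λ := Λ) M M
  have : Module.Projective Λ (Fin n → Module.End Λ M) :=
    .of_equiv' (DFinsupp.linearEquivFunOnFintype (R := Λ))
  exact projective_of_exact hΛ a Φ ha' fun y => by rw [hΦ, ha]; rfl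

end

end FiniteProjective

end

/-! ### The algebras `End(T|_G)` and their regular modules -/

section

namespace NoriCat

open FGModuleCat FiniteProjective

section

variable {Λ : Type u} [CommRing Λ] {V : Type v} [Quiver.{w} V] (T : V ⥤q FGModuleCat.{u} Λ)

/-- The direct sum of the modules `T v`, `v ∈ G`. -/
abbrev total (G : Finset V) : Type (max u v) := ∀ x : G, T.obj x.1

/-- A compatible family of endomorphisms as an operator on the direct sum. -/
def diagOp (G : Finset V) : endAlg T G →ₗ[Λ] Module.End Λ (total T G) where
  toFun e := LinearMap.pi fun x => e.1 x ∘ₗ LinearMap.proj x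
  map_add' _ _ := rfl
  map_smul' _ _ := rfl

lemma diagOp_apply {G : Finset V} (e : endAlg T G) (m : total T G) (x : G) :
    diagOp T G e m x = e.1 x (m x) := rfl

open Classical in
/-- The operator on the direct sum given by an edge. -/
def edgeOp {G : Finset V} {x y : G} (γ : x.1 ⟶ y.1) : Module.End Λ (total T G) :=
  LinearMap.single Λ (fun x : G => T.obj x.1) y ∘ₗ FGModuleCat.lin (T.map γ) ∘ₗ LinearMap.proj x

open Classical in
/-- The projection to a summand of the direct sum. -/
def vertexOp {G : Finset V} (x : G) : Module.End Λ (total T G) :=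
  LinearMap.single Λ (fun x : G => T.obj x.1) x ∘ₗ LinearMap.proj x

/-- The operators on the direct sum given by the edges and the vertices. -/
def diagramOps (G : Finset V) : Set (Module.End Λ (total T G)) :=
  {r | (∃ x, r = vertexOp T x) ∨ ∃ (x y : G) (γ : x.1 ⟶ y.1), r = edgeOp T γ}

lemma edge_comm {G : Finset V} (e : endAlg T G) {x y : G} (γ : x.1 ⟶ y.1) (m : T.obj x.1) :
    FGModuleCat.lin (T.map γ) (e.1 x m) = e.1 y (FGModuleCat.lin (T.map γ) m) :=
  LinearMap.congr_fun (e.2 x y γ) m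

lemma diagOp_injective (G : Finset V) : Function.Injective (diagOp T G) := by
  classical
  intro e e' h
  refine Subtype.ext (funext fun x => LinearMap.ext fun m => ?_)
  have := congrFun (LinearMap.congr_fun h (Pi.single x m)) x
  simpa only [diagOp_apply, Pi.single_eq_same] using this

/-- The algebra `End(T|_G)` is the centralizer of the operators given by the diagram. -/
lemma mem_range_diagOp {G : Finset V} (f : Module.End Λ (total T G)) :
    (∀ r ∈ diagramOps T G, r ∘ₗ f = f ∘ₗ r) ↔ f ∈ LinearMap.range (diagOp T G) := by
  classical
  constructor
  · intro h
    -- Commuting with the vertex projections makes `f` block diagonal; commuting with the edge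
    -- operators then says that the blocks are compatible.
    have key : ∀ (x : G) (m : total T G), f m x = f (Pi.single x (m x)) x := fun x m => by
      have := congrFun (LinearMap.congr_fun (h _ (Or.inl ⟨x, rfl⟩)) m) x
      simpa [vertexOp] using this
    let e : ∀ x : G, Module.End Λ (T.obj x.1) := fun x =>
      LinearMap.proj x ∘ₗ f ∘ₗ LinearMap.single Λ (fun x : G => T.obj x.1) x
    refine ⟨⟨e, fun x y γ => ?_⟩, LinearMap.ext fun m => funext fun x => (key x m).symm⟩
    ext m
    have := congrFun (LinearMap.congr_fun (h _ (Or.inr ⟨x, y, γ, rfl⟩)) (Pi.single x m)) y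
    simpa [edgeOp, e] using this
  · rintro ⟨e, rfl⟩ r (⟨x, rfl⟩ | ⟨x, y, γ, rfl⟩)
    · ext1 z
      ext m i
      by_cases hi : i = x
      · subst hi
        simp [vertexOp, diagOp_apply]
      · simp [vertexOp, diagOp_apply, Pi.single_eq_of_ne hi]
    · refine LinearMap.ext fun m => funext fun i => ?_
      by_cases hi : i = y
      · subst hi
        simpa [edgeOp, diagOp_apply] using edge_comm T e γ (m x)
      · simp [edgeOp, diagOp_apply, Pi.single_eq_of_ne hi]

instance [IsNoetherianRing Λ] (G : Finset V) : IsNoetherian Λ (endAlg T G) :=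
  isNoetherian_of_injective (diagOp T G) (diagOp_injective T G)

lemma projective_total (hT : ∀ v : V, Module.Projective Λ (T.obj v)) (G : Finset V) :
    Module.Projective Λ (total T G) := by
  classical
  have (x : G) : Module.Projective Λ (T.obj x.1) := hT x.1
  exact .of_equiv' (DFinsupp.linearEquivFunOnFintype (R := Λ))

lemma projective_endAlg [IsNoetherianRing Λ]
    (hΛ : ∀ M : ModuleCat.{u} Λ, HasProjectiveDimensionLE M 2)
    (hT : ∀ v : V, Module.Projective Λ (T.obj v)) (G : Finset V) :
    Module.Projective Λ (endAlg T G) :=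
  have := projective_total T hT G
  projective_of_centralizer hΛ (diagOp T G) (mem_range_diagOp T) (diagOp_injective T G)

variable [IsNoetherianRing Λ]

/-- `endAlg T G` lives in a universe that also involves the vertices, whereas carriers of objects
lie in `Type u`; finiteness over `Λ` allows it to be shrunk. -/
instance (G : Finset V) : Small.{u} (endAlg T G) := Module.Finite.small Λ _

/-- The left regular module over `End(T|_G)` as an object of `C(T)`. -/
def reg (G : Finset V) : NoriCat T where
  supp := G
  carrier := FGModuleCat.of Λ (Shrink.{u} (endAlg T G))
  action := ((Shrink.linearEquiv.{u} Λ (endAlg T G)).symm.conjAlgEquiv Λ).toAlgHom.comp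
    (Algebra.lmul Λ (endAlg T G))

/-- The underlying module of the left regular module. -/
def regEquiv (G : Finset V) : (reg T G).carrier ≃ₗ[Λ] endAlg T G := Shrink.linearEquiv Λ _

variable {T}

lemma act_reg {G G' : Finset V} (h : G ⊆ G') (e : endAlg T G') (r : (reg T G).carrier) :
    (reg T G).act (G := G') h e r = (regEquiv T G).symm (endAlgRes T h e * regEquiv T G r) := rfl

/-- The morphism from the regular module given by an element. -/
def ofElem {G : Finset V} (X : NoriCat T) (h : X.supp ⊆ G) (x : X.carrier) : reg T G ⟶ X :=
  homMk (X := reg T G) (((X.act h).toLinearMap.flip x) ∘ₗ (regEquiv T G).toLinearMap)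
    (subset_refl G) h fun e r => by
      rw [act_reg (subset_refl G)]
      simp only [LinearMap.comp_apply, LinearEquiv.coe_coe, LinearEquiv.apply_symm_apply,
        LinearMap.flip_apply, AlgHom.toLinearMap_apply, map_mul]
      rfl

lemma lin_ofElem {G : Finset V} (X : NoriCat T) (h : X.supp ⊆ G) (x : X.carrier)
    (r : (reg T G).carrier) : lin (ofElem X h x) r = X.act h (regEquiv T G r) x := rfl

/-- The list consists of finite generating sets of all `T x`, `x ∈ G`; a family of endomorphisms
that vanishes on generators is zero. -/
lemma exists_jointly_injective (G : Finset V) : ∃ (n : ℕ) (x : Fin n → V) (hx : ∀ i, x i ∈ G)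
    (m : ∀ i, T.obj (x i)), ∀ e : endAlg T G, (∀ i, e.1 ⟨x i, hx i⟩ (m i) = 0) → e = 0 := by
  choose n m hm using fun x : G => Module.Finite.exists_fin (R := Λ) (M := T.obj x.1)
  let ε := Fintype.equivFin (Σ x : G, Fin (n x))
  refine ⟨_, fun i => (ε.symm i).1.1, fun i => (ε.symm i).1.2, fun i => m _ (ε.symm i).2,
    fun e he => Subtype.ext (funext fun x => ?_)⟩
  refine LinearMap.ext_on_range (hm x) fun i => ?_
  have h : ∀ s : Σ x : G, Fin (n x), e.1 s.1 (m s.1 s.2) = 0 := fun s => by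
    obtain ⟨k, rfl⟩ := ε.symm.surjective s
    exact he k
  exact h ⟨x, i⟩

/-- A property of objects that passes to subobjects of finite families of objects satisfying it and
holds for the objects `T̃ v` holds for the regular modules. -/
lemma reg_induction {P : NoriCat T → Prop} (h : ∀ x, P ((rep T).obj x)) (G : Finset V)
    (hP : ∀ (n : ℕ) (D : Fin n → NoriCat T) (g : ∀ i, reg T G ⟶ D i),
      (∀ r, (∀ i, lin (g i) r = 0) → r = 0) → (∀ i, P (D i)) → P (reg T G)) : P (reg T G) := by
  obtain ⟨n, x, hx, m, hm⟩ := exists_jointly_injective (T := T) G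
  refine hP n (fun i => (rep T).obj (x i))
    (fun i => ofElem _ (Finset.singleton_subset_iff.2 (hx i)) (m i)) (fun r hr => ?_) fun i => h _
  exact (regEquiv T G).map_eq_zero_iff.1 (hm _ hr)

/-- A property of objects that passes to quotients of finite families of objects satisfying it and
holds for the regular modules holds for all objects. -/
lemma induction_of_reg {P : NoriCat T → Prop} (h : ∀ G, P (reg T G)) (X : NoriCat T)
    (hP : ∀ (n : ℕ) (D : Fin n → NoriCat T) (g : ∀ i, D i ⟶ X),
      (∀ x, ∃ y : ∀ i, (D i).carrier, ∑ i, lin (g i) (y i) = x) → (∀ i, P (D i)) → P X) : P X := by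
  obtain ⟨n, m, hm⟩ := Module.Finite.exists_fin (R := Λ) (M := X.carrier)
  refine hP n (fun _ => reg T X.supp) (fun i => ofElem X subset_rfl (m i)) (fun x => ?_) fun i => h _
  obtain ⟨c, rfl⟩ := (Submodule.mem_span_range_iff_exists_fun Λ).1 (hm ▸ Submodule.mem_top (x := x))
  refine ⟨fun i => (regEquiv T X.supp).symm (algebraMap Λ _ (c i)), ?_⟩
  refine Finset.sum_congr rfl fun i _ => ?_
  rw [lin_ofElem, LinearEquiv.apply_symm_apply, AlgHom.commutes]
  rfl

end

end NoriCat

end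

/-! ### Block operators on tensor products of finite products -/

section

namespace FiniteProjective

open scoped TensorProduct

section Block

variable {Λ : Type u} [CommRing Λ] {ι κ : Type*} [Fintype ι] [Fintype κ] [DecidableEq ι]
  [DecidableEq κ] {M : ι → Type*} {N : κ → Type*} [∀ x, AddCommGroup (M x)] [∀ x, Module Λ (M x)]
  [∀ y, AddCommGroup (N y)] [∀ y, Module Λ (N y)]

/-- The projection of the tensor product of two direct sums to a summand. -/
abbrev projTensor (x : ι) (y : κ) : (∀ x, M x) ⊗[Λ] (∀ y, N y) →ₗ[Λ] M x ⊗[Λ] N y :=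
  TensorProduct.map (LinearMap.proj x) (LinearMap.proj y)

/-- The inclusion of a summand in the tensor product of two direct sums. -/
abbrev singleTensor (x : ι) (y : κ) : M x ⊗[Λ] N y →ₗ[Λ] (∀ x, M x) ⊗[Λ] (∀ y, N y) :=
  TensorProduct.map (LinearMap.single Λ M x) (LinearMap.single Λ N y)

lemma sum_singleTensor_projTensor (z : (∀ x, M x) ⊗[Λ] (∀ y, N y)) :
    ∑ x, ∑ y, singleTensor x y (projTensor x y z) = z := by
  induction z with
  | zero => simp
  | add z z' hz hz' => simp only [map_add, Finset.sum_add_distrib, hz, hz']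
  | tmul m n =>
    simp only [TensorProduct.map_tmul, LinearMap.proj_apply, LinearMap.single_apply]
    simp only [← TensorProduct.tmul_sum, ← TensorProduct.sum_tmul, Finset.univ_sum_single]

lemma projTensor_ext {z z' : (∀ x, M x) ⊗[Λ] (∀ y, N y)}
    (h : ∀ x y, projTensor x y z = projTensor x y z') : z = z' := by
  rw [← sum_singleTensor_projTensor z, ← sum_singleTensor_projTensor z']
  simp only [h]

lemma projTensor_singleTensor (x : ι) (y : κ) (z : M x ⊗[Λ] N y) :
    projTensor x y (singleTensor x y z) = z := by
  induction z with
  | zero => simp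
  | add z z' hz hz' => simp only [map_add, hz, hz']
  | tmul m n => simp

lemma projTensor_singleTensor_of_ne {x a : ι} {y b : κ} (h : ¬ (x = a ∧ y = b))
    (z : M a ⊗[Λ] N b) : projTensor x y (singleTensor a b z) = 0 := by
  induction z with
  | zero => simp
  | add z z' hz hz' => simp only [map_add, hz, hz', add_zero]
  | tmul m n =>
    rw [not_and_or] at h
    rcases h with h | h
    · simp [Pi.single_eq_of_ne h]
    · simp [Pi.single_eq_of_ne h]

/-- The diagonal operator on the tensor product of two direct sums. -/
def blockOp (E : ∀ x y, Module.End Λ (M x ⊗[Λ] N y)) :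
    Module.End Λ ((∀ x, M x) ⊗[Λ] (∀ y, N y)) :=
  ∑ x, ∑ y, singleTensor x y ∘ₗ E x y ∘ₗ projTensor x y

lemma projTensor_blockOp (E : ∀ x y, Module.End Λ (M x ⊗[Λ] N y)) (x : ι) (y : κ)
    (z : (∀ x, M x) ⊗[Λ] (∀ y, N y)) :
    projTensor x y (blockOp E z) = E x y (projTensor x y z) := by
  rw [blockOp]
  simp only [LinearMap.sum_apply, map_sum, LinearMap.comp_apply]
  rw [Fintype.sum_eq_single x, Fintype.sum_eq_single y, projTensor_singleTensor]
  · intro b hb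
    exact projTensor_singleTensor_of_ne (fun h => hb h.2.symm) _
  · intro a ha
    exact Finset.sum_eq_zero fun b _ => projTensor_singleTensor_of_ne (fun h => ha h.1.symm) _

lemma projTensor_rTensor {a b : ι} (φ : M a →ₗ[Λ] M b) (y : κ) (z : (∀ x, M x) ⊗[Λ] (∀ y, N y)) :
    projTensor b y (LinearMap.rTensor (∀ y, N y)
      (LinearMap.single Λ M b ∘ₗ φ ∘ₗ LinearMap.proj a) z) =
    LinearMap.rTensor (N y) φ (projTensor a y z) := by
  induction z with
  | zero => simp
  | add z z' hz hz' => simp only [map_add, hz, hz']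
  | tmul m n => simp

lemma projTensor_rTensor_of_ne {a b x : ι} (h : x ≠ b) (φ : M a →ₗ[Λ] M b) (y : κ)
    (z : (∀ x, M x) ⊗[Λ] (∀ y, N y)) :
    projTensor x y (LinearMap.rTensor (∀ y, N y)
      (LinearMap.single Λ M b ∘ₗ φ ∘ₗ LinearMap.proj a) z) = 0 := by
  induction z with
  | zero => simp
  | add z z' hz hz' => simp only [map_add, hz, hz', add_zero]
  | tmul m n => simp [Pi.single_eq_of_ne h]

lemma projTensor_lTensor {a b : κ} (φ : N a →ₗ[Λ] N b) (x : ι) (z : (∀ x, M x) ⊗[Λ] (∀ y, N y)) :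
    projTensor x b (LinearMap.lTensor (∀ x, M x)
      (LinearMap.single Λ N b ∘ₗ φ ∘ₗ LinearMap.proj a) z) =
    LinearMap.lTensor (M x) φ (projTensor x a z) := by
  induction z with
  | zero => simp
  | add z z' hz hz' => simp only [map_add, hz, hz']
  | tmul m n => simp

lemma projTensor_lTensor_of_ne {a b y : κ} (h : y ≠ b) (φ : N a →ₗ[Λ] N b) (x : ι)
    (z : (∀ x, M x) ⊗[Λ] (∀ y, N y)) :
    projTensor x y (LinearMap.lTensor (∀ x, M x)
      (LinearMap.single Λ N b ∘ₗ φ ∘ₗ LinearMap.proj a) z) = 0 := by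
  induction z with
  | zero => simp
  | add z z' hz hz' => simp only [map_add, hz, hz', add_zero]
  | tmul m n => simp [Pi.single_eq_of_ne h]

/-- Compare blocks: both sides vanish in every row other than `b`, and in row `b` the identity is
the hypothesis. -/
lemma blockOp_comm_rTensor (E : ∀ x y, Module.End Λ (M x ⊗[Λ] N y)) {a b : ι}
    (φ : M a →ₗ[Λ] M b)
    (h : ∀ y z, LinearMap.rTensor (N y) φ (E a y z) = E b y (LinearMap.rTensor (N y) φ z)) :
    LinearMap.rTensor (∀ y, N y) (LinearMap.single Λ M b ∘ₗ φ ∘ₗ LinearMap.proj a) ∘ₗ blockOp E =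
      blockOp E ∘ₗ
        LinearMap.rTensor (∀ y, N y) (LinearMap.single Λ M b ∘ₗ φ ∘ₗ LinearMap.proj a) := by
  refine LinearMap.ext fun z => projTensor_ext fun x y => ?_
  rw [LinearMap.comp_apply, LinearMap.comp_apply, projTensor_blockOp]
  by_cases hx : x = b
  · subst hx
    rw [projTensor_rTensor, projTensor_rTensor, projTensor_blockOp, h]
  · rw [projTensor_rTensor_of_ne hx, projTensor_rTensor_of_ne hx, map_zero]

lemma blockOp_comm_lTensor (E : ∀ x y, Module.End Λ (M x ⊗[Λ] N y)) {a b : κ}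
    (φ : N a →ₗ[Λ] N b)
    (h : ∀ x z, LinearMap.lTensor (M x) φ (E x a z) = E x b (LinearMap.lTensor (M x) φ z)) :
    LinearMap.lTensor (∀ x, M x) (LinearMap.single Λ N b ∘ₗ φ ∘ₗ LinearMap.proj a) ∘ₗ blockOp E =
      blockOp E ∘ₗ
        LinearMap.lTensor (∀ x, M x) (LinearMap.single Λ N b ∘ₗ φ ∘ₗ LinearMap.proj a) := by
  refine LinearMap.ext fun z => projTensor_ext fun x y => ?_
  rw [LinearMap.comp_apply, LinearMap.comp_apply, projTensor_blockOp]
  by_cases hy : y = b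
  · subst hy
    rw [projTensor_lTensor, projTensor_lTensor, projTensor_blockOp, h]
  · rw [projTensor_lTensor_of_ne hy, projTensor_lTensor_of_ne hy, map_zero]

end Block

end FiniteProjective

end

/-! ### The tensor product of objects of `C(T)` -/

section

open GradedDiagram CommProductDiagram UnitalProductDiagram
open FGModuleCat FiniteProjective
open scoped TensorProduct

lemma koszulSign_mul_self (a : ZMod 2) : koszulSign a * koszulSign a = 1 := by
  rw [koszulSign, ← pow_add, ← two_mul, pow_mul, neg_one_sq, one_pow]

lemma koszulSign_smul_smul {M : Type*} [AddCommGroup M] (a : ZMod 2) (x : M) :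
    koszulSign a • koszulSign a • x = x := by
  rw [smul_smul, koszulSign_mul_self, one_smul]

lemma koszulSign_smul_injective {M : Type*} [AddCommGroup M] (a : ZMod 2) {x y : M}
    (h : koszulSign a • x = koszulSign a • y) : x = y := by
  rw [← koszulSign_smul_smul a x, h, koszulSign_smul_smul]

namespace ProductData

variable {Λ : Type u} [CommRing Λ] {V : Type v} [UnitalProductDiagram.{w} V]
  {T : V ⥤q FGModuleCat.{u} Λ} (t : ProductData T)

/-- The multiplicativity isomorphism of a representation in modules as a linear equivalence. -/
def tauEquiv (x y : V) : T.obj (vprod x y) ≃ₗ[Λ] T.obj x ⊗[Λ] T.obj y :=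
  isoToLinearEquiv (t.τ x y)

variable {t}

lemma IsUGM.tau_edgeProd (ht : t.IsUGM) {x x' : V} (γ : x ⟶ x') (y : V) (m : T.obj (vprod x y)) :
    t.tauEquiv x' y (lin (T.map (CommProductDiagram.edgeProd γ y)) m) =
      koszulSign ((deg x - deg x') * deg y) •
        LinearMap.rTensor (T.obj y) (lin (T.map γ)) (t.tauEquiv x y m) :=
  LinearMap.congr_fun (congrArg lin (ht.edgeProd γ y)) m

lemma IsUGM.tau_prodEdge (ht : t.IsUGM) {y y' : V} (x : V) (γ : y ⟶ y') (m : T.obj (vprod x y)) :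
    t.tauEquiv x y' (lin (T.map (CommProductDiagram.prodEdge x γ)) m) =
      LinearMap.lTensor (T.obj x) (lin (T.map γ)) (t.tauEquiv x y m) :=
  LinearMap.congr_fun (congrArg lin (ht.prodEdge x γ)) m

/-- The hypotheses under which the tensor product on Nori's category is constructed. -/
structure Admissible (t : ProductData T) : Prop where
  gldim : ∀ M : ModuleCat.{u} Λ, HasProjectiveDimensionLE M 2
  projective : ∀ x : V, Module.Projective Λ (T.obj x)
  isUGM : t.IsUGM

variable (t) in
/-- The action of `End(T|_H)` on `T x ⊗ T y` if the product vertex is in `H`. -/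
def prodEval {H : Finset V} {x y : V} (h : vprod x y ∈ H) :
    endAlg T H →ₐ[Λ] Module.End Λ (T.obj x ⊗[Λ] T.obj y) :=
  (((t.tauEquiv x y).conjAlgEquiv Λ).toAlgHom.comp
    (Pi.evalAlgHom Λ (fun z : H => Module.End Λ (T.obj z.1)) ⟨vprod x y, h⟩)).comp (endAlg T H).val

lemma prodEval_tau {H : Finset V} {x y : V} (h : vprod x y ∈ H) (e : endAlg T H)
    (m : T.obj (vprod x y)) :
    t.prodEval h e (t.tauEquiv x y m) = t.tauEquiv x y (e.1 ⟨_, h⟩ m) := by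
  change t.tauEquiv x y (e.1 ⟨_, h⟩ ((t.tauEquiv x y).symm (t.tauEquiv x y m))) = _
  rw [LinearEquiv.symm_apply_apply]

/-- Both ends of the edge `γ × id` lie in `H`, so `e` commutes with its value. Under `τ` this value
is `γ ⊗ 1` up to a sign, which occurs on both sides and is invertible. -/
lemma prodEval_rTensor (ht : t.IsUGM) {H : Finset V} {x x' y : V} (γ : x ⟶ x')
    (h : vprod x y ∈ H) (h' : vprod x' y ∈ H) (e : endAlg T H) (z : T.obj x ⊗[Λ] T.obj y) :
    LinearMap.rTensor (T.obj y) (lin (T.map γ)) (t.prodEval h e z) =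
      t.prodEval h' e (LinearMap.rTensor (T.obj y) (lin (T.map γ)) z) := by
  obtain ⟨m, rfl⟩ := (t.tauEquiv x y).surjective z
  apply koszulSign_smul_injective ((deg x - deg x') * deg y)
  rw [prodEval_tau, ← map_zsmul (t.prodEval h' e), ← ht.tau_edgeProd, ← ht.tau_edgeProd,
    prodEval_tau, NoriCat.edge_comm T e (x := ⟨_, h⟩) (y := ⟨_, h'⟩)]

lemma prodEval_lTensor (ht : t.IsUGM) {H : Finset V} {x y y' : V} (γ : y ⟶ y')
    (h : vprod x y ∈ H) (h' : vprod x y' ∈ H) (e : endAlg T H) (z : T.obj x ⊗[Λ] T.obj y) :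
    LinearMap.lTensor (T.obj x) (lin (T.map γ)) (t.prodEval h e z) =
      t.prodEval h' e (LinearMap.lTensor (T.obj x) (lin (T.map γ)) z) := by
  obtain ⟨m, rfl⟩ := (t.tauEquiv x y).surjective z
  rw [prodEval_tau, ← ht.tau_prodEdge, ← ht.tau_prodEdge,
    prodEval_tau, NoriCat.edge_comm T e (x := ⟨_, h⟩) (y := ⟨_, h'⟩)]

end ProductData

namespace NoriCat

section

variable {Λ : Type u} [CommRing Λ] {V : Type v} [Quiver.{w} V] {T : V ⥤q FGModuleCat.{u} Λ}

lemma rep_supp_subset {G : Finset V} {x : V} (hx : x ∈ G) : ((rep T).obj x).supp ⊆ G :=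
  Finset.singleton_subset_iff.2 hx

/-- The action of `End(T|_G) ⊗ End(T|_G')` on the tensor product of two objects. -/
def tensorAct (X Y : NoriCat T) {G G' : Finset V} (hX : X.supp ⊆ G) (hY : Y.supp ⊆ G') :
    endAlg T G ⊗[Λ] endAlg T G' →ₐ[Λ] Module.End Λ (X.carrier ⊗[Λ] Y.carrier) :=
  (Module.endTensorEndAlgHom (R := Λ) (S := Λ) (A := Λ)).comp
    (Algebra.TensorProduct.map (X.act hX) (Y.act hY))

lemma tensorAct_tmul (X Y : NoriCat T) {G G' : Finset V} (hX : X.supp ⊆ G) (hY : Y.supp ⊆ G')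
    (a : endAlg T G) (b : endAlg T G') :
    tensorAct X Y hX hY (a ⊗ₜ b) = TensorProduct.map (X.act hX a) (Y.act hY b) := rfl

lemma tensorAct_res (X Y : NoriCat T) {G G' G₁ G₁' : Finset V} (hX : X.supp ⊆ G)
    (hY : Y.supp ⊆ G') (h : G ⊆ G₁) (h' : G' ⊆ G₁') (z : endAlg T G₁ ⊗[Λ] endAlg T G₁') :
    tensorAct X Y hX hY (Algebra.TensorProduct.map (endAlgRes T h) (endAlgRes T h') z) =
      tensorAct X Y (hX.trans h) (hY.trans h') z := by
  induction z with
  | zero => simp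
  | add z z' hz hz' => rw [map_add, map_add, map_add, hz, hz']
  | tmul a b => rfl

lemma tensorAct_map {X X' Y Y' : NoriCat T} {G G' : Finset V} (hX : X.supp ⊆ G)
    (hX' : X'.supp ⊆ G) (hY : Y.supp ⊆ G') (hY' : Y'.supp ⊆ G') (f : X.carrier →ₗ[Λ] X'.carrier)
    (g : Y.carrier →ₗ[Λ] Y'.carrier) (hf : ∀ e x, f (X.act hX e x) = X'.act hX' e (f x))
    (hg : ∀ e y, g (Y.act hY e y) = Y'.act hY' e (g y)) (z : endAlg T G ⊗[Λ] endAlg T G')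
    (m : X.carrier ⊗[Λ] Y.carrier) :
    TensorProduct.map f g (tensorAct X Y hX hY z m) =
      tensorAct X' Y' hX' hY' z (TensorProduct.map f g m) := by
  induction z with
  | zero => simp
  | add z z' hz hz' => simp only [map_add, LinearMap.add_apply, hz, hz']
  | tmul a b =>
    induction m with
    | zero => simp
    | add m m' hm hm' => simp only [map_add, hm, hm']
    | tmul x y => simp only [tensorAct_tmul, TensorProduct.map_tmul, hf, hg]

end

variable {Λ : Type u} [CommRing Λ] {V : Type v} [UnitalProductDiagram.{w} V]
  {T : V ⥤q FGModuleCat.{u} Λ} {t : ProductData T}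

/-- The action of `End(T|_G) ⊗ End(T|_G')` on `T x ⊗ T y`. -/
def tensorEval {G G' : Finset V} {x y : V} (hx : x ∈ G) (hy : y ∈ G') :
    endAlg T G ⊗[Λ] endAlg T G' →ₐ[Λ] Module.End Λ (T.obj x ⊗[Λ] T.obj y) :=
  tensorAct ((rep T).obj x) ((rep T).obj y) (rep_supp_subset hx) (rep_supp_subset hy)

lemma tensorEval_res {G G' G₁ G₁' : Finset V} {x y : V} (hx : x ∈ G) (hy : y ∈ G') (h : G ⊆ G₁)
    (h' : G' ⊆ G₁') (z : endAlg T G₁ ⊗[Λ] endAlg T G₁') :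
    tensorEval hx hy (Algebra.TensorProduct.map (endAlgRes T h) (endAlgRes T h') z) =
      tensorEval (h hx) (h' hy) z :=
  tensorAct_res _ _ _ _ h h' z

lemma projTensor_diagOp {G G' : Finset V} (x : G) (y : G') (z : endAlg T G ⊗[Λ] endAlg T G')
    (m : total T G ⊗[Λ] total T G') :
    projTensor x y (endTensor (total T G) (total T G')
      (TensorProduct.map (diagOp T G) (diagOp T G') z) m) =
    tensorEval x.2 y.2 z (projTensor x y m) := by
  classical
  induction z with
  | zero => simp
  | add z z' hz hz' => simp only [map_add, LinearMap.add_apply, hz, hz']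
  | tmul a b =>
    induction m with
    | zero => simp
    | add m m' hm hm' => simp only [map_add, hm, hm']
    | tmul m n => rfl

/-- The operator on the tensor product of the direct sums given by an element of `End(T|_H)`. -/
def prodBlock (t : ProductData T) {G G' H : Finset V} (hH : ∀ x ∈ G, ∀ y ∈ G', vprod x y ∈ H)
    (e : endAlg T H) : Module.End Λ (total T G ⊗[Λ] total T G') := by
  classical
  exact blockOp fun (x : G) (y : G') => t.prodEval (hH x.1 x.2 y.1 y.2) e

lemma projTensor_prodBlock {G G' H : Finset V} (hH : ∀ x ∈ G, ∀ y ∈ G', vprod x y ∈ H)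
    (e : endAlg T H) (x : G) (y : G') (z : total T G ⊗[Λ] total T G') :
    projTensor x y (prodBlock t hH e z) = t.prodEval (hH x.1 x.2 y.1 y.2) e (projTensor x y z) := by
  classical
  exact projTensor_blockOp (M := fun x : G => T.obj x.1) (N := fun y : G' => T.obj y.1) _ x y z

lemma prodBlock_comm_rTensor (ht : t.IsUGM) {G G' H : Finset V}
    (hH : ∀ x ∈ G, ∀ y ∈ G', vprod x y ∈ H) (e : endAlg T H) {r : Module.End Λ (total T G)}
    (hr : r ∈ diagramOps T G) :
    LinearMap.rTensor (total T G') r ∘ₗ prodBlock t hH e =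
      prodBlock t hH e ∘ₗ LinearMap.rTensor (total T G') r := by
  classical
  rcases hr with ⟨x, rfl⟩ | ⟨x, y, γ, rfl⟩
  -- A vertex projection is the block operator of an identity map, so this case needs no edge of the
  -- diagram.
  · exact blockOp_comm_rTensor (M := fun x : G => T.obj x.1) (N := fun y : G' => T.obj y.1) _
      (a := x) (b := x) LinearMap.id fun y z => by
        rw [LinearMap.rTensor_id, LinearMap.id_apply, LinearMap.id_apply]
  · exact blockOp_comm_rTensor (M := fun x : G => T.obj x.1) (N := fun y : G' => T.obj y.1) _
      (a := x) (b := y) (FGModuleCat.lin (T.map γ)) fun z m =>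
        t.prodEval_rTensor ht γ (hH x.1 x.2 z.1 z.2) (hH y.1 y.2 z.1 z.2) e m

lemma prodBlock_comm_lTensor (ht : t.IsUGM) {G G' H : Finset V}
    (hH : ∀ x ∈ G, ∀ y ∈ G', vprod x y ∈ H) (e : endAlg T H) {r : Module.End Λ (total T G')}
    (hr : r ∈ diagramOps T G') :
    LinearMap.lTensor (total T G) r ∘ₗ prodBlock t hH e =
      prodBlock t hH e ∘ₗ LinearMap.lTensor (total T G) r := by
  classical
  rcases hr with ⟨x, rfl⟩ | ⟨x, y, γ, rfl⟩
  · exact blockOp_comm_lTensor (M := fun x : G => T.obj x.1) (N := fun y : G' => T.obj y.1) _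
      (a := x) (b := x) LinearMap.id fun y z => by
        rw [LinearMap.lTensor_id, LinearMap.id_apply, LinearMap.id_apply]
  · exact blockOp_comm_lTensor (M := fun x : G => T.obj x.1) (N := fun y : G' => T.obj y.1) _
      (a := x) (b := y) (FGModuleCat.lin (T.map γ)) fun z m =>
        t.prodEval_lTensor ht γ (hH z.1 z.2 x.1 x.2) (hH z.1 z.2 y.1 y.2) e m

variable [IsNoetherianRing Λ]

lemma flat_endAlg (ht : t.Admissible) (G : Finset V) : Module.Flat Λ (endAlg T G) :=
  have := projective_endAlg T ht.gldim ht.projective G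
  Module.Flat.of_projective

/-- By flatness, `End(T|_G) ⊗ End(T|_G')` acts faithfully on the tensor product of the two direct
sums, and this action is block diagonal. Hence all identities for the comultiplication can be
checked on the modules `T x ⊗ T y`. -/
lemma tensorEval_ext (ht : t.Admissible) {G G' : Finset V} {z z' : endAlg T G ⊗[Λ] endAlg T G'}
    (h : ∀ (x y : V) (hx : x ∈ G) (hy : y ∈ G'), tensorEval hx hy z = tensorEval hx hy z') :
    z = z' := by
  classical
  have := flat_endAlg ht G
  have := projective_total T ht.projective G
  have := projective_total T ht.projective G'
  apply endTensor_map_injective (diagOp T G) (diagOp T G') (diagOp_injective T G)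
    (diagOp_injective T G')
  refine LinearMap.ext fun m => projTensor_ext fun x y => ?_
  rw [LinearMap.comp_apply, LinearMap.comp_apply, projTensor_diagOp, projTensor_diagOp, h]

/-- Acting by `e` on each block `T x ⊗ T y` through `τ` gives an operator that commutes with the
diagram operators of both factors; by the double centralizer statement it comes from the tensor
product of the algebras. -/
lemma exists_comul (ht : t.Admissible) {G G' H : Finset V} (hH : ∀ x ∈ G, ∀ y ∈ G', vprod x y ∈ H)
    (e : endAlg T H) : ∃ z : endAlg T G ⊗[Λ] endAlg T G',
      ∀ (x y : V) (hx : x ∈ G) (hy : y ∈ G'),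
        tensorEval hx hy z = t.prodEval (hH x hx y hy) e := by
  classical
  have := flat_endAlg ht G
  have := projective_total T ht.projective G
  have := projective_total T ht.projective G'
  obtain ⟨z, hz⟩ := exists_endTensor_map (diagOp T G) (diagOp T G') (mem_range_diagOp T)
    (diagOp_injective T G) (mem_range_diagOp T) (prodBlock t hH e)
    (fun r hr => prodBlock_comm_rTensor ht.isUGM hH e hr)
    (fun r hr => prodBlock_comm_lTensor ht.isUGM hH e hr)
  refine ⟨z, fun x y hx hy => LinearMap.ext fun m => ?_⟩
  rw [← projTensor_singleTensor (M := fun x : G => T.obj x.1) (N := fun y : G' => T.obj y.1)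
    ⟨x, hx⟩ ⟨y, hy⟩ m, ← projTensor_diagOp ⟨x, hx⟩ ⟨y, hy⟩, hz, projTensor_prodBlock]

/-- The map underlying the comultiplication. -/
def comulFun (ht : t.Admissible) {G G' H : Finset V} (hH : ∀ x ∈ G, ∀ y ∈ G', vprod x y ∈ H)
    (e : endAlg T H) : endAlg T G ⊗[Λ] endAlg T G' :=
  (exists_comul ht hH e).choose

lemma tensorEval_comulFun (ht : t.Admissible) {G G' H : Finset V}
    (hH : ∀ x ∈ G, ∀ y ∈ G', vprod x y ∈ H) (e : endAlg T H) {x y : V} (hx : x ∈ G) (hy : y ∈ G') :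
    tensorEval hx hy (comulFun ht hH e) = t.prodEval (hH x hx y hy) e :=
  (exists_comul ht hH e).choose_spec x y hx hy

set_option synthInstance.maxHeartbeats 100000 in
/-- The comultiplication `End(T|_H) → End(T|_G) ⊗ End(T|_G')` for `H` containing the products of
vertices of `G` and `G'`. -/
def comul (ht : t.Admissible) {G G' H : Finset V} (hH : ∀ x ∈ G, ∀ y ∈ G', vprod x y ∈ H) :
    endAlg T H →ₐ[Λ] endAlg T G ⊗[Λ] endAlg T G' :=
  AlgHom.ofLinearMap
    { toFun := comulFun ht hH
      map_add' := fun e e' => tensorEval_ext ht fun x y hx hy => by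
        simp only [map_add, tensorEval_comulFun]
      map_smul' := fun r e => tensorEval_ext ht fun x y hx hy => by
        simp only [map_smul, tensorEval_comulFun, RingHom.id_apply] }
    (tensorEval_ext ht fun x y hx hy => by
      simp only [LinearMap.coe_mk, AddHom.coe_mk, tensorEval_comulFun, map_one])
    fun e e' => tensorEval_ext ht fun x y hx hy => by
      simp only [LinearMap.coe_mk, AddHom.coe_mk, tensorEval_comulFun, map_mul]

lemma tensorEval_comul (ht : t.Admissible) {G G' H : Finset V}
    (hH : ∀ x ∈ G, ∀ y ∈ G', vprod x y ∈ H) (e : endAlg T H) {x y : V} (hx : x ∈ G) (hy : y ∈ G') :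
    tensorEval hx hy (comul ht hH e) = t.prodEval (hH x hx y hy) e :=
  tensorEval_comulFun ht hH e hx hy

lemma comul_res (ht : t.Admissible) {G G' H G₁ G₁' H₁ : Finset V}
    (hH : ∀ x ∈ G, ∀ y ∈ G', vprod x y ∈ H) (hH₁ : ∀ x ∈ G₁, ∀ y ∈ G₁', vprod x y ∈ H₁)
    (h : G ⊆ G₁) (h' : G' ⊆ G₁') (h'' : H ⊆ H₁) (e : endAlg T H₁) :
    comul ht hH (endAlgRes T h'' e) =
      Algebra.TensorProduct.map (endAlgRes T h) (endAlgRes T h') (comul ht hH₁ e) := by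
  refine tensorEval_ext ht fun x y hx hy => ?_
  rw [tensorEval_comul, tensorEval_res, tensorEval_comul]
  rfl

open Classical in
/-- The tensor product of two objects of `C(T)`. -/
def tensor (ht : t.Admissible) (X Y : NoriCat T) : NoriCat T where
  supp := Finset.image₂ vprod X.supp Y.supp
  carrier := X.carrier ⊗ Y.carrier
  action := (tensorAct X Y subset_rfl subset_rfl).comp
    (comul ht fun _ hx _ hy => Finset.mem_image₂_of_mem hx hy)

/-- The action on a tensor product is defined through the supports of the factors. That any larger
vertex sets compute the same action allows objects with different supports to be compared. -/
lemma act_tensor (ht : t.Admissible) (X Y : NoriCat T) {G G' H : Finset V}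
    (hH : ∀ x ∈ G, ∀ y ∈ G', vprod x y ∈ H) (hX : X.supp ⊆ G) (hY : Y.supp ⊆ G')
    (h : (tensor ht X Y).supp ⊆ H) (e : endAlg T H) :
    (tensor ht X Y).act h e = tensorAct X Y hX hY (comul ht hH e) := by
  classical
  exact (congrArg (tensorAct X Y subset_rfl subset_rfl) (comul_res ht
    (fun _ hx _ hy => Finset.mem_image₂_of_mem hx hy) hH hX hY h e)).trans (tensorAct_res ..)

lemma tensor_mem_homs (ht : t.Admissible) {X X' Y Y' : NoriCat T} (f : X ⟶ X') (g : Y ⟶ Y') :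
    f.1 ⊗ₘ g.1 ∈ homs (tensor ht X Y) (tensor ht X' Y') := by
  classical
  obtain ⟨G, hX, hX', hf⟩ := exists_linear f
  obtain ⟨G', hY, hY', hg⟩ := exists_linear g
  have hH : ∀ x ∈ G, ∀ y ∈ G', vprod x y ∈ Finset.image₂ vprod G G' :=
    fun _ hx _ hy => Finset.mem_image₂_of_mem hx hy
  have h1 : (tensor ht X Y).supp ⊆ Finset.image₂ vprod G G' := Finset.image₂_subset hX hY
  have h2 : (tensor ht X' Y').supp ⊆ Finset.image₂ vprod G G' := Finset.image₂_subset hX' hY'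
  refine (homMk (X := tensor ht X Y) (Y := tensor ht X' Y') (FGModuleCat.lin (f.1 ⊗ₘ g.1)) h1 h2
    fun e m => ?_).2
  rw [act_tensor ht X Y hH hX hY, act_tensor ht X' Y' hH hX' hY']
  exact tensorAct_map hX hX' hY hY' _ _ hf hg _ m

lemma tau_mem_homs (ht : t.Admissible) (x y : V) :
    (t.τ x y).hom ∈ homs ((rep T).obj (vprod x y)) (tensor ht ((rep T).obj x) ((rep T).obj y)) := by
  classical
  have h1 : (tensor ht ((rep T).obj x) ((rep T).obj y)).supp ⊆ {vprod x y} := by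
    change Finset.image₂ vprod {x} {y} ⊆ _
    rw [Finset.image₂_singleton]
  refine (homMk (X := (rep T).obj (vprod x y)) (Y := tensor ht ((rep T).obj x) ((rep T).obj y))
    (FGModuleCat.lin (t.τ x y).hom) (subset_refl {vprod x y}) h1 fun e m => ?_).2
  rw [act_tensor ht _ _ (G := {x}) (G' := {y}) (by simp) subset_rfl subset_rfl]
  have := tensorEval_comul ht (G := {x}) (G' := {y}) (H := {vprod x y}) (by simp) e
    (Finset.mem_singleton_self x) (Finset.mem_singleton_self y)
  refine Eq.trans ?_ (LinearMap.congr_fun this _).symm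
  exact (ProductData.prodEval_tau _ _ _).symm

end NoriCat

end

/-! ### Extending lifts from the universal representation -/

section

open FGModuleCat FiniteProjective
open scoped TensorProduct

namespace CategoryTheory.Functor

section

variable {C : Type u₁} [Category.{v₁} C] {D : Type u₂} [Category.{v₂} D] {U : C ⥤ D}

variable (U) in
/-- A morphism between values of `U` is the image of a morphism. -/
def LiftsHom {A B : C} (f : U.obj A ⟶ U.obj B) : Prop := ∃ g : A ⟶ B, U.map g = f

lemma liftsHom_map {A B : C} (g : A ⟶ B) : U.LiftsHom (U.map g) := ⟨g, rfl⟩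

lemma LiftsHom.comp {A B E : C} {f : U.obj A ⟶ U.obj B} {g : U.obj B ⟶ U.obj E}
    (hf : U.LiftsHom f) (hg : U.LiftsHom g) : U.LiftsHom (f ≫ g) := by
  obtain ⟨f, rfl⟩ := hf
  obtain ⟨g, rfl⟩ := hg
  exact ⟨f ≫ g, U.map_comp f g⟩

lemma LiftsHom.of_comp_left {A B E : C} (g : A ⟶ B) [IsIso g] {f : U.obj B ⟶ U.obj E}
    (h : U.LiftsHom (U.map g ≫ f)) : U.LiftsHom f := by
  obtain ⟨k, hk⟩ := h
  refine ⟨CategoryTheory.inv g ≫ k, ?_⟩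
  rw [U.map_comp, hk, U.map_inv, IsIso.inv_hom_id_assoc]

lemma LiftsHom.of_comp_right {A B E : C} {f : U.obj A ⟶ U.obj B} (g : B ⟶ E) [IsIso g]
    (h : U.LiftsHom (f ≫ U.map g)) : U.LiftsHom f := by
  obtain ⟨k, hk⟩ := h
  refine ⟨k ≫ CategoryTheory.inv g, ?_⟩
  rw [U.map_comp, hk, U.map_inv, Category.assoc, IsIso.hom_inv_id, Category.comp_id]

lemma LiftsHom.inv [U.ReflectsIsomorphisms] {A B : C} {e : U.obj A ≅ U.obj B}
    (h : U.LiftsHom e.hom) : U.LiftsHom e.inv := by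
  obtain ⟨f, hf⟩ := h
  have : IsIso (U.map f) := hf ▸ e.isIso_hom
  have : IsIso f := isIso_of_reflects_iso f U
  refine ⟨CategoryTheory.inv f, ?_⟩
  rw [Functor.map_inv, IsIso.inv_eq_of_hom_inv_id]
  rw [hf, e.hom_inv_id]

/-- An isomorphism that lifts to a morphism lifts to an isomorphism. -/
def LiftsHom.iso [U.ReflectsIsomorphisms] {A B : C} {e : U.obj A ≅ U.obj B}
    (h : U.LiftsHom e.hom) : A ≅ B :=
  have : IsIso (U.map h.choose) := by
    rw [h.choose_spec]
    infer_instance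
  have : IsIso h.choose := isIso_of_reflects_iso _ U
  asIso h.choose

lemma LiftsHom.map_iso_hom [U.ReflectsIsomorphisms] {A B : C} {e : U.obj A ≅ U.obj B}
    (h : U.LiftsHom e.hom) : U.map h.iso.hom = e.hom := h.choose_spec

end

lemma liftsHom_iff {Λ : Type u} [CommRing Λ] {C : Type u₁} [Category.{v₁} C]
    {U : C ⥤ FGModuleCat.{u} Λ} {A B : C} (f : U.obj A ⟶ U.obj B) :
    U.LiftsHom f ↔ U.Lifts (lin f) :=
  ⟨fun ⟨g, hg⟩ => ⟨g, congrArg lin hg⟩, fun ⟨g, hg⟩ => ⟨g, FGModuleCat.hom_ext hg⟩⟩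

end CategoryTheory.Functor

namespace NoriCat

section

variable {Λ : Type u} [CommRing Λ] [IsNoetherianRing Λ] {V : Type v} [Quiver.{w} V]
  {T : V ⥤q FGModuleCat.{u} Λ} {C : Type u₁} [Category.{v₁} C] [Abelian C]
  {U : C ⥤ FGModuleCat.{u} Λ} [U.Additive] [U.Faithful] [PreservesFiniteLimits U]
  [PreservesFiniteColimits U] {H K : NoriCat T ⥤ C} {E : FGModuleCat.{u} Λ}

/-- A transformation that lifts on the objects `T̃ v` lifts on the regular modules. -/
lemma liftsHom_reg [Module.Flat Λ E] (e : H ⋙ U ⟶ K ⋙ U) (eK : K ⋙ U ≅ forget T ⋙ tensorRight E)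
    (h : ∀ x, U.LiftsHom (A := H.obj ((rep T).obj x)) (B := K.obj ((rep T).obj x)) (e.app _))
    (G : Finset V) : U.LiftsHom (A := H.obj (reg T G)) (B := K.obj (reg T G)) (e.app _) := by
  refine reg_induction (P := fun X => U.LiftsHom (A := H.obj X) (B := K.obj X) (e.app X)) h G ?_
  intro n D g hg hD
  rw [Functor.liftsHom_iff]
  -- Up to `eK`, `K` tensors underlying modules with the flat module `E`, so the maps `K (g i)`
  -- remain jointly injective. By naturality the composites with them factor through the components
  -- at the `D i`, which lift.
  refine Functor.lifts_of_jointly_injective _ (fun i => K.map (g i)) (fun x hx => ?_) fun i => ?_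
  · have h1 : FGModuleCat.lin (eK.hom.app (reg T G)) x = 0 := by
      refine rTensor_jointly_injective (E := E) (fun i => lin (g i)) hg _ fun i => ?_
      have := LinearMap.congr_fun (congrArg FGModuleCat.lin (eK.hom.naturality (g i))) x
      refine this.symm.trans ?_
      exact (congrArg (FGModuleCat.lin (eK.hom.app (D i))) (hx i)).trans (map_zero _)
    have h2 := LinearMap.congr_fun (congrArg FGModuleCat.lin (eK.hom_inv_id_app (reg T G))) x
    refine h2.symm.trans ?_
    exact (congrArg (FGModuleCat.lin (eK.inv.app (reg T G))) h1).trans (map_zero _)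
  · have := congrArg FGModuleCat.lin (e.naturality (g i))
    have h3 := (Functor.liftsHom_iff _).1 (hD i)
    have h4 := h3.comp (Functor.lifts_linMap (U := U) (H.map (g i)))
    exact (congrArg U.Lifts this).mp h4

/-- A transformation that lifts on the regular modules lifts. -/
lemma liftsHom_of_reg (e : H ⋙ U ⟶ K ⋙ U) (eH : H ⋙ U ≅ forget T ⋙ tensorRight E)
    (h : ∀ G, U.LiftsHom (A := H.obj (reg T G)) (B := K.obj (reg T G)) (e.app _)) (X : NoriCat T) :
    U.LiftsHom (A := H.obj X) (B := K.obj X) (e.app X) := by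
  refine induction_of_reg (P := fun X => U.LiftsHom (A := H.obj X) (B := K.obj X) (e.app X)) h X ?_
  intro n D g hg hD
  rw [Functor.liftsHom_iff]
  -- Dual to the embedding step, with the condition placed on `H`; surjectivity survives every
  -- tensor product, so `E` need not be flat.
  refine Functor.lifts_of_jointly_surjective _ (fun i => H.map (g i)) (fun x => ?_) fun i => ?_
  · obtain ⟨y, hy⟩ := rTensor_jointly_surjective (E := E) (fun i => lin (g i)) hg
      (FGModuleCat.lin (eH.hom.app X) x)
    refine ⟨fun i => FGModuleCat.lin (eH.inv.app (D i)) (y i), ?_⟩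
    have h2 := LinearMap.congr_fun (congrArg FGModuleCat.lin (eH.hom_inv_id_app X)) x
    refine Eq.trans ?_ h2
    refine Eq.trans ?_ (congrArg (FGModuleCat.lin (eH.inv.app X)) hy)
    refine Eq.trans ?_ (_root_.map_sum _ _ _).symm
    refine Finset.sum_congr rfl fun i _ => ?_
    exact (LinearMap.congr_fun (congrArg FGModuleCat.lin (eH.inv.naturality (g i))) (y i)).symm
  · have := congrArg FGModuleCat.lin (e.naturality (g i))
    have h3 := (Functor.liftsHom_iff _).1 (hD i)
    have h4 := (Functor.lifts_linMap (U := U) (K.map (g i))).comp h3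
    exact (congrArg U.Lifts this.symm).mp h4

end

end NoriCat

end

/-! ### Lifting the associativity, symmetry and unit isomorphisms -/

section

open GradedDiagram CommProductDiagram UnitalProductDiagram
open FGModuleCat FiniteProjective
open scoped TensorProduct

namespace NoriCat

variable {Λ : Type u} [CommRing Λ] [IsNoetherianRing Λ] {V : Type v} [UnitalProductDiagram.{w} V]
  {T : V ⥤q FGModuleCat.{u} Λ} {t : ProductData T}

/-- The tensor product of morphisms of `C(T)`. -/
def tensorMap (ht : t.Admissible) {X X' Y Y' : NoriCat T} (f : X ⟶ X') (g : Y ⟶ Y') :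
    tensor ht X Y ⟶ tensor ht X' Y' := ⟨f.1 ⊗ₘ g.1, tensor_mem_homs ht f g⟩

/-- Tensoring with an object on the left. -/
def tensorL (ht : t.Admissible) (X : NoriCat T) : NoriCat T ⥤ NoriCat T where
  obj Y := tensor ht X Y
  map g := ⟨X.carrier ◁ g.1, by
    rw [← id_tensorHom]
    exact tensor_mem_homs ht (𝟙 X) g⟩
  map_id Y := Subtype.ext (whiskerLeft_id X.carrier Y.carrier)
  map_comp f g := Subtype.ext (whiskerLeft_comp X.carrier f.1 g.1)

/-- Tensoring with an object on the right. -/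
def tensorR (ht : t.Admissible) (Y : NoriCat T) : NoriCat T ⥤ NoriCat T where
  obj X := tensor ht X Y
  map f := ⟨f.1 ▷ Y.carrier, by
    rw [← tensorHom_id]
    exact tensor_mem_homs ht f (𝟙 Y)⟩
  map_id X := Subtype.ext (id_whiskerRight X.carrier Y.carrier)
  map_comp f g := Subtype.ext (comp_whiskerRight f.1 g.1 Y.carrier)

omit [IsNoetherianRing Λ] in
lemma inv_mem_homs {X Y : NoriCat T} (e : X.carrier ≅ Y.carrier) (h : e.hom ∈ homs X Y) :
    e.inv ∈ homs Y X := by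
  have h' : (forget T).LiftsHom (A := X) (B := Y) e.hom := ⟨⟨e.hom, h⟩, rfl⟩
  obtain ⟨g, hg⟩ := Functor.LiftsHom.inv (U := forget T) (A := X) (B := Y) (e := e) h'
  exact hg ▸ g.2

/-- An isomorphism of underlying modules that is a morphism is an isomorphism. -/
def isoMk {X Y : NoriCat T} (e : X.carrier ≅ Y.carrier) (h : e.hom ∈ homs X Y) : X ≅ Y where
  hom := ⟨e.hom, h⟩
  inv := ⟨e.inv, inv_mem_homs e h⟩
  hom_inv_id := Subtype.ext e.hom_inv_id
  inv_hom_id := Subtype.ext e.inv_hom_id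

/-- The multiplicativity isomorphisms of `T̃`. -/
def repTau (ht : t.Admissible) (x y : V) :
    (rep T).obj (vprod x y) ≅ tensor ht ((rep T).obj x) ((rep T).obj y) :=
  isoMk (Y := tensor ht ((rep T).obj x) ((rep T).obj y)) (t.τ x y) (tau_mem_homs ht x y)

/-- Tensoring on the right, on underlying modules. -/
def tensorRForget (ht : t.Admissible) (Y : NoriCat T) :
    tensorR ht Y ⋙ forget T ≅ forget T ⋙ tensorRight Y.carrier :=
  NatIso.ofComponents (fun _ => Iso.refl _) fun f => (Category.comp_id _).trans (Category.id_comp _).symm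

/-- Tensoring on the left, on underlying modules. -/
def tensorLForget (ht : t.Admissible) (X : NoriCat T) :
    tensorL ht X ⋙ forget T ≅ forget T ⋙ tensorRight X.carrier :=
  NatIso.ofComponents (fun Y => β_ X.carrier Y.carrier) fun f =>
    BraidedCategory.braiding_naturality_right X.carrier f.1

lemma flat_rep (ht : t.Admissible) (x : V) : Module.Flat Λ ((rep T).obj x).carrier :=
  have := ht.projective x
  inferInstanceAs (Module.Flat Λ (T.obj x))

lemma flat_reg (ht : t.Admissible) (G : Finset V) : Module.Flat Λ (reg T G).carrier :=
  have := flat_endAlg ht G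
  Module.Flat.of_linearEquiv (regEquiv T G)

lemma flat_tensor {A B : FGModuleCat.{u} Λ} (hA : Module.Flat Λ A) (hB : Module.Flat Λ B) :
    Module.Flat Λ ((A ⊗ B : FGModuleCat.{u} Λ)) :=
  inferInstanceAs (Module.Flat Λ (A ⊗[Λ] B))

section Associator

variable (ht : t.Admissible)

/-- The associativity isomorphism lifts for the three given objects. -/
def LiftsAssoc (X Y Z : NoriCat T) : Prop :=
  (forget T).LiftsHom (A := tensor ht X (tensor ht Y Z)) (B := tensor ht (tensor ht X Y) Z)
    (α_ X.carrier Y.carrier Z.carrier).inv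

/-- The associativity isomorphism as a transformation in the first variable. -/
def assocFst (Y Z : NoriCat T) :
    tensorR ht (tensor ht Y Z) ⋙ forget T ≅ (tensorR ht Y ⋙ tensorR ht Z) ⋙ forget T :=
  NatIso.ofComponents (fun X => (α_ X.carrier Y.carrier Z.carrier).symm) fun f =>
    associator_inv_naturality_left f.1 Y.carrier Z.carrier

/-- The associativity isomorphism as a transformation in the second variable. -/
def assocSnd (X Z : NoriCat T) :
    (tensorR ht Z ⋙ tensorL ht X) ⋙ forget T ≅ (tensorL ht X ⋙ tensorR ht Z) ⋙ forget T :=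
  NatIso.ofComponents (fun Y => (α_ X.carrier Y.carrier Z.carrier).symm) fun f =>
    associator_inv_naturality_middle X.carrier f.1 Z.carrier

/-- The associativity isomorphism as a transformation in the third variable. -/
def assocThd (X Y : NoriCat T) :
    (tensorL ht Y ⋙ tensorL ht X) ⋙ forget T ≅ tensorL ht (tensor ht X Y) ⋙ forget T :=
  NatIso.ofComponents (fun Z => (α_ X.carrier Y.carrier Z.carrier).symm) fun f =>
    associator_inv_naturality_right X.carrier Y.carrier f.1

/-- The middle tensor factor, on underlying modules. -/
def tensorMidForget (X Z : NoriCat T) :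
    (tensorR ht Z ⋙ tensorL ht X) ⋙ forget T ≅ forget T ⋙ tensorRight (Z.carrier ⊗ X.carrier) :=
  NatIso.ofComponents (fun Y => β_ X.carrier (Y.carrier ⊗ Z.carrier) ≪≫
      α_ Y.carrier Z.carrier X.carrier) fun {Y Y'} f => by
    change X.carrier ◁ (f.1 ▷ Z.carrier) ≫ (β_ X.carrier (Y'.carrier ⊗ Z.carrier)).hom ≫
      (α_ Y'.carrier Z.carrier X.carrier).hom = ((β_ X.carrier (Y.carrier ⊗ Z.carrier)).hom ≫
      (α_ Y.carrier Z.carrier X.carrier).hom) ≫ f.1 ▷ (Z.carrier ⊗ X.carrier)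
    rw [BraidedCategory.braiding_naturality_right_assoc, associator_naturality_left, Category.assoc]

/-- The ugm axiom for the associativity edge, solved for the associator, writes it as a composite of
morphisms of `C(T)`. -/
lemma liftsAssoc_rep (x y z : V) :
    LiftsAssoc ht ((rep T).obj x) ((rep T).obj y) ((rep T).obj z) := by
  have h : T.obj x ◁ (t.τ y z).inv ≫ (t.τ x (vprod y z)).inv ≫ T.map (assocEdge x y z) ≫
      (t.τ (vprod x y) z).hom ≫ (t.τ x y).hom ▷ T.obj z =
      (α_ (T.obj x) (T.obj y) (T.obj z)).inv := by
    rw [ht.isUGM.assoc, Iso.inv_hom_id_assoc, whiskerLeft_inv_hom_assoc]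
  refine ⟨(tensorL ht ((rep T).obj x)).map (repTau ht y z).inv ≫ (repTau ht x (vprod y z)).inv ≫
    (rep T).map (assocEdge x y z) ≫ (repTau ht (vprod x y) z).hom ≫
    (tensorR ht ((rep T).obj z)).map (repTau ht x y).hom, h⟩

/-- The associativity isomorphisms lift. -/
lemma liftsAssoc (X Y Z : NoriCat T) : LiftsAssoc ht X Y Z := by
  -- All three variables are first moved from the `T̃ v` to regular modules, while the other two
  -- factors are still flat. Only afterwards are they replaced by arbitrary objects, a step that
  -- needs no flatness.
  have h1 : ∀ x y G, LiftsAssoc ht ((rep T).obj x) ((rep T).obj y) (reg T G) := fun x y G =>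
    have : Module.Flat Λ (tensor ht ((rep T).obj x) ((rep T).obj y)).carrier :=
      flat_tensor (flat_rep ht x) (flat_rep ht y)
    liftsHom_reg (assocThd ht ((rep T).obj x) ((rep T).obj y)).hom (tensorLForget ht _)
      (liftsAssoc_rep ht x y) G
  have h2 : ∀ x G' G, LiftsAssoc ht ((rep T).obj x) (reg T G') (reg T G) := fun x G' G =>
    have : Module.Flat Λ ((reg T G).carrier ⊗ ((rep T).obj x).carrier : FGModuleCat.{u} Λ) :=
      flat_tensor (flat_reg ht G) (flat_rep ht x)
    liftsHom_reg (assocSnd ht ((rep T).obj x) (reg T G)).hom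
      ((assocSnd ht _ _).symm ≪≫ tensorMidForget ht _ _) (fun y => h1 x y G) G'
  have h3 : ∀ G'' G' G, LiftsAssoc ht (reg T G'') (reg T G') (reg T G) := fun G'' G' G =>
    have : Module.Flat Λ (tensor ht (reg T G') (reg T G)).carrier :=
      flat_tensor (flat_reg ht G') (flat_reg ht G)
    liftsHom_reg (assocFst ht (reg T G') (reg T G)).hom
      ((assocFst ht _ _).symm ≪≫ tensorRForget ht _) (fun x => h2 x G' G) G''
  have h4 : ∀ X G' G, LiftsAssoc ht X (reg T G') (reg T G) := fun X G' G =>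
    liftsHom_of_reg (assocFst ht (reg T G') (reg T G)).hom (tensorRForget ht _)
      (fun G'' => h3 G'' G' G) X
  have h5 : ∀ X Y G, LiftsAssoc ht X Y (reg T G) := fun X Y G =>
    liftsHom_of_reg (assocSnd ht X (reg T G)).hom (tensorMidForget ht _ _) (fun G' => h4 X G' G) Y
  exact liftsHom_of_reg (assocThd ht X Y).hom ((assocThd ht X Y) ≪≫ tensorLForget ht _)
    (fun G => h5 X Y G) Z

end Associator

section Braiding

variable (ht : t.Admissible)

/-- The symmetry isomorphism lifts for the two given objects. -/
def LiftsBraiding (X Y : NoriCat T) : Prop :=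
  (forget T).LiftsHom (A := tensor ht X Y) (B := tensor ht Y X) (β_ X.carrier Y.carrier).hom

/-- The symmetry as a transformation in the first variable. -/
def braidingFst (Y : NoriCat T) : tensorR ht Y ⋙ forget T ≅ tensorL ht Y ⋙ forget T :=
  NatIso.ofComponents (fun X => β_ X.carrier Y.carrier) fun f =>
    BraidedCategory.braiding_naturality_left f.1 Y.carrier

/-- The symmetry as a transformation in the second variable. -/
def braidingSnd (X : NoriCat T) : tensorL ht X ⋙ forget T ≅ tensorR ht X ⋙ forget T :=
  NatIso.ofComponents (fun Y => β_ X.carrier Y.carrier) fun f =>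
    BraidedCategory.braiding_naturality_right X.carrier f.1

/-- The commutativity edge gives the symmetry up to the Koszul sign, an integer of square one that
can be multiplied away inside `C(T)`. -/
lemma liftsBraiding_rep (x y : V) : LiftsBraiding ht ((rep T).obj x) ((rep T).obj y) := by
  have h : koszulSign (deg x * deg y) • ((t.τ x y).inv ≫
      T.map (commEdge x y) ≫ (t.τ y x).hom) = (β_ (T.obj x) (T.obj y)).hom := by
    rw [ht.isUGM.comm, koszulSign_smul_smul]
  refine ⟨koszulSign (deg x * deg y) • ((repTau ht x y).inv ≫
    (rep T).map (commEdge x y) ≫ (repTau ht y x).hom), ?_⟩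
  rw [Functor.map_zsmul]
  exact h

/-- The symmetry isomorphisms lift. -/
lemma liftsBraiding (X Y : NoriCat T) : LiftsBraiding ht X Y := by
  have h1 : ∀ x G, LiftsBraiding ht ((rep T).obj x) (reg T G) := fun x G =>
    have := flat_rep ht x
    liftsHom_reg (braidingSnd ht ((rep T).obj x)).hom (tensorRForget ht _)
      (liftsBraiding_rep ht x) G
  have h2 : ∀ G' G, LiftsBraiding ht (reg T G') (reg T G) := fun G' G =>
    have := flat_reg ht G
    liftsHom_reg (braidingFst ht (reg T G)).hom (tensorLForget ht _) (fun x => h1 x G) G'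
  have h3 : ∀ X G, LiftsBraiding ht X (reg T G) := fun X G =>
    liftsHom_of_reg (braidingFst ht (reg T G)).hom (tensorRForget ht _) (fun G' => h2 G' G) X
  exact liftsHom_of_reg (braidingSnd ht X).hom (tensorLForget ht _) (fun G => h3 X G) Y

end Braiding

section Unitor

omit [IsNoetherianRing Λ] in
lemma exists_eq_smul_id {A : FGModuleCat.{u} Λ} (i : 𝟙_ (FGModuleCat.{u} Λ) ≅ A) (f : A ⟶ A) :
    ∃ r : Λ, f = r • 𝟙 A := by
  have key : ∀ g : 𝟙_ (FGModuleCat.{u} Λ) ⟶ 𝟙_ (FGModuleCat.{u} Λ), ∃ r : Λ, g = r • 𝟙 _ := by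
    intro g
    let g' : Λ →ₗ[Λ] Λ := FGModuleCat.lin g
    refine ⟨g' 1, FGModuleCat.hom_ext ?_⟩
    change g' = g' 1 • LinearMap.id
    ext
    simp
  obtain ⟨r, hr⟩ := key (i.hom ≫ f ≫ i.inv)
  refine ⟨r, ?_⟩
  rw [← cancel_epi i.hom, ← cancel_mono i.inv, Category.assoc, hr]
  simp

variable (t) in
/-- The left unit isomorphism on underlying modules. -/
def unitorIso (A : FGModuleCat.{u} Λ) : T.obj one ⊗ A ≅ A :=
  whiskerRightIso t.unitIso.symm A ≪≫ λ_ A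

omit [IsNoetherianRing Λ] in
lemma unitorIso_naturality {A B : FGModuleCat.{u} Λ} (f : A ⟶ B) :
    T.obj one ◁ f ≫ (unitorIso t B).hom = (unitorIso t A).hom ≫ f := by
  simp only [unitorIso, Iso.trans_hom, whiskerRightIso_hom, Iso.symm_hom, Category.assoc]
  rw [whisker_exchange_assoc, leftUnitor_naturality]

omit [IsNoetherianRing Λ] in
lemma unitorIso_tensor (A B : FGModuleCat.{u} Λ) :
    (unitorIso t (A ⊗ B)).hom = (α_ (T.obj one) A B).inv ≫ (unitorIso t A).hom ▷ B := by
  simp only [unitorIso, Iso.trans_hom, whiskerRightIso_hom, Iso.symm_hom, comp_whiskerRight,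
    leftUnitor_tensor_hom, whiskerRight_tensor, Category.assoc, Iso.hom_inv_id_assoc,
    Iso.inv_hom_id_assoc]

variable (ht : t.Admissible)

/-- The left unit isomorphism lifts. -/
def LiftsUnitor (X : NoriCat T) : Prop :=
  (forget T).LiftsHom (A := tensor ht ((rep T).obj one) X) (B := X) (unitorIso t X.carrier).hom

/-- The left unit isomorphism as a transformation. -/
def unitorTrans : tensorL ht ((rep T).obj one) ⋙ forget T ≅ 𝟭 _ ⋙ forget T :=
  NatIso.ofComponents (fun X => unitorIso t X.carrier) fun f => unitorIso_naturality f.1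

/-- The isomorphism `T̃ x ≅ T̃ 1 ⊗ T̃ x` given by the unit edge. -/
lemma exists_unitEdge_iso (x : V) :
    ∃ g : (rep T).obj x ⟶ tensor ht ((rep T).obj one) ((rep T).obj x), IsIso g := by
  refine ⟨(rep T).map (unitEdge x) ≫ (repTau ht one x).hom, ?_⟩
  have h1 : IsIso ((forget T).map ((rep T).map (unitEdge x))) := ht.isUGM.unit x
  have := isIso_of_reflects_iso ((rep T).map (unitEdge x)) (forget T)
  infer_instance

/-- The unit edge at `1` gives an isomorphism `g` in `C(T)`, not necessarily the canonical one.
Following it by the unit isomorphism gives an endomorphism of `T 1 ≅ Λ`, thus a scalar, which lifts;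
then `g` is cancelled. -/
lemma liftsUnitor_one : LiftsUnitor ht ((rep T).obj one) := by
  obtain ⟨g, hg⟩ := exists_unitEdge_iso ht one
  obtain ⟨r, hr⟩ := exists_eq_smul_id t.unitIso
    ((forget T).map g ≫ (unitorIso t (T.obj one)).hom)
  exact Functor.LiftsHom.of_comp_left g
    ⟨r • 𝟙 _, ((forget T).map_smul r (𝟙 ((rep T).obj one))).trans hr.symm⟩

/-- On `T̃ 1 ⊗ T̃ x` the unit isomorphism is the inverse associator followed by the unit isomorphism
of `T̃ 1` tensored with `T̃ x`, so it lifts. Naturality along the isomorphism `g` from `T̃ x`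
transfers this to `T̃ x`. -/
lemma liftsUnitor_rep (x : V) : LiftsUnitor ht ((rep T).obj x) := by
  obtain ⟨g, hg⟩ := exists_unitEdge_iso ht x
  obtain ⟨c, hc⟩ := liftsUnitor_one ht
  have h1 : LiftsUnitor ht (tensor ht ((rep T).obj one) ((rep T).obj x)) :=
    (congrArg ((forget T).LiftsHom (A := tensor ht ((rep T).obj one)
      (tensor ht ((rep T).obj one) ((rep T).obj x))) (B := tensor ht ((rep T).obj one)
      ((rep T).obj x))) (unitorIso_tensor (t := t) (T.obj one) (T.obj x))).mpr
    (Functor.LiftsHom.comp (liftsAssoc ht ((rep T).obj one) ((rep T).obj one) ((rep T).obj x))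
      ⟨(tensorR ht ((rep T).obj x)).map c, congrArg (fun k => k ▷ T.obj x) hc⟩)
  exact Functor.LiftsHom.of_comp_right g
    ((congrArg (Functor.LiftsHom _) (unitorIso_naturality (t := t) g.1)).mp
      (Functor.LiftsHom.comp
        (Functor.liftsHom_map (U := forget T) ((tensorL ht ((rep T).obj one)).map g)) h1))

/-- The left unit isomorphisms lift. -/
lemma liftsUnitor (X : NoriCat T) : LiftsUnitor ht X := by
  have h1 : ∀ G, LiftsUnitor ht (reg T G) := fun G =>
    have : Module.Flat Λ (𝟙_ (FGModuleCat.{u} Λ)) := inferInstanceAs (Module.Flat Λ Λ)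
    liftsHom_reg (unitorTrans ht).hom (E := 𝟙_ _)
      (NatIso.ofComponents (fun X => (ρ_ X.carrier).symm) fun f => rightUnitor_inv_naturality f.1)
      (liftsUnitor_rep ht) G
  exact liftsHom_of_reg (unitorTrans ht).hom (tensorLForget ht _) h1 X

end Unitor

end NoriCat

end

/-! ### The monoidal structure on `C(T)` -/

section

open GradedDiagram CommProductDiagram UnitalProductDiagram
open FGModuleCat FiniteProjective

namespace NoriCat

variable {Λ : Type u} [CommRing Λ] [IsNoetherianRing Λ] {V : Type v} [UnitalProductDiagram.{w} V]
  {T : V ⥤q FGModuleCat.{u} Λ} {t : ProductData T} (ht : t.Admissible)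

lemma mem_homs_of_liftsHom {X Y : NoriCat T} {f : X.carrier ⟶ Y.carrier}
    (h : (forget T).LiftsHom (A := X) (B := Y) f) : f ∈ homs X Y := by
  obtain ⟨g, rfl⟩ := h
  exact g.2

/-- The operations of the monoidal structure on `C(T)`. -/
@[reducible]
def monoidalStruct : MonoidalCategoryStruct (NoriCat T) where
  tensorObj := tensor ht
  whiskerLeft X _ _ f := (tensorL ht X).map f
  whiskerRight f Y := (tensorR ht Y).map f
  tensorHom f g := tensorMap ht f g
  -- The unit is `T̃ 1`, not `Λ` itself: it carries an action by construction, and its underlying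
  -- module is identified with `Λ` by `t.unitIso`.
  tensorUnit := (rep T).obj one
  associator X Y Z := (isoMk (X := tensor ht X (tensor ht Y Z)) (Y := tensor ht (tensor ht X Y) Z)
    (α_ X.carrier Y.carrier Z.carrier).symm (mem_homs_of_liftsHom (liftsAssoc ht X Y Z))).symm
  leftUnitor X := isoMk (X := tensor ht ((rep T).obj one) X) (unitorIso t X.carrier)
    (mem_homs_of_liftsHom (liftsUnitor ht X))
  rightUnitor X :=
    isoMk (X := tensor ht X ((rep T).obj one)) (Y := tensor ht ((rep T).obj one) X)
      (β_ X.carrier (T.obj one)) (mem_homs_of_liftsHom (liftsBraiding ht X ((rep T).obj one))) ≪≫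
    isoMk (X := tensor ht ((rep T).obj one) X) (unitorIso t X.carrier)
      (mem_homs_of_liftsHom (liftsUnitor ht X))

/-- The right unitor of `C(T)` is defined as the symmetry followed by the left unitor; this
identifies its underlying map with the standard right unitor of modules. -/
lemma braiding_unitorIso (A : FGModuleCat.{u} Λ) :
    (β_ A (T.obj one)).hom ≫ (unitorIso t A).hom = A ◁ t.unitIso.inv ≫ (ρ_ A).hom := by
  simp only [unitorIso, Iso.trans_hom, whiskerRightIso_hom, Iso.symm_hom]
  rw [← BraidedCategory.braiding_naturality_right_assoc, braiding_leftUnitor]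

/-- The forgetful functor preserves the operations of the monoidal structure. -/
def inducingData : letI := monoidalStruct ht
    Monoidal.InducingFunctorData (forget T) :=
  letI := monoidalStruct ht
  { μIso := fun X Y => Iso.refl (X.carrier ⊗ Y.carrier)
    whiskerLeft_eq := fun X _ _ f =>
      ((Category.id_comp _).trans (Category.comp_id (X.carrier ◁ f.1))).symm
    whiskerRight_eq := fun f Y =>
      ((Category.id_comp _).trans (Category.comp_id (f.1 ▷ Y.carrier))).symm
    tensorHom_eq := fun f g =>
      ((Category.id_comp _).trans (Category.comp_id (f.1 ⊗ₘ g.1))).symm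
    εIso := t.unitIso
    associator_eq := fun X Y Z => by
      have h : (α_ X.carrier Y.carrier Z.carrier).hom =
        (𝟙 _ ≫ (𝟙 _ ⊗ₘ 𝟙 _)) ≫ (α_ X.carrier Y.carrier Z.carrier).hom ≫ (𝟙 _ ⊗ₘ 𝟙 _) ≫ 𝟙 _ := by
        simp only [Category.id_comp, Category.comp_id, id_tensorHom_id]
      exact h
    leftUnitor_eq := fun X => by
      have h : (unitorIso t X.carrier).hom =
        (𝟙 _ ≫ (t.unitIso.inv ⊗ₘ 𝟙 _)) ≫ (λ_ X.carrier).hom := by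
        rw [Category.id_comp, tensorHom_id]
        rfl
      exact h
    rightUnitor_eq := fun X => by
      have h : (β_ X.carrier (T.obj one)).hom ≫ (unitorIso t X.carrier).hom =
        (𝟙 _ ≫ (𝟙 _ ⊗ₘ t.unitIso.inv)) ≫ (ρ_ X.carrier).hom := by
        rw [Category.id_comp, id_tensorHom, braiding_unitorIso]
      exact h }

/-- The monoidal structure on `C(T)`. -/
@[reducible]
def monoidal : MonoidalCategory (NoriCat T) :=
  letI := monoidalStruct ht
  Monoidal.induced (forget T) (inducingData ht)

/-- The monoidal structure of the forgetful functor. -/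
@[reducible]
def forgetMonoidal : letI := monoidal ht
    (forget T).Monoidal :=
  letI := monoidalStruct ht
  Monoidal.fromInducedMonoidal (forget T) (inducingData ht)

/-- The braiding on `C(T)`. -/
@[reducible]
def braided : letI := monoidal ht
    BraidedCategory (NoriCat T) :=
  letI := monoidal ht
  letI := forgetMonoidal ht
  BraidedCategory.ofFaithful (forget T)
    (fun X Y => isoMk (X := tensor ht X Y) (Y := tensor ht Y X) (β_ X.carrier Y.carrier)
      (mem_homs_of_liftsHom (liftsBraiding ht X Y)))
    fun X Y => (Category.id_comp _).trans (Category.comp_id (β_ X.carrier Y.carrier).hom).symm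

/-- The forgetful functor is braided. -/
@[reducible]
def forgetBraided : letI := monoidal ht
    letI := braided ht
    (forget T).Braided :=
  letI := monoidal ht
  letI := braided ht
  { forgetMonoidal ht with
    braided := fun X Y =>
      (Category.id_comp _).trans (Category.comp_id (β_ X.carrier Y.carrier).hom).symm }

/-- The symmetry of `C(T)`. -/
@[reducible]
def symmetric : letI := monoidal ht
    SymmetricCategory (NoriCat T) :=
  letI := monoidal ht
  letI := braided ht
  letI := forgetBraided ht
  SymmetricCategory.ofFaithful (forget T)

/-- The product data of `T̃`. -/
def repData : letI := monoidal ht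
    ProductData (rep T) :=
  letI := monoidal ht
  { τ := fun x y => repTau ht x y
    unitIso := Iso.refl _ }

/-- The equational axioms are equalities of underlying linear maps, where they are those of `t`;
invertibility at the unit edges is reflected by the forgetful functor. -/
lemma repData_isUGM : letI := monoidal ht
    letI := symmetric ht
    (repData ht).IsUGM :=
  letI := monoidal ht
  letI := symmetric ht
  { comm := fun x y => Subtype.ext (ht.isUGM.comm x y)
    edgeProd := fun γ y => Subtype.ext (ht.isUGM.edgeProd γ y)
    prodEdge := fun x _ _ γ => Subtype.ext (ht.isUGM.prodEdge x γ)
    assoc := fun x y z => Subtype.ext (ht.isUGM.assoc x y z)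
    assoc' := fun x y z => Subtype.ext (ht.isUGM.assoc' x y z)
    unit := fun x =>
      have : IsIso ((forget T).map ((rep T).map (unitEdge x))) := ht.isUGM.unit x
      isIso_of_reflects_iso ((rep T).map (unitEdge x)) (forget T) }

lemma forget_repData : letI := monoidal ht
    letI := forgetMonoidal ht
    ProductData.IsTransformation ((repData ht).map (forget T)) t (fun x => 𝟙 (T.obj x)) :=
  letI := monoidal ht
  letI := forgetMonoidal ht
  { natural := fun γ => (Category.comp_id (T.map γ)).trans (Category.id_comp _).symm
    tensor := fun x y => by
      have h : 𝟙 (T.obj (vprod x y)) ≫ (t.τ x y).hom =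
          ((t.τ x y).hom ≫ 𝟙 _) ≫ (𝟙 (T.obj x) ⊗ₘ 𝟙 (T.obj y)) := by
        simp only [Category.id_comp, Category.comp_id, id_tensorHom_id]
      exact h
    unit := by
      have h : (t.unitIso.hom ≫ 𝟙 _) ≫ 𝟙 _ = t.unitIso.hom := by
        simp only [Category.comp_id]
      exact h }

end NoriCat

/-! ### Right exactness of the tensor product -/

section

variable {Λ : Type u} [CommRing Λ] [IsNoetherianRing Λ]

instance (A : FGModuleCat.{u} Λ) : PreservesFiniteColimits (tensorLeft A) := by
  let U := forget₂ (FGModuleCat.{u} Λ) (ModuleCat.{u} Λ)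
  have e : tensorLeft A ⋙ U ≅ U ⋙ tensorLeft (U.obj A) := Iso.refl _
  have : PreservesFiniteColimits (U ⋙ tensorLeft (U.obj A)) := comp_preservesFiniteColimits _ _
  have := preservesFiniteColimits_of_natIso e.symm
  exact preservesFiniteColimits_of_reflects_of_preserves (tensorLeft A) U

/-- A category with a faithful exact linear symmetric monoidal functor to modules has a right exact
tensor product. -/
lemma rightExactMonoidal_of_functor {C : Type u₁} [Category.{v₁} C] [Abelian C] [Linear Λ C]
    [MonoidalCategory C] [SymmetricCategory C] (U : C ⥤ FGModuleCat.{u} Λ) [U.Additive]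
    [U.Linear Λ] [U.Faithful] [PreservesFiniteColimits U] [U.ReflectsIsomorphisms] [U.Braided] :
    RightExactMonoidal Λ C :=
  have h1 := monoidalPreadditive_of_faithful U
  have h2 : ∀ X : C, PreservesFiniteColimits (tensorLeft X) := fun X => by
    have e : tensorLeft X ⋙ U ≅ U ⋙ tensorLeft (U.obj X) :=
      (Functor.Monoidal.commTensorLeft U X).symm
    have : PreservesFiniteColimits (U ⋙ tensorLeft (U.obj X)) := comp_preservesFiniteColimits _ _
    have := preservesFiniteColimits_of_natIso e.symm
    exact preservesFiniteColimits_of_reflects_of_preserves (tensorLeft X) U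
  { h1, MonoidalLinear.ofFaithful (R := Λ) U with
    tensorLeft := h2
    tensorRight := fun X =>
      have := h2 X
      preservesFiniteColimits_of_natIso (BraidedCategory.tensorLeftIsoTensorRight X) }

end

namespace NoriCat

variable {Λ : Type u} [CommRing Λ] [IsNoetherianRing Λ] {V : Type v} [UnitalProductDiagram.{w} V]
  {T : V ⥤q FGModuleCat.{u} Λ} {t : ProductData T}

/-- Nori's category carries the required monoidal structure. -/
theorem exists_isNoriMonoidal (ht : t.Admissible) :
    ∃ (_ : MonoidalCategory (NoriCat T)) (_ : SymmetricCategory (NoriCat T))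
      (_ : (forget T).Braided) (t' : ProductData (rep T)), IsNoriMonoidal t t' :=
  letI := monoidal ht
  letI := symmetric ht
  letI := forgetBraided ht
  ⟨monoidal ht, symmetric ht, forgetBraided ht, repData ht,
    { rightExact := rightExactMonoidal_of_functor (forget T)
      isUGM := repData_isUGM ht
      forget_rep := forget_repData ht }⟩

end NoriCat

end

/-! ### Counterparts of the regular modules -/

section

open FGModuleCat
open CategoryTheory.Functor (linMap_comp_apply linMap_comp linMap_add linMap_zero linMap_smul sum_biproduct)

attribute [local instance] Abelian.hasFiniteBiproducts

/-! ### Common kernels of morphisms vanishing on a submodule -/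

section DoubleAnnihilator

variable {Λ : Type u} [CommRing Λ] [IsNoetherianRing Λ] {C : Type u₁} [Category.{v₁} C] [Abelian C]
  [Linear Λ C] (U : C ⥤ FGModuleCat.{u} Λ) [U.Additive] [U.Linear Λ]

/-- The morphisms `A ⟶ B` that vanish on `W`, as a module of linear maps. -/
def annihilatingMaps {A : C} (W : Submodule Λ (U.obj A)) (B : C) :
    Submodule Λ (U.obj A →ₗ[Λ] U.obj B) where
  carrier := {f | U.Lifts f ∧ ∀ x ∈ W, f x = 0}
  zero_mem' := ⟨⟨0, linMap_zero A B⟩, fun _ _ => rfl⟩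
  add_mem' := by
    rintro _ _ ⟨⟨f, rfl⟩, hf⟩ ⟨⟨g, rfl⟩, hg⟩
    refine ⟨⟨f + g, linMap_add f g⟩, fun x hx => ?_⟩
    rw [LinearMap.add_apply, hf x hx, hg x hx, add_zero]
  smul_mem' := by
    rintro c _ ⟨⟨f, rfl⟩, hf⟩
    refine ⟨⟨c • f, linMap_smul c f⟩, fun x hx => ?_⟩
    rw [LinearMap.smul_apply, hf x hx, smul_zero]

variable [U.Faithful] [PreservesFiniteLimits U] [PreservesFiniteColimits U]

/-- The common kernel of all morphisms `A ⟶ B` vanishing on `W` is a subobject. -/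
lemma exists_commonKernel {A : C} (W : Submodule Λ (U.obj A)) (B : C) :
    ∃ (P : C) (i : P ⟶ A), Function.Injective (U.linMap i) ∧ ∀ x, x ∈ LinearMap.range (U.linMap i) ↔
      ∀ h : A ⟶ B, (∀ y ∈ W, U.linMap h y = 0) → U.linMap h x = 0 := by
  -- The annihilating morphisms form a submodule of a noetherian module of linear maps. Finitely
  -- many of them generate it, and their common kernel is the kernel of one morphism to a finite
  -- power of `B`.
  obtain ⟨n, f, hf⟩ := Submodule.fg_iff_exists_fin_generating_family.1
    (IsNoetherian.noetherian (annihilatingMaps U W B))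
  have hf' : ∀ k, (∃ g : A ⟶ B, U.linMap g = f k) ∧ ∀ x ∈ W, f k x = 0 := fun k =>
    show f k ∈ annihilatingMaps U W B from hf ▸ Submodule.subset_span ⟨k, rfl⟩
  choose g hg using fun k => (hf' k).1
  have key (x : U.obj A) : U.linMap (biproduct.lift g) x = 0 ↔
      ∀ h : A ⟶ B, (∀ y ∈ W, U.linMap h y = 0) → U.linMap h x = 0 := by
    constructor
    · intro hx h hh
      have h1 : ∀ φ ∈ Submodule.span Λ (Set.range f), φ x = 0 := by
        intro φ hφ
        induction hφ using Submodule.span_induction with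
        | mem φ hφ =>
          obtain ⟨k, rfl⟩ := hφ
          rw [← hg, ← biproduct.lift_π g k, linMap_comp_apply, hx, map_zero]
        | zero => rfl
        | add φ φ' _ _ h1 h2 => rw [LinearMap.add_apply, h1, h2, add_zero]
        | smul c φ _ h1 => rw [LinearMap.smul_apply, h1, smul_zero]
      exact h1 _ (hf ▸ (⟨⟨h, rfl⟩, hh⟩ : U.linMap h ∈ annihilatingMaps U W B))
    · intro hx
      refine Functor.biproduct_ext _ fun k => ?_
      rw [← linMap_comp_apply, biproduct.lift_π, map_zero]
      exact hx (g k) fun y hy => by rw [hg, (hf' k).2 y hy]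
  refine ⟨kernel (biproduct.lift g), kernel.ι _,
    (Functor.mono_iff_injective _).1 inferInstance, fun x => ?_⟩
  rw [← key]
  constructor
  · rintro ⟨y, rfl⟩
    rw [← linMap_comp_apply, kernel.condition, linMap_zero]
    rfl
  · intro hx
    exact Functor.exact_linMap (ShortComplex.exact_kernel (biproduct.lift g)) x hx

end DoubleAnnihilator

/-- A factorization of the representation `T` through `U`, up to isomorphism. -/
structure Factorization {Λ : Type u} [CommRing Λ] {V : Type v} [Quiver.{w} V]
    (T : V ⥤q FGModuleCat.{u} Λ) {C : Type u₁} [Category.{v₁} C] (U : C ⥤ FGModuleCat.{u} Λ)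
    (S : V ⥤q C) where
  /-- the identification -/
  equiv : ∀ x : V, U.obj (S.obj x) ≃ₗ[Λ] T.obj x
  natural : ∀ {x y : V} (γ : x ⟶ y) (m : U.obj (S.obj x)),
    equiv y (U.linMap (S.map γ) m) = lin (T.map γ) (equiv x m)

namespace Factorization

variable {Λ : Type u} [CommRing Λ] {V : Type v} [Quiver.{w} V] {T : V ⥤q FGModuleCat.{u} Λ}

lemma exists_generators (T : V ⥤q FGModuleCat.{u} Λ) (G : Finset V) :
    ∃ (n : ℕ) (x : Fin n → V) (_ : ∀ i, x i ∈ G) (m : ∀ i, T.obj (x i)), ∀ y ∈ G,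
      (∃ i, x i = y) ∧
      Submodule.span Λ {z : T.obj y | ∃ i, (⟨x i, m i⟩ : Σ x, T.obj x) = ⟨y, z⟩} = ⊤ := by
  choose n m hm using fun x : G => Module.Finite.exists_fin (R := Λ) (M := T.obj x.1)
  -- One extra element, zero, is added at each vertex so that every `y ∈ G` occurs in the list even
  -- if its generating set is empty.
  let ε := Fintype.equivFin (Σ x : G, Fin (n x + 1))
  let a (s : Σ x : G, Fin (n x + 1)) : T.obj s.1.1 :=
    Fin.cons (α := fun _ => T.obj s.1.1) 0 (m s.1) s.2
  refine ⟨_, fun i => (ε.symm i).1.1, fun i => (ε.symm i).1.2, fun i => a (ε.symm i),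
    fun y hy => ⟨⟨ε ⟨⟨y, hy⟩, 0⟩, congrArg (fun s => s.1.1) (ε.symm_apply_apply _)⟩, ?_⟩⟩
  rw [eq_top_iff, ← hm ⟨y, hy⟩, Submodule.span_le]
  rintro _ ⟨k, rfl⟩
  exact Submodule.subset_span ⟨ε ⟨⟨y, hy⟩, k.succ⟩, congrArg
    (fun s => (⟨s.1.1, a s⟩ : Σ x, T.obj x)) (ε.symm_apply_apply ⟨⟨y, hy⟩, k.succ⟩)⟩

section

variable {C : Type u₁} [Category.{v₁} C] {U : C ⥤ FGModuleCat.{u} Λ} {S : V ⥤q C}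
  (D : Factorization T U S)

/-- The linear map `e ↦ e_x y` from `End(T|_G)`, with values in `U (S x)`. -/
def evalMap {G : Finset V} {x : V} (hx : x ∈ G) (y : T.obj x) :
    endAlg T G →ₗ[Λ] U.obj (S.obj x) where
  toFun e := (D.equiv x).symm (e.1 ⟨x, hx⟩ y)
  map_add' _ _ := map_add (D.equiv x).symm _ _
  map_smul' r _ := map_smul (D.equiv x).symm r _

lemma evalMap_apply {G : Finset V} {x : V} (hx : x ∈ G) (y : T.obj x) (e : endAlg T G) :
    D.evalMap hx y e = (D.equiv x).symm (e.1 ⟨x, hx⟩ y) := rfl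

end

variable {C : Type u₁} [Category.{v₁} C] [Abelian C] {U : C ⥤ FGModuleCat.{u} Λ} [U.Additive]
  {S : V ⥤q C} (D : Factorization T U S)

/-- The embedding of `End(T|_G)` given by the values on finitely many elements. -/
def embed {G : Finset V} {n : ℕ} {x : Fin n → V} (hx : ∀ i, x i ∈ G) (m : ∀ i, T.obj (x i)) :
    endAlg T G →ₗ[Λ] U.obj (⨁ fun i => S.obj (x i)) :=
  ∑ i, U.linMap (biproduct.ι (fun i => S.obj (x i)) i) ∘ₗ D.evalMap (hx i) (m i)

lemma π_embed {G : Finset V} {n : ℕ} {x : Fin n → V} (hx : ∀ i, x i ∈ G) (m : ∀ i, T.obj (x i))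
    (e : endAlg T G) (k : Fin n) :
    U.linMap (biproduct.π (fun i => S.obj (x i)) k) (D.embed hx m e) = D.evalMap (hx k) (m k) e := by
  rw [embed, LinearMap.sum_apply, _root_.map_sum, Finset.sum_eq_single k]
  · rw [LinearMap.comp_apply, ← linMap_comp_apply, biproduct.ι_π_self, Functor.linMap_id]
    rfl
  · intro i _ hi
    rw [LinearMap.comp_apply, ← linMap_comp_apply, biproduct.ι_π_ne _ hi, linMap_zero]
    rfl
  · intro h
    exact (h (Finset.mem_univ k)).elim

variable [Linear Λ C] [U.Linear Λ]

/-- Evaluation at a listed generator is a projection of the biproduct; evaluation at any `z` is a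
`Λ`-linear combination of these, and `C` is `Λ`-linear. -/
lemma exists_eval {G : Finset V} {n : ℕ} {x : Fin n → V} (hx : ∀ i, x i ∈ G)
    (m : ∀ i, T.obj (x i)) {y : V} (hy : y ∈ G)
    (h : Submodule.span Λ {z : T.obj y | ∃ i, (⟨x i, m i⟩ : Σ x, T.obj x) = ⟨y, z⟩} = ⊤)
    (z : T.obj y) : ∃ p : (⨁ fun i => S.obj (x i)) ⟶ S.obj y,
      ∀ e, U.linMap p (D.embed hx m e) = D.evalMap hy z e := by
  have hz : z ∈ Submodule.span Λ {z : T.obj y | ∃ i, (⟨x i, m i⟩ : Σ x, T.obj x) = ⟨y, z⟩} :=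
    h ▸ Submodule.mem_top
  induction hz using Submodule.span_induction with
  | mem z hz =>
    obtain ⟨i, hi⟩ := hz
    cases hi
    exact ⟨biproduct.π _ i, fun e => D.π_embed hx m e i⟩
  | zero =>
    refine ⟨0, fun e => ?_⟩
    rw [linMap_zero, evalMap_apply, map_zero, map_zero]
    rfl
  | add z z' _ _ h1 h2 =>
    obtain ⟨p, hp⟩ := h1
    obtain ⟨q, hq⟩ := h2
    refine ⟨p + q, fun e => ?_⟩
    rw [linMap_add, LinearMap.add_apply, hp, hq, evalMap_apply, evalMap_apply, evalMap_apply,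
      map_add, map_add]
  | smul c z _ h1 =>
    obtain ⟨p, hp⟩ := h1
    refine ⟨c • p, fun e => ?_⟩
    rw [linMap_smul, LinearMap.smul_apply, hp, evalMap_apply, evalMap_apply, map_smul, map_smul]

variable [U.Faithful] [PreservesFiniteLimits U] [PreservesFiniteColimits U] [IsNoetherianRing Λ]

/-- There is an object of `C` that corresponds to the regular module over `End(T|_G)`. -/
theorem exists_regObj (G : Finset V) : ∃ (P : C) (ψ : endAlg T G ≃ₗ[Λ] U.obj P),
    (∀ (x : V) (hx : x ∈ G) (y : T.obj x), U.Lifts (A := P) (B := S.obj x)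
      (D.evalMap hx y ∘ₗ ψ.symm.toLinearMap)) ∧
    ∀ (Z : C) (ζ : U.obj Z →ₗ[Λ] endAlg T G),
      (∀ (x : V) (hx : x ∈ G) (y : T.obj x), U.Lifts (A := Z) (B := S.obj x)
        (D.evalMap hx y ∘ₗ ζ)) → U.Lifts (A := Z) (B := P) (ψ.toLinearMap ∘ₗ ζ) := by
  obtain ⟨n, x, hx, m, hm⟩ := exists_generators T G
  let A : C := ⨁ fun i => S.obj (x i)
  let κ : endAlg T G →ₗ[Λ] U.obj A := D.embed hx m
  -- Endomorphisms of `A` are enough test maps, since every `S y` with `y ∈ G` is one of the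
  -- summands of `A`.
  obtain ⟨P, i, hi, hP⟩ := exists_commonKernel U (LinearMap.range κ) A
  choose p hp using fun (y : V) (hy : y ∈ G) => D.exists_eval hx m hy (hm y hy).2
  -- Two morphisms `A ⟶ S y` that agree on the image of `κ` agree on `P`: their difference, followed
  -- by an inclusion of `S y` into `A`, is an annihilating endomorphism.
  have hP' : ∀ z ∈ LinearMap.range (U.linMap i), ∀ y ∈ G, ∀ h h' : A ⟶ S.obj y,
      (∀ e, U.linMap h (κ e) = U.linMap h' (κ e)) → U.linMap h z = U.linMap h' z := by
    intro z hz y hy h h' hh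
    obtain ⟨k, rfl⟩ := (hm y hy).1
    have h1 := (hP z).1 hz ((h - h') ≫ biproduct.ι (fun i => S.obj (x i)) k) (by
      rintro _ ⟨e, rfl⟩
      rw [linMap_comp_apply, Functor.linMap_sub, LinearMap.sub_apply, hh, sub_self, map_zero])
    have h2 := congrArg (U.linMap (biproduct.π (fun i => S.obj (x i)) k)) h1
    rwa [← linMap_comp_apply, Category.assoc, biproduct.ι_π_self, Category.comp_id, map_zero,
      Functor.linMap_sub, LinearMap.sub_apply, sub_eq_zero] at h2
  have hκ : Function.Injective κ := by
    rw [injective_iff_map_eq_zero]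
    intro e he
    refine Subtype.ext (funext fun y => LinearMap.ext fun z => ?_)
    have h1 := hp y.1 y.2 z e
    change U.linMap (p y.1 y.2 z) (κ e) = _ at h1
    rw [he, map_zero, evalMap_apply] at h1
    exact (D.equiv y.1).symm.map_eq_zero_iff.1 h1.symm
  have hr : LinearMap.range κ = LinearMap.range (U.linMap i) := by
    apply le_antisymm
    · rintro _ ⟨e, rfl⟩
      exact (hP _).2 fun h hh => hh _ ⟨e, rfl⟩
    · intro z hz
      -- An element `z` of `P` defines endomorphisms by inserting it in the evaluation morphisms:
      -- `a` goes to `p a` at `z`. Linearity in `a` and compatibility with edges are identities of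
      -- morphisms on the image of `κ`, hence hold at `z` by `hP'`.
      let f (y : G) : Module.End Λ (T.obj y.1) :=
        { toFun := fun a => D.equiv y.1 (U.linMap (p y.1 y.2 a) z)
          map_add' := fun a b => by
            rw [← map_add, ← LinearMap.add_apply, ← linMap_add]
            refine congrArg _ (hP' z hz y.1 y.2 _ _ fun e => ?_)
            rw [linMap_add, LinearMap.add_apply]
            refine (hp y.1 y.2 (a + b) e).trans ?_
            refine Eq.trans ?_ (congrArg₂ _ (hp y.1 y.2 a e) (hp y.1 y.2 b e)).symm
            rw [evalMap_apply, evalMap_apply, evalMap_apply, map_add, map_add]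
          map_smul' := fun c a => by
            rw [RingHom.id_apply, ← map_smul, ← LinearMap.smul_apply, ← linMap_smul]
            refine congrArg _ (hP' z hz y.1 y.2 _ _ fun e => ?_)
            rw [linMap_smul, LinearMap.smul_apply]
            refine (hp y.1 y.2 (c • a) e).trans ?_
            refine Eq.trans ?_ (congrArg (c • ·) (hp y.1 y.2 a e)).symm
            rw [evalMap_apply, evalMap_apply, map_smul, map_smul] }
      have hf : f ∈ endAlg T G := fun y y' γ => LinearMap.ext fun a => by
        change lin (T.map γ) (D.equiv y.1 (U.linMap (p y.1 y.2 a) z)) =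
          D.equiv y'.1 (U.linMap (p y'.1 y'.2 (lin (T.map γ) a)) z)
        rw [← D.natural, ← linMap_comp_apply]
        refine congrArg _ (hP' z hz y'.1 y'.2 _ _ fun e => ?_)
        rw [linMap_comp_apply]
        refine (congrArg _ (hp y.1 y.2 a e)).trans (Eq.trans ?_ (hp y'.1 y'.2 _ e).symm)
        apply (D.equiv y'.1).injective
        rw [D.natural, evalMap_apply, evalMap_apply, LinearEquiv.apply_symm_apply,
          LinearEquiv.apply_symm_apply]
        exact NoriCat.edge_comm T e γ a
      -- To see that `κ` sends this family to `z`, compare components: the `k`-th projection and the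
      -- evaluation morphism at `m k` agree on the image of `κ`, hence at `z`.
      refine ⟨⟨f, hf⟩, Functor.biproduct_ext _ fun k => ?_⟩
      refine (D.π_embed hx m ⟨f, hf⟩ k).trans ?_
      rw [evalMap_apply, LinearEquiv.symm_apply_eq]
      refine congrArg _ (hP' z hz (x k) (hx k) _ _ fun e => ?_)
      exact (hp (x k) (hx k) (m k) e).trans (D.π_embed hx m e k).symm
  let ψ : endAlg T G ≃ₗ[Λ] U.obj P :=
    LinearEquiv.ofInjective κ hκ ≪≫ₗ LinearEquiv.ofEq _ _ hr ≪≫ₗ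
      (LinearEquiv.ofInjective (U.linMap i) hi).symm
  have hψ : ∀ e, U.linMap i (ψ e) = κ e := fun e =>
    congrArg Subtype.val ((LinearEquiv.ofInjective (U.linMap i) hi).apply_symm_apply _)
  refine ⟨P, ψ, fun y hy a => ⟨i ≫ p y hy a, LinearMap.ext fun u => ?_⟩, fun Z ζ h => ?_⟩
  · obtain ⟨e, rfl⟩ := ψ.surjective u
    rw [linMap_comp_apply, hψ, LinearMap.comp_apply, LinearEquiv.coe_coe,
      LinearEquiv.symm_apply_apply]
    exact hp y hy a e
  -- A map into `P` may be lifted after the inclusion in `A`, where the components are evaluations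
  -- and lift by assumption.
  · refine Functor.lifts_of_comp_mono _ i hi ?_
    choose g hg using fun k => h (x k) (hx k) (m k)
    refine ⟨biproduct.lift g, LinearMap.ext fun z => Functor.biproduct_ext _ fun k => ?_⟩
    rw [← linMap_comp_apply, biproduct.lift_π, hg]
    refine Eq.trans ?_ (congrArg _ (hψ (ζ z)).symm)
    exact (D.π_embed hx m (ζ z) k).symm

end Factorization

end

/-! ### Counterparts of the objects of `C(T)` -/

section

open FGModuleCat
open CategoryTheory.Functor (linMap_comp_apply linMap_comp linMap_add linMap_zero linMap_smul sum_biproduct)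

attribute [local instance] Abelian.hasFiniteBiproducts

namespace Factorization

variable {Λ : Type u} [CommRing Λ] {V : Type v} [Quiver.{w} V] {T : V ⥤q FGModuleCat.{u} Λ}
  {C : Type u₁} [Category.{v₁} C] [Abelian C] [Linear Λ C] {U : C ⥤ FGModuleCat.{u} Λ} [U.Additive]
  [U.Linear Λ] [U.Faithful] [PreservesFiniteLimits U] [PreservesFiniteColimits U]
  [IsNoetherianRing Λ] {S : V ⥤q C} (D : Factorization T U S)

/-- The object of `C` that corresponds to the regular module over `End(T|_G)`. -/
def regObj (G : Finset V) : C := (D.exists_regObj G).choose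

/-- The identification of the regular module with its counterpart in `C`. -/
def regObjEquiv (G : Finset V) : endAlg T G ≃ₗ[Λ] U.obj (D.regObj G) :=
  (D.exists_regObj G).choose_spec.choose

lemma lifts_eval {G : Finset V} {x : V} (hx : x ∈ G) (y : T.obj x) :
    U.Lifts (A := D.regObj G) (B := S.obj x)
      (D.evalMap hx y ∘ₗ (D.regObjEquiv G).symm.toLinearMap) :=
  (D.exists_regObj G).choose_spec.choose_spec.1 x hx y

lemma lifts_to_regObj {G : Finset V} {Z : C} (ζ : U.obj Z →ₗ[Λ] endAlg T G)
    (h : ∀ (x : V) (hx : x ∈ G) (y : T.obj x), U.Lifts (A := Z) (B := S.obj x)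
      (D.evalMap hx y ∘ₗ ζ)) :
    U.Lifts (A := Z) (B := D.regObj G) ((D.regObjEquiv G).toLinearMap ∘ₗ ζ) :=
  (D.exists_regObj G).choose_spec.choose_spec.2 Z ζ h

/-- Right multiplication by `r` followed by evaluation at `y` is evaluation at `r y`, so the mapping
property of `regObj` applies. Right multiplications supply the left-linear maps needed in
presentations. -/
lemma lifts_mulRight {G : Finset V} (r : endAlg T G) :
    U.Lifts (A := D.regObj G) (B := D.regObj G) ((D.regObjEquiv G).toLinearMap ∘ₗ
      LinearMap.mulRight Λ r ∘ₗ (D.regObjEquiv G).symm.toLinearMap) :=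
  D.lifts_to_regObj _ fun x hx y => D.lifts_eval hx (r.1 ⟨x, hx⟩ y)

lemma lifts_res {G G' : Finset V} (h : G ⊆ G') :
    U.Lifts (A := D.regObj G') (B := D.regObj G) ((D.regObjEquiv G).toLinearMap ∘ₗ
      (endAlgRes T h).toLinearMap ∘ₗ (D.regObjEquiv G').symm.toLinearMap) :=
  D.lifts_to_regObj _ fun x hx y => D.lifts_eval (h hx) y

/-- The linear map `e ↦ φ (e x)` from the counterpart of the regular module. -/
def orbitMap {X : NoriCat T} {Y : C} (φ : X.carrier ≃ₗ[Λ] U.obj Y) {G : Finset V}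
    (h : X.supp ⊆ G) (x : X.carrier) : U.obj (D.regObj G) →ₗ[Λ] U.obj Y :=
  φ.toLinearMap ∘ₗ (X.act h).toLinearMap.flip x ∘ₗ (D.regObjEquiv G).symm.toLinearMap

lemma orbitMap_apply {X : NoriCat T} {Y : C} (φ : X.carrier ≃ₗ[Λ] U.obj Y) {G : Finset V}
    (h : X.supp ⊆ G) (x : X.carrier) (e : endAlg T G) :
    D.orbitMap φ h x (D.regObjEquiv G e) = φ (X.act h e x) := by
  change φ (X.act h ((D.regObjEquiv G).symm (D.regObjEquiv G e)) x) = _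
  rw [LinearEquiv.symm_apply_apply]

/-- The object `Y` of `C` is a counterpart of the object `X` of `C(T)`. -/
def Corresponds (X : NoriCat T) (Y : C) (φ : X.carrier ≃ₗ[Λ] U.obj Y) : Prop :=
  ∃ (G : Finset V) (h : X.supp ⊆ G), ∀ x, U.Lifts (A := D.regObj G) (B := Y) (D.orbitMap φ h x)

variable {D}

lemma lifts_orbitMap_mono {X : NoriCat T} {Y : C} {φ : X.carrier ≃ₗ[Λ] U.obj Y} {G G' : Finset V}
    {h : X.supp ⊆ G} {x : X.carrier} (hx : U.Lifts (A := D.regObj G) (B := Y) (D.orbitMap φ h x))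
    (h' : G ⊆ G') :
    U.Lifts (A := D.regObj G') (B := Y) (D.orbitMap φ (h.trans h') x) := by
  have := hx.comp (D.lifts_res h')
  convert this using 1
  refine LinearMap.ext fun u => ?_
  obtain ⟨e, rfl⟩ := (D.regObjEquiv G').surjective u
  rw [orbitMap_apply, LinearMap.comp_apply, LinearMap.comp_apply, LinearMap.comp_apply,
    LinearEquiv.coe_coe, LinearEquiv.coe_coe, LinearEquiv.symm_apply_apply, orbitMap_apply]
  rfl

/-- Morphisms of `C(T)` lift to morphisms between counterparts. -/
lemma Corresponds.lifts {X X' : NoriCat T} {Y Y' : C} {φ : X.carrier ≃ₗ[Λ] U.obj Y}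
    {φ' : X'.carrier ≃ₗ[Λ] U.obj Y'} (hφ : D.Corresponds X Y φ) (hφ' : D.Corresponds X' Y' φ')
    (f : X ⟶ X') : U.Lifts (A := Y) (B := Y')
      (φ'.toLinearMap ∘ₗ NoriCat.lin f ∘ₗ φ.symm.toLinearMap) := by
  classical
  obtain ⟨G₁, h₁, H₁⟩ := hφ
  obtain ⟨G₂, h₂, H₂⟩ := hφ'
  obtain ⟨G₃, h₃, h₃', H₃⟩ := NoriCat.exists_linear f
  let G := G₁ ∪ (G₂ ∪ G₃)
  have i₁ : G₁ ⊆ G := Finset.subset_union_left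
  have i₂ : G₂ ⊆ G := Finset.subset_union_left.trans Finset.subset_union_right
  have i₃ : G₃ ⊆ G := Finset.subset_union_right.trans Finset.subset_union_right
  have H₃' : ∀ (e : endAlg T G) x, NoriCat.lin f (X.act (h₁.trans i₁) e x) =
      X'.act (h₂.trans i₂) e (NoriCat.lin f x) := fun e => H₃ (endAlgRes T i₃ e)
  obtain ⟨n, m, hm⟩ := Module.Finite.exists_fin (R := Λ) (M := X.carrier)
  choose g hg using fun i => lifts_orbitMap_mono (H₁ (m i)) i₁
  -- The orbit maps of finitely many generators of `X` jointly cover `Y`; over a common vertex set,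
  -- `f` turns the orbit map of `m i` into that of `f (m i)`, which lifts.
  refine Functor.lifts_of_jointly_surjective (U := U) _ g (fun y => ?_) fun i => ?_
  · obtain ⟨x, rfl⟩ := φ.surjective y
    obtain ⟨c, rfl⟩ := (Submodule.mem_span_range_iff_exists_fun Λ).1
      (hm ▸ Submodule.mem_top (x := x))
    refine ⟨fun i => D.regObjEquiv G (algebraMap Λ _ (c i)), ?_⟩
    rw [_root_.map_sum]
    refine Finset.sum_congr rfl fun i _ => ?_
    rw [hg, orbitMap_apply, AlgHom.commutes]
    rfl
  · convert lifts_orbitMap_mono (H₂ (NoriCat.lin f (m i))) i₂ using 1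
    refine LinearMap.ext fun u => ?_
    obtain ⟨e, rfl⟩ := (D.regObjEquiv G).surjective u
    rw [orbitMap_apply, LinearMap.comp_apply, hg, orbitMap_apply, ← H₃']
    simp

variable (D) in
lemma corresponds_rep (x : V) :
    D.Corresponds ((NoriCat.rep T).obj x) (S.obj x) (D.equiv x).symm :=
  ⟨{x}, subset_rfl, fun y => D.lifts_eval (Finset.mem_singleton_self x) y⟩

variable (D) in
/-- Every object of `C(T)` has a counterpart in `C`. -/
theorem exists_corresponds (X : NoriCat T) :
    ∃ (Y : C) (φ : X.carrier ≃ₗ[Λ] U.obj Y), D.Corresponds X Y φ := by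
  let G := X.supp
  let P := D.regObj G
  let ψ := D.regObjEquiv G
  obtain ⟨n, m, hm⟩ := Module.Finite.exists_fin (R := Λ) (M := X.carrier)
  let M : C := ⨁ fun _ : Fin n => P
  let π (i : Fin n) : M ⟶ P := biproduct.π (fun _ : Fin n => P) i
  let ι (i : Fin n) : P ⟶ M := biproduct.ι (fun _ : Fin n => P) i
  let p : U.obj M →ₗ[Λ] X.carrier :=
    ∑ i, (X.act subset_rfl).toLinearMap.flip (m i) ∘ₗ ψ.symm.toLinearMap ∘ₗ U.linMap (π i)
  have hp : ∀ z, p z = ∑ i, X.act subset_rfl (ψ.symm (U.linMap (π i) z)) (m i) := fun z => by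
    simp [p]
  have hpι : ∀ i e, p (U.linMap (ι i) (ψ e)) = X.act subset_rfl e (m i) := fun i e => by
    rw [hp, Finset.sum_eq_single i]
    · rw [← linMap_comp_apply, biproduct.ι_π_self, Functor.linMap_id, LinearMap.id_apply,
        LinearEquiv.symm_apply_apply]
    · intro j _ hj
      rw [← linMap_comp_apply, biproduct.ι_π_ne _ hj.symm, linMap_zero, LinearMap.zero_apply,
        map_zero, map_zero, LinearMap.zero_apply]
    · intro h
      exact (h (Finset.mem_univ i)).elim
  have hps : Function.Surjective p := fun x => by
    obtain ⟨c, rfl⟩ := (Submodule.mem_span_range_iff_exists_fun Λ).1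
      (hm ▸ Submodule.mem_top (x := x))
    refine ⟨∑ i, U.linMap (ι i) (ψ (algebraMap Λ _ (c i))), ?_⟩
    rw [_root_.map_sum]
    refine Finset.sum_congr rfl fun i _ => ?_
    rw [hpι, AlgHom.commutes]
    rfl
  choose ρ hρ using fun r => D.lifts_mulRight (G := G) r
  have hρ' : ∀ r e, U.linMap (ρ r) (ψ e) = ψ (e * r) := fun r e => by
    rw [hρ]
    simp [ψ]
  obtain ⟨k, z, hz⟩ := Submodule.fg_iff_exists_fin_generating_family.1
    (IsNoetherian.noetherian (LinearMap.ker p))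
  -- The left-linear map `P → Pⁿ` that sends `1` to the relation `z j`, assembled from right
  -- multiplications by the coordinates of `z j`.
  let h (j : Fin k) : P ⟶ M := ∑ i, ρ (ψ.symm (U.linMap (π i) (z j))) ≫ ι i
  have hh : ∀ j e, U.linMap (h j) (ψ e) =
      ∑ i, U.linMap (ι i) (ψ (e * ψ.symm (U.linMap (π i) (z j)))) := fun j e => by
    simp only [h, Functor.linMap_sum, LinearMap.sum_apply, linMap_comp_apply, hρ']
  have hz' : ∀ j, z j ∈ LinearMap.ker p := fun j => hz ▸ Submodule.subset_span ⟨j, rfl⟩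
  -- The image of `f` is exactly the kernel of `p`: it contains each `z j` as the image of `1`, and
  -- it kills nothing more than relations because `p` of `e * z j` is `e` applied to `p (z j) = 0`.
  -- Thus the cokernel of `f` has underlying module `X`.
  let f : (⨁ fun _ : Fin k => P) ⟶ M := biproduct.desc h
  have hf1 : LinearMap.range (U.linMap f) ≤ LinearMap.ker p := by
    rintro _ ⟨y, rfl⟩
    rw [LinearMap.mem_ker, ← sum_biproduct _ y, _root_.map_sum, _root_.map_sum]
    refine Finset.sum_eq_zero fun j _ => ?_
    rw [← linMap_comp_apply, biproduct.ι_desc]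
    obtain ⟨e, he⟩ := ψ.surjective (U.linMap (biproduct.π (fun _ : Fin k => P) j) y)
    rw [← he, hh, _root_.map_sum]
    simp only [hpι, map_mul, Module.End.mul_apply]
    rw [← _root_.map_sum, ← hp, hz' j, map_zero]
  have hf2 : LinearMap.ker p ≤ LinearMap.range (U.linMap f) := by
    rw [← hz, Submodule.span_le]
    rintro _ ⟨j, rfl⟩
    refine ⟨U.linMap (biproduct.ι (fun _ : Fin k => P) j) (ψ 1), ?_⟩
    rw [← linMap_comp_apply, biproduct.ι_desc, hh]
    simp only [one_mul, LinearEquiv.apply_symm_apply]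
    exact sum_biproduct _ (z j)
  let q := cokernel.π f
  have hq : Function.Surjective (U.linMap q) := (Functor.epi_iff_surjective q).1 inferInstance
  have hqk : LinearMap.ker p = LinearMap.ker (U.linMap q) := by
    rw [le_antisymm hf2 hf1]
    apply le_antisymm
    · rintro _ ⟨y, rfl⟩
      rw [LinearMap.mem_ker, ← linMap_comp_apply, cokernel.condition, linMap_zero]
      rfl
    · intro y hy
      exact Functor.exact_linMap (ShortComplex.exact_cokernel f) y hy
  let φ : X.carrier ≃ₗ[Λ] U.obj (cokernel f) :=
    (p.quotKerEquivOfSurjective hps).symm ≪≫ₗ Submodule.quotEquivOfEq _ _ hqk ≪≫ₗ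
      (U.linMap q).quotKerEquivOfSurjective hq
  have hφ : ∀ y, φ (p y) = U.linMap q y := fun y => by
    have : (p.quotKerEquivOfSurjective hps).symm (p y) = Submodule.Quotient.mk y := by
      rw [LinearEquiv.symm_apply_eq]
      rfl
    simp only [φ, LinearEquiv.trans_apply, this]
    rfl
  refine ⟨cokernel f, φ, G, subset_rfl, fun x => ?_⟩
  obtain ⟨c, rfl⟩ := (Submodule.mem_span_range_iff_exists_fun Λ).1
    (hm ▸ Submodule.mem_top (x := x))
  refine ⟨∑ i, c i • ι i ≫ q, LinearMap.ext fun u => ?_⟩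
  obtain ⟨e, rfl⟩ := ψ.surjective u
  refine Eq.trans ?_ (D.orbitMap_apply φ subset_rfl _ e).symm
  simp only [Functor.linMap_sum, LinearMap.sum_apply, linMap_smul, LinearMap.smul_apply,
    linMap_comp_apply, _root_.map_sum, map_smul, ← hφ, hpι]

end Factorization

end

/-! ### The functor given by a factorization -/

section

open FGModuleCat
open CategoryTheory.Functor (linMap_comp_apply)

namespace Factorization

variable {Λ : Type u} [CommRing Λ] {V : Type v} [Quiver.{w} V] {T : V ⥤q FGModuleCat.{u} Λ}
  {C : Type u₁} [Category.{v₁} C] [Abelian C] [Linear Λ C] {U : C ⥤ FGModuleCat.{u} Λ} [U.Additive]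
  [U.Linear Λ] [U.Faithful] [PreservesFiniteLimits U] [PreservesFiniteColimits U]
  [IsNoetherianRing Λ] {S : V ⥤q C} {D : Factorization T U S}

/-- The linear equivalences underlying an isomorphism `forget T ≅ F ⋙ U`. -/
def isoEquiv {F : NoriCat T ⥤ C} (β : NoriCat.forget T ≅ F ⋙ U) (X : NoriCat T) :
    X.carrier ≃ₗ[Λ] U.obj (F.obj X) :=
  isoToLinearEquiv (β.app X)

omit [Abelian C] [Linear Λ C] [U.Additive] [U.Linear Λ] [U.Faithful] [PreservesFiniteLimits U]
  [PreservesFiniteColimits U] [IsNoetherianRing Λ] in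
lemma isoEquiv_naturality {F : NoriCat T ⥤ C} (β : NoriCat.forget T ≅ F ⋙ U) {X Y : NoriCat T}
    (f : X ⟶ Y) (x : X.carrier) :
    U.linMap (F.map f) (isoEquiv β X x) = isoEquiv β Y (NoriCat.lin f x) :=
  (LinearMap.congr_fun (congrArg FGModuleCat.lin (β.hom.naturality f)) x).symm

/-- The values of a functor compatible with the factorization are counterparts. -/
lemma corresponds_of_lift {F : NoriCat T ⥤ C} (β : NoriCat.forget T ≅ F ⋙ U)
    (α : ∀ x, F.obj ((NoriCat.rep T).obj x) ⟶ S.obj x)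
    (h : ∀ (x : V) (m : T.obj x), U.linMap (α x) (isoEquiv β ((NoriCat.rep T).obj x) m) =
      (D.equiv x).symm m) (X : NoriCat T) :
    D.Corresponds X (F.obj X) (isoEquiv β X) := by
  let G := X.supp
  let ψ := D.regObjEquiv G
  let b := isoEquiv β (NoriCat.reg T G)
  let r := NoriCat.regEquiv T G
  -- The mapping property of `regObj` applies to `F` of the regular module: evaluation at `y ∈ T x`
  -- is `F` of the morphism to `T̃ x` given by `y`, followed by `α x`. Being bijective, the
  -- resulting map has a lifting inverse.
  have h1 : U.Lifts (A := F.obj (NoriCat.reg T G)) (B := D.regObj G)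
      (b.symm ≪≫ₗ r ≪≫ₗ ψ).toLinearMap := by
    refine D.lifts_to_regObj (b.symm ≪≫ₗ r).toLinearMap fun x hx y =>
      ⟨F.map (NoriCat.ofElem ((NoriCat.rep T).obj x) (NoriCat.rep_supp_subset hx) y) ≫ α x,
        LinearMap.ext fun z => ?_⟩
    obtain ⟨e, rfl⟩ := b.surjective z
    rw [linMap_comp_apply]
    refine (congrArg _ (isoEquiv_naturality β _ _)).trans ((h x _).trans ?_)
    simp only [LinearMap.comp_apply, LinearEquiv.coe_coe, LinearEquiv.trans_apply,
      LinearEquiv.symm_apply_apply]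
    rfl
  have h2 := h1.symm
  refine ⟨G, subset_rfl, fun x => ?_⟩
  -- The orbit map of `x` is this inverse followed by `F` of the morphism from the regular module
  -- given by `x`.
  have h3 := (Functor.lifts_linMap (U := U) (F.map (NoriCat.ofElem X subset_rfl x))).comp h2
  convert h3 using 1
  refine LinearMap.ext fun u => ?_
  obtain ⟨e, rfl⟩ := ψ.surjective u
  refine (D.orbitMap_apply _ _ _ e).trans ?_
  have h4 : (b.symm ≪≫ₗ r ≪≫ₗ ψ).symm (ψ e) = b (r.symm e) := by
    simp
  refine Eq.trans ?_ (congrArg _ h4).symm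
  refine Eq.trans ?_ (isoEquiv_naturality β _ _).symm
  rw [NoriCat.lin_ofElem]
  exact congrArg (fun a => isoEquiv β X (X.act subset_rfl a x)) (r.apply_symm_apply e).symm

section

variable {F F' : NoriCat T ⥤ C} (β : NoriCat.forget T ≅ F ⋙ U) (β' : NoriCat.forget T ≅ F' ⋙ U)
  (h : ∀ X, D.Corresponds X (F.obj X) (isoEquiv β X))
  (h' : ∀ X, D.Corresponds X (F'.obj X) (isoEquiv β' X))

-- The required relation leaves only `β⁻¹ ≫ β'` as candidate. It lifts at each `X`, since `F X` and
-- `F' X` are counterparts of the same object, and naturality is checked after the faithful `U`.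
include h h' in
lemma exists_comparison : ∃ γ : F ≅ F', ∀ X, β.hom.app X ≫ U.map (γ.hom.app X) = β'.hom.app X := by
  have key : ∀ X, U.LiftsHom (A := F.obj X) (B := F'.obj X) (β.inv.app X ≫ β'.hom.app X) :=
    fun X => by
      obtain ⟨g, hg⟩ := (h X).lifts (h' X) (𝟙 X)
      exact ⟨g, FGModuleCat.hom_ext hg⟩
  choose g hg using key
  have hi : ∀ X, IsIso (g X) := fun X => by
    have : IsIso (U.map (g X)) := by
      rw [hg]
      infer_instance
    refine Functor.isIso_of_bijective (U := U) (g X) ?_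
    exact ((isoToLinearEquiv (asIso (U.map (g X))))).bijective
  refine ⟨NatIso.ofComponents (fun X => @asIso _ _ _ _ (g X) (hi X)) fun {X Y} f =>
    U.map_injective ?_, fun X => ?_⟩
  · change U.map (F.map f ≫ g Y) = U.map (g X ≫ F'.map f)
    rw [U.map_comp, U.map_comp, hg, hg]
    have h1 := β.inv.naturality f
    have h2 := β'.hom.naturality f
    simp only [Functor.comp_map] at h1 h2
    rw [reassoc_of% h1, h2, Category.assoc]
  · change β.hom.app X ≫ U.map (g X) = _
    rw [hg, Iso.hom_inv_id_app_assoc]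

end

variable (D)

/-- A counterpart in `C` of an object of `C(T)`. -/
def functorObj (X : NoriCat T) : C := (D.exists_corresponds X).choose

/-- The identification of the underlying modules of an object and its counterpart. -/
def functorEquiv (X : NoriCat T) : X.carrier ≃ₗ[Λ] U.obj (D.functorObj X) :=
  (D.exists_corresponds X).choose_spec.choose

lemma corresponds_functorObj (X : NoriCat T) :
    D.Corresponds X (D.functorObj X) (D.functorEquiv X) :=
  (D.exists_corresponds X).choose_spec.choose_spec

/-- The counterpart of a morphism of `C(T)`. -/
def functorMap {X Y : NoriCat T} (f : X ⟶ Y) : D.functorObj X ⟶ D.functorObj Y :=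
  ((D.corresponds_functorObj X).lifts (D.corresponds_functorObj Y) f).choose

lemma linMap_functorMap {X Y : NoriCat T} (f : X ⟶ Y) :
    U.linMap (D.functorMap f) =
      (D.functorEquiv Y).toLinearMap ∘ₗ NoriCat.lin f ∘ₗ (D.functorEquiv X).symm.toLinearMap :=
  ((D.corresponds_functorObj X).lifts (D.corresponds_functorObj Y) f).choose_spec

/-- The functor `C(T) ⥤ C` given by a factorization. -/
def functor : NoriCat T ⥤ C where
  obj := D.functorObj
  map := D.functorMap
  map_id X := Functor.linMap_injective (U := U) <| by
    rw [linMap_functorMap, Functor.linMap_id]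
    ext x
    simp
  map_comp f g := Functor.linMap_injective (U := U) <| by
    rw [linMap_functorMap, Functor.linMap_comp, linMap_functorMap, linMap_functorMap]
    ext x
    simp

/-- The functor is compatible with the functors to modules. -/
def functorIso : NoriCat.forget T ≅ D.functor ⋙ U :=
  NatIso.ofComponents (fun X => LinearEquiv.toFGModuleCatIso (D.functorEquiv X)) fun {X Y} f => by
    refine FGModuleCat.hom_ext (LinearMap.ext fun x => ?_)
    refine Eq.trans ?_ (LinearMap.congr_fun (D.linMap_functorMap f) (D.functorEquiv X x)).symm
    exact congrArg (fun z => D.functorEquiv Y (NoriCat.lin f z))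
      ((D.functorEquiv X).symm_apply_apply x).symm

lemma corresponds_functor (X : NoriCat T) :
    D.Corresponds X (D.functor.obj X) (isoEquiv D.functorIso X) :=
  D.corresponds_functorObj X

/-- Both `S x` and the value of the functor are counterparts of `T̃ x`, so the identity of `T̃ x`
lifts to a morphism between them, which is bijective after `U`. -/
lemma exists_functor_rep (x : V) : ∃ α : S.obj x ≅ D.functor.obj ((NoriCat.rep T).obj x),
    U.linMap α.hom = (D.equiv x).trans (isoEquiv D.functorIso ((NoriCat.rep T).obj x)) := by
  obtain ⟨g, hg⟩ := (D.corresponds_rep x).lifts (D.corresponds_functor ((NoriCat.rep T).obj x)) (𝟙 _)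
  have : IsIso g := Functor.isIso_of_bijective (U := U) g (by
    have := ((D.equiv x).trans (isoEquiv D.functorIso ((NoriCat.rep T).obj x))).bijective
    rw [hg]
    exact this)
  exact ⟨asIso g, hg⟩

end Factorization

end

/-! ### Monoidal structures determined by a faithful monoidal functor -/

section

namespace CategoryTheory.Functor

open LaxMonoidal

variable {A : Type*} [Category* A] [MonoidalCategory A] {C : Type*} [Category* C]
  [MonoidalCategory C] {M : Type*} [Category* M] [MonoidalCategory M] {N : A ⥤ M} {F : A ⥤ C}
  {U : C ⥤ M} [N.Monoidal] [U.Monoidal]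

/-- Comparison isomorphisms for a functor `F` that become those of the monoidal functor `N` after
composition with a monoidal functor `U`. -/
structure MonoidalLift (β : N ≅ F ⋙ U) where
  /-- the unit comparison -/
  unit : 𝟙_ C ≅ F.obj (𝟙_ A)
  /-- the tensor comparison -/
  tensor : ∀ X Y : A, F.obj X ⊗ F.obj Y ≅ F.obj (X ⊗ Y)
  map_unit : ε U ≫ U.map unit.hom = ε N ≫ β.hom.app (𝟙_ A)
  map_tensor : ∀ X Y : A, (β.hom.app X ⊗ₘ β.hom.app Y) ≫ μ U (F.obj X) (F.obj Y) ≫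
    U.map (tensor X Y).hom = μ N X Y ≫ β.hom.app (X ⊗ Y)

namespace MonoidalLift

variable {β : N ≅ F ⋙ U} (m : MonoidalLift β)

lemma naturality {X Y : A} (f : X ⟶ Y) :
    β.hom.app X ≫ U.map (F.map f) = N.map f ≫ β.hom.app Y :=
  (β.hom.naturality f).symm

lemma hom_ext_tensor [U.Faithful] {X Y : A} {B : C} {f g : F.obj X ⊗ F.obj Y ⟶ B}
    (h : (β.hom.app X ⊗ₘ β.hom.app Y) ≫ μ U (F.obj X) (F.obj Y) ≫ U.map f =
      (β.hom.app X ⊗ₘ β.hom.app Y) ≫ μ U (F.obj X) (F.obj Y) ≫ U.map g) : f = g := by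
  apply U.map_injective
  have : IsIso (β.hom.app X ⊗ₘ β.hom.app Y) := inferInstance
  rwa [cancel_epi, cancel_epi] at h

lemma natural_left [U.Faithful] {X Y : A} (f : X ⟶ Y) (Z : A) :
    F.map f ▷ F.obj Z ≫ (m.tensor Y Z).hom = (m.tensor X Z).hom ≫ F.map (f ▷ Z) := by
  apply hom_ext_tensor (β := β)
  have h1 := reassoc_of% m.map_tensor X Z
  rw [U.map_comp, U.map_comp, ← μ_natural_left_assoc, h1, naturality, ← μ_natural_left_assoc,
    ← m.map_tensor Y Z]
  have h2 : (β.hom.app X ⊗ₘ β.hom.app Z) ≫ U.map (F.map f) ▷ U.obj (F.obj Z) =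
      N.map f ▷ N.obj Z ≫ (β.hom.app Y ⊗ₘ β.hom.app Z) := by
    rw [← tensorHom_id, ← tensorHom_id, tensorHom_comp_tensorHom, tensorHom_comp_tensorHom,
      naturality, Category.id_comp]
    exact congrArg _ (Category.comp_id _)
  rw [reassoc_of% h2]

lemma natural_right [U.Faithful] {X Y : A} (Z : A) (f : X ⟶ Y) :
    F.obj Z ◁ F.map f ≫ (m.tensor Z Y).hom = (m.tensor Z X).hom ≫ F.map (Z ◁ f) := by
  apply hom_ext_tensor (β := β)
  have h1 := reassoc_of% m.map_tensor Z X
  rw [U.map_comp, U.map_comp, ← μ_natural_right_assoc, h1, naturality, ← μ_natural_right_assoc,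
    ← m.map_tensor Z Y]
  have h2 : (β.hom.app Z ⊗ₘ β.hom.app X) ≫ U.obj (F.obj Z) ◁ U.map (F.map f) =
      N.obj Z ◁ N.map f ≫ (β.hom.app Z ⊗ₘ β.hom.app Y) := by
    rw [← id_tensorHom, ← id_tensorHom, tensorHom_comp_tensorHom, tensorHom_comp_tensorHom,
      naturality, Category.id_comp]
    exact congrArg (· ⊗ₘ _) (Category.comp_id _)
  rw [reassoc_of% h2]

lemma map_tensor_whiskerRight (X Y Z : A) :
    ((β.hom.app X ⊗ₘ β.hom.app Y) ⊗ₘ β.hom.app Z) ≫ μ U (F.obj X) (F.obj Y) ▷ U.obj (F.obj Z) ≫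
      U.map (m.tensor X Y).hom ▷ U.obj (F.obj Z) =
    μ N X Y ▷ N.obj Z ≫ (β.hom.app (X ⊗ Y) ⊗ₘ β.hom.app Z) := by
  rw [← comp_whiskerRight, ← tensorHom_id, ← tensorHom_id, tensorHom_comp_tensorHom,
    tensorHom_comp_tensorHom, m.map_tensor, Category.id_comp]
  exact congrArg _ (Category.comp_id _)

lemma map_whiskerLeft_tensor (X Y Z : A) :
    (β.hom.app X ⊗ₘ (β.hom.app Y ⊗ₘ β.hom.app Z)) ≫ U.obj (F.obj X) ◁ μ U (F.obj Y) (F.obj Z) ≫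
      U.obj (F.obj X) ◁ U.map (m.tensor Y Z).hom =
    N.obj X ◁ μ N Y Z ≫ (β.hom.app X ⊗ₘ β.hom.app (Y ⊗ Z)) := by
  rw [← MonoidalCategory.whiskerLeft_comp, ← id_tensorHom, ← id_tensorHom, tensorHom_comp_tensorHom,
    tensorHom_comp_tensorHom, m.map_tensor, Category.id_comp]
  exact congrArg (· ⊗ₘ _) (Category.comp_id _)

/-- After `U`, precompose with the isomorphisms `μ U` and `β`. Both sides then turn into the two
sides of the associativity law for `N`; the unit laws below are reduced to those of `N` in the same
way. -/
lemma associativity [U.Faithful] (X Y Z : A) :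
    (m.tensor X Y).hom ▷ F.obj Z ≫ (m.tensor (X ⊗ Y) Z).hom ≫ F.map (α_ X Y Z).hom =
      (α_ (F.obj X) (F.obj Y) (F.obj Z)).hom ≫ F.obj X ◁ (m.tensor Y Z).hom ≫
        (m.tensor X (Y ⊗ Z)).hom := by
  apply U.map_injective
  have i1 : IsIso ((β.hom.app X ⊗ₘ β.hom.app Y) ⊗ₘ β.hom.app Z) := inferInstance
  have i2 : IsIso (μ U (F.obj X) (F.obj Y) ▷ U.obj (F.obj Z)) := inferInstance
  rw [← cancel_epi (μ U (F.obj X ⊗ F.obj Y) (F.obj Z)),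
    ← cancel_epi (μ U (F.obj X) (F.obj Y) ▷ U.obj (F.obj Z)),
    ← cancel_epi ((β.hom.app X ⊗ₘ β.hom.app Y) ⊗ₘ β.hom.app Z)]
  simp only [U.map_comp]
  have e1 : ((β.hom.app X ⊗ₘ β.hom.app Y) ⊗ₘ β.hom.app Z) ≫
      μ U (F.obj X) (F.obj Y) ▷ U.obj (F.obj Z) ≫ μ U (F.obj X ⊗ F.obj Y) (F.obj Z) ≫
        U.map ((m.tensor X Y).hom ▷ F.obj Z) ≫ U.map (m.tensor (X ⊗ Y) Z).hom ≫
          U.map (F.map (α_ X Y Z).hom) =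
      μ N X Y ▷ N.obj Z ≫ μ N (X ⊗ Y) Z ≫ N.map (α_ X Y Z).hom ≫ β.hom.app _ := by
    rw [← μ_natural_left_assoc]
    have h1 := reassoc_of% m.map_tensor_whiskerRight X Y Z
    have h2 := reassoc_of% m.map_tensor (X ⊗ Y) Z
    refine (h1 _).trans ?_
    rw [h2, naturality]
  have e2 : ((β.hom.app X ⊗ₘ β.hom.app Y) ⊗ₘ β.hom.app Z) ≫
      μ U (F.obj X) (F.obj Y) ▷ U.obj (F.obj Z) ≫ μ U (F.obj X ⊗ F.obj Y) (F.obj Z) ≫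
        U.map (α_ (F.obj X) (F.obj Y) (F.obj Z)).hom ≫ U.map (F.obj X ◁ (m.tensor Y Z).hom) ≫
          U.map (m.tensor X (Y ⊗ Z)).hom =
      (α_ (N.obj X) (N.obj Y) (N.obj Z)).hom ≫ N.obj X ◁ μ N Y Z ≫ μ N X (Y ⊗ Z) ≫
        β.hom.app _ := by
    rw [LaxMonoidal.associativity_assoc, ← μ_natural_right_assoc]
    have h1 := reassoc_of% m.map_whiskerLeft_tensor X Y Z
    have h2 := m.map_tensor X (Y ⊗ Z)
    have h3 := associator_naturality (β.hom.app X) (β.hom.app Y) (β.hom.app Z)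
    refine ((reassoc_of% h3) _).trans ?_
    refine congrArg _ ((h1 _).trans ?_)
    rw [h2]
  rw [e1, e2, LaxMonoidal.associativity_assoc]

lemma left_unitality [U.Faithful] (X : A) : (λ_ (F.obj X)).hom =
    m.unit.hom ▷ F.obj X ≫ (m.tensor (𝟙_ A) X).hom ≫ F.map (λ_ X).hom := by
  apply U.map_injective
  rw [← cancel_epi (μ U (𝟙_ C) (F.obj X)), ← cancel_epi (ε U ▷ U.obj (F.obj X)),
    ← LaxMonoidal.left_unitality, ← cancel_epi (𝟙_ M ◁ β.hom.app X)]
  simp only [U.map_comp]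
  rw [← μ_natural_left_assoc]
  have h1 : 𝟙_ M ◁ β.hom.app X ≫ ε U ▷ U.obj (F.obj X) ≫ U.map m.unit.hom ▷ U.obj (F.obj X) =
      ε N ▷ N.obj X ≫ (β.hom.app (𝟙_ A) ⊗ₘ β.hom.app X) := by
    rw [← comp_whiskerRight, m.map_unit, ← id_tensorHom, ← tensorHom_id, ← tensorHom_id,
      tensorHom_comp_tensorHom, tensorHom_comp_tensorHom, Category.id_comp, Category.id_comp]
    exact congrArg _ (Category.comp_id _)
  have h2 := reassoc_of% m.map_tensor (𝟙_ A) X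
  refine (leftUnitor_naturality (β.hom.app X)).trans ?_
  refine Eq.trans ?_ ((reassoc_of% h1) _).symm
  rw [h2, naturality, LaxMonoidal.left_unitality]
  simp only [Category.assoc]

lemma right_unitality [U.Faithful] (X : A) : (ρ_ (F.obj X)).hom =
    F.obj X ◁ m.unit.hom ≫ (m.tensor X (𝟙_ A)).hom ≫ F.map (ρ_ X).hom := by
  apply U.map_injective
  rw [← cancel_epi (μ U (F.obj X) (𝟙_ C)), ← cancel_epi (U.obj (F.obj X) ◁ ε U),
    ← LaxMonoidal.right_unitality, ← cancel_epi (β.hom.app X ▷ 𝟙_ M)]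
  simp only [U.map_comp]
  rw [← μ_natural_right_assoc]
  have h1 : β.hom.app X ▷ 𝟙_ M ≫ U.obj (F.obj X) ◁ ε U ≫ U.obj (F.obj X) ◁ U.map m.unit.hom =
      N.obj X ◁ ε N ≫ (β.hom.app X ⊗ₘ β.hom.app (𝟙_ A)) := by
    rw [← MonoidalCategory.whiskerLeft_comp, m.map_unit, ← id_tensorHom, ← tensorHom_id, ← id_tensorHom,
      tensorHom_comp_tensorHom, tensorHom_comp_tensorHom, Category.id_comp, Category.id_comp]
    exact congrArg (· ⊗ₘ _) (Category.comp_id _)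
  have h2 := reassoc_of% m.map_tensor X (𝟙_ A)
  refine (rightUnitor_naturality (β.hom.app X)).trans ?_
  refine Eq.trans ?_ ((reassoc_of% h1) _).symm
  rw [h2, naturality, LaxMonoidal.right_unitality]
  simp only [Category.assoc]

/-- A functor with comparison isomorphisms that are compatible with a faithful monoidal functor is
monoidal. -/
@[reducible]
def monoidal [U.Faithful] : F.Monoidal :=
  CoreMonoidal.toMonoidal
    { εIso := m.unit
      μIso := m.tensor
      μIso_hom_natural_left := m.natural_left
      μIso_hom_natural_right := m.natural_right
      associativity := m.associativity
      left_unitality := m.left_unitality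
      right_unitality := m.right_unitality }

lemma isMonoidal [U.Faithful] : letI := m.monoidal
    NatTrans.IsMonoidal β.hom :=
  letI := m.monoidal
  { unit := m.map_unit.symm
    tensor := fun X Y => (m.map_tensor X Y).symm }

/-- If the given monoidal functors are braided, then so is the functor with comparison
isomorphisms. -/
@[reducible]
def braided {A : Type*} [Category* A] [MonoidalCategory A] [BraidedCategory A] {C : Type*}
    [Category* C] [MonoidalCategory C] [BraidedCategory C] {M : Type*} [Category* M]
    [MonoidalCategory M] [BraidedCategory M] {N : A ⥤ M} {F : A ⥤ C} {U : C ⥤ M} [N.Braided]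
    [U.Braided] {β : N ≅ F ⋙ U} (m : MonoidalLift β) [U.Faithful] : F.Braided :=
  letI := m.monoidal
  { m.monoidal with
    braided := fun X Y => by
      change (m.tensor X Y).hom ≫ F.map (β_ X Y).hom =
        (β_ (F.obj X) (F.obj Y)).hom ≫ (m.tensor Y X).hom
      apply hom_ext_tensor (β := β)
      have h1 := reassoc_of% m.map_tensor X Y
      have h2 := reassoc_of% Functor.LaxBraided.braided (F := U) (F.obj X) (F.obj Y)
      have h3 := BraidedCategory.braiding_naturality (β.hom.app X) (β.hom.app Y)
      rw [U.map_comp, U.map_comp, h1, naturality, h2, Functor.LaxBraided.braided_assoc,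
        ← m.map_tensor Y X]
      exact ((reassoc_of% h3) _).symm }

end MonoidalLift

end CategoryTheory.Functor

end

/-! ### Comparison of unit objects and tensor products -/

section

namespace CategoryTheory.Functor

open LaxMonoidal OplaxMonoidal

section

variable {A : Type*} [Category* A] [MonoidalCategory A] {C : Type*} [Category* C]
  [MonoidalCategory C] {M : Type*} [Category* M] [MonoidalCategory M] {N : A ⥤ M} {F : A ⥤ C}
  {U : C ⥤ M} [N.Monoidal] [U.Monoidal] (β : N ≅ F ⋙ U)

/-- The comparison of unit objects after applying `U`. -/
def unitComparison : U.obj (𝟙_ C) ≅ U.obj (F.obj (𝟙_ A)) :=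
  (Monoidal.εIso U).symm ≪≫ Monoidal.εIso N ≪≫ β.app (𝟙_ A)

/-- The comparison of tensor products after applying `U`. -/
def tensorComparison (X Y : A) : U.obj (F.obj X ⊗ F.obj Y) ≅ U.obj (F.obj (X ⊗ Y)) :=
  (Monoidal.μIso U (F.obj X) (F.obj Y)).symm ≪≫ (β.app X ⊗ᵢ β.app Y).symm ≪≫
    Monoidal.μIso N X Y ≪≫ β.app (X ⊗ Y)

lemma tensorComparison_hom (X Y : A) : (tensorComparison β X Y).hom = δ U (F.obj X) (F.obj Y) ≫
    (β.inv.app X ⊗ₘ β.inv.app Y) ≫ μ N X Y ≫ β.hom.app (X ⊗ Y) := rfl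

lemma inv_naturality {X Y : A} (f : X ⟶ Y) :
    U.map (F.map f) ≫ β.inv.app Y = β.inv.app X ≫ N.map f :=
  β.inv.naturality f

lemma tensorComparison_natural_left {X X' : A} (f : X ⟶ X') (Y : A) :
    U.map (F.map f ▷ F.obj Y) ≫ (tensorComparison β X' Y).hom =
      (tensorComparison β X Y).hom ≫ U.map (F.map (f ▷ Y)) := by
  have h : U.map (F.map f) ▷ U.obj (F.obj Y) ≫ (β.inv.app X' ⊗ₘ β.inv.app Y) =
      (β.inv.app X ⊗ₘ β.inv.app Y) ≫ N.map f ▷ N.obj Y := by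
    rw [← tensorHom_id, ← tensorHom_id, tensorHom_comp_tensorHom, tensorHom_comp_tensorHom,
      inv_naturality, Category.comp_id]
    exact congrArg _ (Category.id_comp _)
  rw [tensorComparison_hom, tensorComparison_hom, ← δ_natural_left_assoc]
  refine (congrArg (_ ≫ ·) ((reassoc_of% h) _)).trans ?_
  simp only [Category.assoc]
  rw [μ_natural_left_assoc]
  exact congrArg (fun k => _ ≫ _ ≫ _ ≫ k) (β.hom.naturality (f ▷ Y))

lemma tensorComparison_natural_right (X : A) {Y Y' : A} (f : Y ⟶ Y') :
    U.map (F.obj X ◁ F.map f) ≫ (tensorComparison β X Y').hom =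
      (tensorComparison β X Y).hom ≫ U.map (F.map (X ◁ f)) := by
  have h : U.obj (F.obj X) ◁ U.map (F.map f) ≫ (β.inv.app X ⊗ₘ β.inv.app Y') =
      (β.inv.app X ⊗ₘ β.inv.app Y) ≫ N.obj X ◁ N.map f := by
    rw [← id_tensorHom, ← id_tensorHom, tensorHom_comp_tensorHom, tensorHom_comp_tensorHom,
      inv_naturality, Category.comp_id]
    exact congrArg (· ⊗ₘ _) (Category.id_comp _)
  rw [tensorComparison_hom, tensorComparison_hom, ← δ_natural_right_assoc]
  refine (congrArg (_ ≫ ·) ((reassoc_of% h) _)).trans ?_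
  simp only [Category.assoc]
  rw [μ_natural_right_assoc]
  exact congrArg (fun k => _ ≫ _ ≫ _ ≫ k) (β.hom.naturality (X ◁ f))

/-- The comparison of tensor products as a transformation in the first variable. -/
def tensorComparisonFst (Y : A) :
    (F ⋙ tensorRight (F.obj Y)) ⋙ U ≅ (tensorRight Y ⋙ F) ⋙ U :=
  NatIso.ofComponents (fun X => tensorComparison β X Y) fun f =>
    tensorComparison_natural_left β f Y

/-- The comparison of tensor products as a transformation in the second variable. -/
def tensorComparisonSnd (X : A) :
    (F ⋙ tensorLeft (F.obj X)) ⋙ U ≅ (tensorLeft X ⋙ F) ⋙ U :=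
  NatIso.ofComponents (fun Y => tensorComparison β X Y) fun f =>
    tensorComparison_natural_right β X f

/-- Tensoring with an object on the right, after applying `F` and `U`. -/
def tensorRightComparison (Y : A) : (tensorRight Y ⋙ F) ⋙ U ≅ N ⋙ tensorRight (N.obj Y) :=
  isoWhiskerLeft (tensorRight Y) β.symm ≪≫ (Monoidal.commTensorRight N Y).symm

/-- Tensoring with an object on the left, after applying `F` and `U`. -/
def tensorLeftComparison [BraidedCategory M] (X : A) :
    (tensorLeft X ⋙ F) ⋙ U ≅ N ⋙ tensorRight (N.obj X) :=
  isoWhiskerLeft (tensorLeft X) β.symm ≪≫ (Monoidal.commTensorLeft N X).symm ≪≫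
    isoWhiskerLeft N (BraidedCategory.tensorLeftIsoTensorRight (N.obj X))

variable {β}

/-- The comparison isomorphisms given by lifts along `U`. -/
def MonoidalLift.ofLifts [U.ReflectsIsomorphisms] (h : U.LiftsHom (unitComparison β).hom)
    (h' : ∀ X Y, U.LiftsHom (tensorComparison β X Y).hom) : MonoidalLift β where
  unit := h.iso
  tensor X Y := (h' X Y).iso
  map_unit := by
    rw [LiftsHom.map_iso_hom]
    exact (Monoidal.εIso U).hom_inv_id_assoc _
  map_tensor X Y := by
    rw [LiftsHom.map_iso_hom, tensorComparison_hom, Monoidal.μ_δ_assoc]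
    rw [tensorHom_comp_tensorHom_assoc]
    have h1 : ∀ X, β.hom.app X ≫ β.inv.app X = 𝟙 _ := fun X => by simp
    rw [h1, h1, id_tensorHom_id, Category.id_comp]

lemma map_eq_unitComparison {p : A} {p' : C} (i : 𝟙_ A ≅ p) (j : 𝟙_ C ≅ p') (α : p' ≅ F.obj p)
    (θ : U.obj p' ⟶ N.obj p) (hα : U.map α.hom = θ ≫ β.hom.app p)
    (h : ε U ≫ U.map j.hom ≫ θ = ε N ≫ N.map i.hom) :
    U.map (j.hom ≫ α.hom ≫ F.map i.inv) = (unitComparison β).hom := by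
  rw [← cancel_epi (ε U)]
  refine Eq.trans ?_ ((Monoidal.εIso U).hom_inv_id_assoc _).symm
  rw [U.map_comp, U.map_comp, hα, Category.assoc, reassoc_of% h]
  have h1 : β.hom.app p ≫ U.map (F.map i.inv) = N.map i.inv ≫ β.hom.app (𝟙_ A) :=
    (β.hom.naturality i.inv).symm
  rw [h1, ← N.map_comp_assoc, i.hom_inv_id, N.map_id, Category.id_comp]
  rfl

/-- This produces the initial lifts of the tensor comparison: multiplicativity of a representation
in `C` allows it to be routed through the value at the product vertex, and `h` is the compatibility
of `θ` with the multiplicativity isomorphisms. -/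
lemma map_eq_tensorComparison {a b p : A} {a' b' p' : C} (i : p ≅ a ⊗ b) (j : p' ≅ a' ⊗ b')
    (αa : a' ≅ F.obj a) (αb : b' ≅ F.obj b) (αp : p' ≅ F.obj p) (θa : U.obj a' ⟶ N.obj a)
    (θb : U.obj b' ⟶ N.obj b) (θp : U.obj p' ⟶ N.obj p) (ha : U.map αa.hom = θa ≫ β.hom.app a)
    (hb : U.map αb.hom = θb ≫ β.hom.app b) (hp : U.map αp.hom = θp ≫ β.hom.app p)
    (h : θp ≫ N.map i.hom ≫ δ N a b = (U.map j.hom ≫ δ U a' b') ≫ (θa ⊗ₘ θb)) :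
    U.map ((αa.inv ⊗ₘ αb.inv) ≫ j.inv ≫ αp.hom ≫ F.map i.hom) =
      (tensorComparison β a b).hom := by
  have i1 : IsIso (αa.hom ⊗ₘ αb.hom) := inferInstance
  rw [← cancel_epi (U.map (αa.hom ⊗ₘ αb.hom)), ← U.map_comp, tensorHom_comp_tensorHom_assoc,
    αa.hom_inv_id, αb.hom_inv_id, id_tensorHom_id, Category.id_comp, tensorComparison_hom,
    ← cancel_epi (U.map j.hom)]
  rw [← U.map_comp, j.hom_inv_id_assoc, U.map_comp, hp, ← δ_natural_assoc, ha, hb]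
  have h1 : ((θa ≫ β.hom.app a) ⊗ₘ (θb ≫ β.hom.app b)) ≫ (β.inv.app a ⊗ₘ β.inv.app b) =
      θa ⊗ₘ θb := by
    have h2 : ∀ X, β.hom.app X ≫ β.inv.app X = 𝟙 _ := fun X => by simp
    rw [tensorHom_comp_tensorHom, Category.assoc, Category.assoc, h2, h2, Category.comp_id,
      Category.comp_id]
  have h3 : β.hom.app p ≫ U.map (F.map i.hom) = N.map i.hom ≫ β.hom.app (a ⊗ b) :=
    (β.hom.naturality i.hom).symm
  rw [Category.assoc, h3, reassoc_of% h1]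
  have h4 := h =≫ (μ N a b ≫ β.hom.app (a ⊗ b))
  simp only [Category.assoc, Monoidal.δ_μ_assoc] at h4
  exact h4

section

variable [F.Monoidal]

lemma map_ε_eq_unitComparison (hβ : NatTrans.IsMonoidal β.hom) :
    U.map (ε F) = (unitComparison β).hom := by
  rw [← cancel_epi (ε U)]
  refine Eq.trans ?_ ((Monoidal.εIso U).hom_inv_id_assoc _).symm
  exact hβ.unit.symm

/-- A monoidal `β` determines the tensor structure of `F` after `U`. This is why structure
compatibilities of lifts need only be checked on `β`. -/
lemma map_μ_eq_tensorComparison (hβ : NatTrans.IsMonoidal β.hom) (X Y : A) :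
    U.map (μ F X Y) = (tensorComparison β X Y).hom := by
  have i1 : IsIso (β.hom.app X ⊗ₘ β.hom.app Y) := inferInstance
  rw [← cancel_epi (μ U (F.obj X) (F.obj Y)), tensorComparison_hom, Monoidal.μ_δ_assoc,
    ← cancel_epi (β.hom.app X ⊗ₘ β.hom.app Y)]
  have h1 : ∀ X, β.hom.app X ≫ β.inv.app X = 𝟙 _ := fun X => by simp
  rw [tensorHom_comp_tensorHom_assoc, h1, h1, id_tensorHom_id, Category.id_comp]
  exact (hβ.tensor X Y).symm

end

/-- A natural isomorphism that is compatible with monoidal isomorphisms after applying a faithful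
functor is monoidal. -/
lemma isMonoidal_of_comp [U.Faithful] {F' : A ⥤ C} [F.Monoidal] [F'.Monoidal] {β' : N ≅ F' ⋙ U}
    (hβ : NatTrans.IsMonoidal β.hom) (hβ' : NatTrans.IsMonoidal β'.hom) (γ : F ⟶ F')
    (h : ∀ X, β.hom.app X ≫ U.map (γ.app X) = β'.hom.app X) : NatTrans.IsMonoidal γ where
  unit := U.map_injective <| by
    rw [U.map_comp, map_ε_eq_unitComparison hβ, map_ε_eq_unitComparison hβ', ← Iso.eq_inv_comp]
    simp only [unitComparison, Iso.trans_inv, Iso.symm_inv, Iso.trans_hom, Iso.symm_hom,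
      Category.assoc, Iso.inv_hom_id_assoc, Iso.hom_inv_id_assoc]
    exact ((Iso.eq_inv_comp (β.app (𝟙_ A))).2 (h (𝟙_ A)))
  tensor X Y := U.map_injective <| by
    rw [U.map_comp, U.map_comp, map_μ_eq_tensorComparison hβ, map_μ_eq_tensorComparison hβ',
      tensorComparison_hom, tensorComparison_hom, ← δ_natural_assoc]
    have h1 : ∀ X, U.map (γ.app X) ≫ β'.inv.app X = β.inv.app X := fun X => by
      have h2 : IsIso (β.hom.app X) := inferInstance
      rw [← cancel_epi (β.hom.app X), reassoc_of% h X, Iso.hom_inv_id_app, Iso.hom_inv_id_app]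
    rw [tensorHom_comp_tensorHom_assoc, h1, h1]
    simp only [Category.assoc, h]

end

end CategoryTheory.Functor

end

/-! ### The universal property -/

section

open GradedDiagram CommProductDiagram UnitalProductDiagram
open FGModuleCat
open CategoryTheory.Functor (linMap_comp_apply)

section Extension

variable {Λ : Type u} [CommRing Λ] [IsNoetherianRing Λ] {V : Type v} [UnitalProductDiagram.{w} V]
  {T : V ⥤q FGModuleCat.{u} Λ} {t : ProductData T} [MonoidalCategory (NoriCat T)]
  [SymmetricCategory (NoriCat T)] [(NoriCat.forget T).Braided]
  {C : Type u₁} [Category.{v₁} C] [Abelian C] [MonoidalCategory C] {U : C ⥤ FGModuleCat.{u} Λ}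
  [U.Additive] [U.Faithful] [PreservesFiniteLimits U] [PreservesFiniteColimits U] [U.Monoidal]
  {F : NoriCat T ⥤ C} {β : NoriCat.forget T ≅ F ⋙ U}

open CategoryTheory.Functor (tensorComparison tensorComparisonFst tensorComparisonSnd tensorRightComparison
  tensorLeftComparison)

/-- If the comparison of tensor products lifts on the values of the universal representation, then
it lifts. -/
lemma NoriCat.liftsHom_tensorComparison (ht : t.Admissible)
    (h : ∀ x y, U.LiftsHom
      (tensorComparison β ((NoriCat.rep T).obj x) ((NoriCat.rep T).obj y)).hom)
    (X Y : NoriCat T) : U.LiftsHom (tensorComparison β X Y).hom := by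
  -- As for associativity, both variables become regular modules while the other factor is flat, and
  -- only then arbitrary objects.
  have h1 : ∀ x G, U.LiftsHom (tensorComparison β ((rep T).obj x) (reg T G)).hom := fun x G =>
    have : Module.Flat Λ ((forget T).obj ((rep T).obj x)) := flat_rep ht x
    liftsHom_reg (tensorComparisonSnd β ((rep T).obj x)).hom (tensorLeftComparison β _) (h x) G
  have h2 : ∀ G' G, U.LiftsHom (tensorComparison β (reg T G') (reg T G)).hom := fun G' G =>
    have : Module.Flat Λ ((forget T).obj (reg T G)) := flat_reg ht G
    liftsHom_reg (tensorComparisonFst β (reg T G)).hom (tensorRightComparison β _)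
      (fun x => h1 x G) G'
  have h3 : ∀ X G, U.LiftsHom (tensorComparison β X (reg T G)).hom := fun X G =>
    liftsHom_of_reg (tensorComparisonFst β (reg T G)).hom
      (tensorComparisonFst β _ ≪≫ tensorRightComparison β _) (fun G' => h2 G' G) X
  exact liftsHom_of_reg (tensorComparisonSnd β X).hom
    (tensorComparisonSnd β _ ≪≫ tensorLeftComparison β _) (fun G => h3 X G) Y

end Extension

namespace Factorization

variable {Λ : Type u} [CommRing Λ] {V : Type v} [Quiver.{w} V] {T : V ⥤q FGModuleCat.{u} Λ}
  {C : Type u₁} [Category.{v₁} C] [Abelian C] [Linear Λ C] {U : C ⥤ FGModuleCat.{u} Λ} [U.Additive]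
  [U.Linear Λ] [U.Faithful] [PreservesFiniteLimits U] [PreservesFiniteColimits U]
  [IsNoetherianRing Λ] {S : V ⥤q C} (D : Factorization T U S)

/-- Followed by `U`, the functor becomes isomorphic to the forgetful functor, from which
faithfulness is inherited; linearity and exactness below follow from the same isomorphism. -/
lemma functor_faithful : D.functor.Faithful :=
  have : (D.functor ⋙ U).Faithful := Functor.Faithful.of_iso D.functorIso
  Functor.Faithful.of_comp D.functor U

lemma functor_additive : D.functor.Additive where
  map_add {X Y f g} := Functor.linMap_injective (U := U) <| LinearMap.ext fun z => by
    obtain ⟨x, rfl⟩ := (isoEquiv D.functorIso X).surjective z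
    rw [Functor.linMap_add, LinearMap.add_apply, isoEquiv_naturality, isoEquiv_naturality,
      isoEquiv_naturality]
    exact map_add _ _ _

lemma functor_linear : D.functor.Linear Λ where
  map_smul {X Y} f r := Functor.linMap_injective (U := U) <| LinearMap.ext fun z => by
    obtain ⟨x, rfl⟩ := (isoEquiv D.functorIso X).surjective z
    rw [Functor.linMap_smul, LinearMap.smul_apply, isoEquiv_naturality, isoEquiv_naturality]
    exact map_smul _ _ _

lemma functor_preservesFiniteLimits : PreservesFiniteLimits D.functor :=
  have : PreservesFiniteLimits (D.functor ⋙ U) := preservesFiniteLimits_of_natIso D.functorIso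
  preservesFiniteLimits_of_reflects_of_preserves D.functor U

lemma functor_preservesFiniteColimits : PreservesFiniteColimits D.functor :=
  have : PreservesFiniteColimits (D.functor ⋙ U) := preservesFiniteColimits_of_natIso D.functorIso
  preservesFiniteColimits_of_reflects_of_preserves D.functor U

end Factorization

section Universal

open Functor.LaxMonoidal Functor.OplaxMonoidal

variable {Λ : Type u} [CommRing Λ] [IsNoetherianRing Λ] {V : Type v} [UnitalProductDiagram.{w} V]
  {T : V ⥤q FGModuleCat.{u} Λ} {t : ProductData T} [MonoidalCategory (NoriCat T)]
  [SymmetricCategory (NoriCat T)] [(NoriCat.forget T).Braided] {t' : ProductData (NoriCat.rep T)}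
  {C : Type u₁} [Category.{v₁} C] [Abelian C] [Linear Λ C] [MonoidalCategory C]
  [SymmetricCategory C] {S : V ⥤q C} {s : ProductData S} {U : C ⥤ FGModuleCat.{u} Λ}
  [U.Additive] [U.Linear Λ] [U.Faithful] [PreservesFiniteLimits U] [PreservesFiniteColimits U]
  [U.Braided] (θ : ProductData.UGMIso (s.map U) t)

/-- The factorization given by a ugm isomorphism. -/
def ProductData.UGMIso.factorization : Factorization T U S where
  equiv x := isoToLinearEquiv (θ.app x)
  natural γ m := LinearMap.congr_fun (congrArg lin (θ.isTransformation.natural γ)) m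

variable (ht : t.Admissible) (h : IsNoriMonoidal t t') {F : NoriCat T ⥤ C}
  (β : NoriCat.forget T ≅ F ⋙ U) (α : ∀ x, S.obj x ≅ F.obj ((NoriCat.rep T).obj x))
  (hα : ∀ x, U.map (α x).hom = (θ.app x).hom ≫ β.hom.app ((NoriCat.rep T).obj x))

include h hα

lemma IsNoriMonoidal.map_unit : U.map (s.unitIso.hom ≫ (α one).hom ≫ F.map t'.unitIso.inv) =
    (Functor.unitComparison β).hom := by
  refine Functor.map_eq_unitComparison t'.unitIso s.unitIso (α one) (θ.app one).hom (hα one) ?_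
  have h1 : (ε U ≫ U.map s.unitIso.hom) ≫ (θ.app one).hom = t.unitIso.hom :=
    θ.isTransformation.unit
  have h2 : (ε (NoriCat.forget T) ≫ (NoriCat.forget T).map t'.unitIso.hom) ≫ 𝟙 (T.obj one) =
    t.unitIso.hom := h.forget_rep.unit
  rw [Category.assoc] at h1
  exact h1.trans (h2.symm.trans (Category.comp_id _))

lemma IsNoriMonoidal.map_tensor (x y : V) : U.map (((α x).inv ⊗ₘ (α y).inv) ≫ (s.τ x y).inv ≫
      (α (vprod x y)).hom ≫ F.map (t'.τ x y).hom) =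
    (Functor.tensorComparison β ((NoriCat.rep T).obj x) ((NoriCat.rep T).obj y)).hom := by
  refine Functor.map_eq_tensorComparison (t'.τ x y) (s.τ x y) (α x) (α y) (α (vprod x y))
    (θ.app x).hom (θ.app y).hom (θ.app (vprod x y)).hom (hα x) (hα y) (hα _) ?_
  have h1 : (θ.app (vprod x y)).hom ≫ (t.τ x y).hom =
      (U.map (s.τ x y).hom ≫ δ U (S.obj x) (S.obj y)) ≫ ((θ.app x).hom ⊗ₘ (θ.app y).hom) :=
    θ.isTransformation.tensor x y
  have h2 : 𝟙 (T.obj (vprod x y)) ≫ (t.τ x y).hom =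
      ((NoriCat.forget T).map (t'.τ x y).hom ≫ δ (NoriCat.forget T) _ _) ≫
        (𝟙 (T.obj x) ⊗ₘ 𝟙 (T.obj y)) := h.forget_rep.tensor x y
  have h3 : (t.τ x y).hom = (NoriCat.forget T).map (t'.τ x y).hom ≫ δ (NoriCat.forget T) _ _ :=
    (Category.id_comp _).symm.trans (h2.trans
      ((congrArg (_ ≫ ·) (id_tensorHom_id _ _)).trans (Category.comp_id _)))
  exact (congrArg (_ ≫ ·) h3.symm).trans h1

/-- After `U`, `α` is expressed through `θ` and `β`, and the structure maps of `F` are the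
comparison maps fixed by `β`. Since these are also computed through `α`, faithfulness of `U` gives
every compatibility. -/
lemma IsNoriMonoidal.isTransformation [F.Monoidal] (hβ : NatTrans.IsMonoidal β.hom) :
    ProductData.IsTransformation s (t'.map F) (fun x => (α x).hom) where
  natural {x y} γ := U.map_injective <| by
    rw [U.map_comp, U.map_comp, hα, hα]
    have h1 : U.map (S.map γ) ≫ (θ.app y).hom = (θ.app x).hom ≫ T.map γ :=
      θ.isTransformation.natural γ
    refine (Category.assoc _ _ _).symm.trans ((congrArg (· ≫ _) h1).trans ?_)
    exact (Category.assoc _ _ _).trans ((congrArg (_ ≫ ·)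
      (β.hom.naturality ((NoriCat.rep T).map γ))).trans (Category.assoc _ _ _).symm)
  tensor x y := by
    have h1 := (h.map_tensor θ β α hα x y).trans
      (Functor.map_μ_eq_tensorComparison hβ _ _).symm
    have h2 := U.map_injective h1
    change (α (vprod x y)).hom ≫ F.map (t'.τ x y).hom ≫ δ F _ _ = _
    rw [← cancel_mono (μ F ((NoriCat.rep T).obj x) ((NoriCat.rep T).obj y)), Category.assoc,
      Category.assoc, Category.assoc, Functor.Monoidal.δ_μ, Category.comp_id, ← h2,
      tensorHom_comp_tensorHom_assoc, Iso.hom_inv_id, Iso.hom_inv_id, id_tensorHom_id,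
      Category.id_comp, Iso.hom_inv_id_assoc]
  unit := by
    have h1 := (h.map_unit θ β α hα).trans (Functor.map_ε_eq_unitComparison hβ).symm
    have h2 := U.map_injective h1
    change _ = ε F ≫ F.map t'.unitIso.hom
    rw [← h2, Category.assoc, Category.assoc, ← F.map_comp, Iso.inv_hom_id, F.map_id,
      Category.comp_id]

omit hα in
include ht in
/-- The universal property of Nori's category: existence. -/
theorem IsNoriMonoidal.exists_lift : ∃ L : NoriLift t' θ, L.F.Faithful ∧
    PreservesFiniteLimits L.F ∧ PreservesFiniteColimits L.F ∧ L.F.Additive ∧ L.F.Linear Λ := by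
  let D := θ.factorization
  choose α hα using D.exists_functor_rep
  have hα' : ∀ x, U.map (α x).hom = (θ.app x).hom ≫
      D.functorIso.hom.app ((NoriCat.rep T).obj x) := fun x => FGModuleCat.hom_ext (hα x)
  -- The unit comparison lifts directly, through `S 1`; the tensor comparison lifts on the `T̃ v`
  -- through the ugm structure of `S` and then extends to all objects.
  let m : Functor.MonoidalLift D.functorIso := Functor.MonoidalLift.ofLifts
    ⟨_, h.map_unit θ D.functorIso α hα'⟩
    (NoriCat.liftsHom_tensorComparison ht fun x y => ⟨_, h.map_tensor θ D.functorIso α hα' x y⟩)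
  let _ := m.braided
  exact ⟨{
    F := D.functor
    α := ⟨α, h.isTransformation θ D.functorIso α hα' m.isMonoidal⟩
    β := D.functorIso
    isMonoidal := m.isMonoidal
    compat := hα' }, D.functor_faithful, D.functor_preservesFiniteLimits,
    D.functor_preservesFiniteColimits, D.functor_additive, D.functor_linear⟩

omit [IsNoetherianRing Λ] h hα

variable {θ}

/-- The compatibility of `α`, `β` and `θ` says that `α⁻¹` underlies `θ⁻¹` once modules are
identified by `β`, as required to recognize the values of `L.F` as counterparts. -/
lemma NoriLift.corresponds [IsNoetherianRing Λ] (L : NoriLift t' θ) (X : NoriCat T) :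
    θ.factorization.Corresponds X (L.F.obj X) (Factorization.isoEquiv L.β X) := by
  refine Factorization.corresponds_of_lift L.β (fun x => (L.α.app x).inv) (fun x m => ?_) X
  have h1 := LinearMap.congr_fun (congrArg lin (L.compat x)) ((θ.factorization.equiv x).symm m)
  have h2 : U.linMap (L.α.app x).hom ((θ.factorization.equiv x).symm m) =
      Factorization.isoEquiv L.β ((NoriCat.rep T).obj x) m :=
    h1.trans (congrArg (Factorization.isoEquiv L.β ((NoriCat.rep T).obj x))
      ((θ.factorization.equiv x).apply_symm_apply m))
  rw [← h2]
  exact Functor.linMap_hom_inv _ _ (L.α.app x) _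

/-- The universal property of Nori's category: uniqueness. -/
theorem NoriLift.existsUnique_iso [IsNoetherianRing Λ] (L' L : NoriLift t' θ) :
    ∃! γ : L'.F ≅ L.F, NatTrans.IsMonoidal γ.hom ∧
      (∀ x : V, (L'.α.app x).hom ≫ γ.hom.app ((NoriCat.rep T).obj x) = (L.α.app x).hom) ∧
      (∀ X : NoriCat T, L'.β.hom.app X ≫ U.map (γ.hom.app X) = L.β.hom.app X) := by
  obtain ⟨γ, hγ⟩ := Factorization.exists_comparison L'.β L.β L'.corresponds L.corresponds
  -- Compatibility with `β` alone forces the rest: monoidality and the relation with `α` hold after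
  -- `U`, hence in `C`.
  refine ⟨γ, ⟨Functor.isMonoidal_of_comp L'.isMonoidal L.isMonoidal γ.hom hγ,
    fun x => U.map_injective ?_, hγ⟩, ?_⟩
  · rw [U.map_comp, L'.compat, L.compat]
    exact (Category.assoc _ _ _).trans <| congrArg (_ ≫ ·) (hγ _)
  · rintro γ' ⟨-, -, hγ'⟩
    refine Iso.ext (NatTrans.ext (funext fun X => U.map_injective ?_))
    have h1 : IsIso (L'.β.hom.app X) := inferInstance
    rw [← cancel_epi (L'.β.hom.app X)]
    exact (hγ' X).trans (hγ X).symm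

end Universal

end

end

/-! ### Nori's category with its tensor product and universal property -/

theorem theoremA1 {Λ : Type u} [CommRing Λ] [IsNoetherianRing Λ]
    (hΛ : ∀ M : ModuleCat.{u} Λ, HasProjectiveDimensionLE M 2)
    {V : Type v} [UnitalProductDiagram.{w} V]
    (T : V ⥤q FGModuleCat.{u} Λ) (t : ProductData T) (ht : t.IsUGM)
    (hT : ∀ v : V, Module.Projective Λ (T.obj v)) :
    -- Nori's category is abelian and its forgetful functor is faithful, exact and linear
    (∃ A : Abelian (NoriCat T), A.toPreadditive = (inferInstance : Preadditive (NoriCat T))) ∧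
    (NoriCat.forget T).Faithful ∧ (NoriCat.forget T).Additive ∧ (NoriCat.forget T).Linear Λ ∧
    PreservesFiniteLimits (NoriCat.forget T) ∧
    PreservesFiniteColimits (NoriCat.forget T) ∧
    -- it carries a right exact symmetric monoidal structure compatible with `T`
    (∃ (_ : MonoidalCategory (NoriCat T)) (_ : SymmetricCategory (NoriCat T))
      (_ : (NoriCat.forget T).Braided) (t' : ProductData (NoriCat.rep T)),
      IsNoriMonoidal t t') ∧
    -- and with any such structure it has the universal property
    ∀ [MonoidalCategory (NoriCat T)] [SymmetricCategory (NoriCat T)]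
      [(NoriCat.forget T).Braided] (t' : ProductData (NoriCat.rep T)),
      IsNoriMonoidal t t' →
      ∀ (C : Type u₁) [Category.{v₁} C] [Abelian C] [Linear Λ C] [MonoidalCategory C]
        [SymmetricCategory C] [RightExactMonoidal Λ C]
        (S : V ⥤q C) (s : ProductData S) (_ : s.IsUGM)
        (fS : C ⥤ FGModuleCat.{u} Λ) [fS.Additive] [fS.Linear Λ] [fS.Faithful]
        [PreservesFiniteLimits fS] [PreservesFiniteColimits fS] [fS.Braided]
        (θ : ProductData.UGMIso (s.map fS) t),
        ∃ L : NoriLift t' θ,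
          (L.F.Faithful ∧ PreservesFiniteLimits L.F ∧ PreservesFiniteColimits L.F ∧
            L.F.Additive ∧ L.F.Linear Λ) ∧
          ∀ L' : NoriLift t' θ, ∃! γ : L'.F ≅ L.F,
            NatTrans.IsMonoidal γ.hom ∧
            (∀ v : V, (L'.α.app v).hom ≫ γ.hom.app ((NoriCat.rep T).obj v) =
              (L.α.app v).hom) ∧
            (∀ X : NoriCat T, L'.β.hom.app X ≫ fS.map (γ.hom.app X) = L.β.hom.app X) := by
  have hadm : t.Admissible := ⟨hΛ, hT, ht⟩
  refine ⟨⟨inferInstance, NoriCat.abelian_toPreadditive⟩, inferInstance, inferInstance,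
    inferInstance, inferInstance, inferInstance, NoriCat.exists_isNoriMonoidal hadm, ?_⟩
  intro _ _ _ t' h C _ _ _ _ _ _ S s _ fS _ _ _ _ _ _ θ
  obtain ⟨L, hL⟩ := h.exists_lift θ hadm
  exact ⟨L, hL, fun L' => L'.existsUnique_iso L⟩
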